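/- Let $R$ be an integral domain (commutative), $n\ge 1$, and let $\sigma=(\sigma_1^{1/2},\dots,\sigma_n^{1/2})$ be commuting ring automorphisms of $R$; put $\sigma_i^{k/2}=(\sigma_i^{1/2})^k$ for $k\in\mathbb Z$, $\sigma_i=\sigma_i^{2/2}$. For $t\in R^n$ let $\tilde A(t)$ be the ring obtained from $R$ by adjoining $X_1^\pm,\dots,X_n^\pm$ subject to $$X_i^\pm r=\sigma_i^{\pm1}(r)X_i^\pm,\qquad X_i^\pm X_i^\mp=\sigma_i^{\pm1/2}(t_i),\qquad [X_i^\pm,X_j^\mp]=0\ (i\ne j),$$ and let $A(t)$ be the quotient of $\tilde A(t)$ by the ideal $\{a\mid \exists r\in R\setminus\{0\}: ra=0\}$ (the twisted generalized Weyl algebra). Let $\Omega$ be the set of $t\in(R\setminus\{0\})^n$ for which $R\to A(t)$ is injective. Let $\mathcal O$ be a torsion-free orbit of $\mathbb Z^n$ acting on $\mathrm{MaxSpec}(R)$ by $g\cdot\mathfrak m=\sigma_1^{g_1}\cdots\sigma_n^{g_n}(\mathfrak m)$, i.e. an orbit with trivial stabilizers. Let $A(t)\text{-wmod}_{\mathcal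 O}$ be the category of $A(t)$-modules $M$ with $M=\bigoplus_{\mathfrak m} M_{\mathfrak m}$, $M_{\mathfrak m}=\{v\mid\mathfrak m v=0\}$, such that every $M_{\mathfrak m}$ is finite dimensional over $R/\mathfrak m$ and $M_{\mathfrak m}=0$ for $\mathfrak m\notin\mathcal O$. Let $K_0$ and $K_0^{\rm split}$ denote its Grothendieck group and split Grothendieck group. Let $\Gamma\subset\Omega$ be a submonoid of $R^n$ (componentwise multiplication, $\boldsymbol 1\in\Gamma$) on which the tensor product is defined: for $t,t'\in\Gamma$, $M\in A(t)\text{-wmod}_{\mathcal O}$ and $M'\in A(t')\text{-wmod}_{\mathcal O}$, the diagonal action $r(v\otimes v')=rv\otimes v'$, $X_i^\pm(v\otimes v')=X_i^\pm v\otimes X_i^\pm v'$ of $\tilde A(tt')$ on $M\otimes_R M'$ factors through $A(tt')$. (This is automatic, for instance, if $R$ is a Dedekind or a Bézout domain.) For a submonoid $\Gamma_1\subset\Gamma$ put $$\mathscr A(\Gamma_1,\mathcal O)=\bigoplus_{t\in\Gamma_1}\mathbb C\otimes_{\mathbb Z}K_0(A(t)\text{-wmod}_{\mathcal O}),\qquad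 \mathscr A^{\rm split}(\Gamma_1,\mathcal O)=\bigoplus_{t\in\Gamma_1}\mathbb C\otimes_{\mathbb Z}K_0^{\rm split}(A(t)\text{-wmod}_{\mathcal O}),$$ graded algebras with product $[M]\cdot[M']=[M\otimes_R M']$. Let $\Gamma^\times$ be the submonoid of all $t\in\Gamma$ such that $\sigma_i^{1/2}(t_i)\notin\mathfrak m$ for all $i$ and all $\mathfrak m\in\mathcal O$, and let $\Gamma/\Gamma^\times$ be the quotient monoid, in which $s,t\in \Gamma$ are identified if $us=vt$ for some $u,v\in\Gamma^\times$. Let $\mathscr A(\Gamma/\Gamma^\times,\mathcal O)$ be the quotient of $\mathscr A(\Gamma,\mathcal O)$ by the ideal generated by all $[M]-[M\otimes_R S]$, where $M\in A(t)\text{-wmod}_{\mathcal O}$ with $t\in\Gamma$ and $S$ is a simple object of $A(u)\text{-wmod}_{\mathcal O}$ with $u\in\Gamma^\times$; define $\mathscr A^{\rm split}(\Gamma/\Gamma^\times,\mathcal O)$ in the same way. Both are graded by $\Gamma/\Gamma^\times$. Suppose that $\boldsymbol 1\to\Gamma^\times\to\Gamma\to\Gamma/\Gamma^\times\to\boldsymbol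 1$ splits: there is a submonoid $\Gamma'\subset\Gamma$ such that every $t\in\Gamma$ can be written in exactly one way as $t=t^\times t'$ with $t^\times\in\Gamma^\times$ and $t'\in\Gamma'$. Then the composite $\Gamma'\to\Gamma\to\Gamma/\Gamma^\times$ is an isomorphism of monoids, and there are isomorphisms of graded $\mathbb C$-algebras $$\mathscr A(\Gamma/\Gamma^\times,\mathcal O)\simeq\mathscr A(\Gamma',\mathcal O),\qquad \mathscr A(\Gamma,\mathcal O)\simeq\mathbb C[\Gamma^\times]\otimes_{\mathbb C}\mathscr A(\Gamma',\mathcal O),$$ $$\mathscr A^{\rm split}(\Gamma/\Gamma^\times,\mathcal O)\simeq\mathscr A^{\rm split}(\Gamma',\mathcal O),\qquad \mathscr A^{\rm split}(\Gamma,\mathcal O)\simeq\mathbb C[\Gamma^\times]\otimes_{\mathbb C}\mathscr A^{\rm split}(\Gamma',\mathcal O),$$ where the gradings by $\Gamma/\Gamma^\times$ and $\Gamma'$ are identified through this isomorphism, and $u\otimes x$ with $u\in\Gamma^\times$, $x$ of degree $t'$, has degree $ut'$. -/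

import Mathlib

open scoped TensorProduct DirectSum

noncomputable section

namespace TGWATower

universe u

set_option linter.unusedSectionVars false

section Algebra

variable {R : Type u} [CommRing R] {n : ℕ}

/-! ### Twisted generalized Weyl algebras

`σ i` plays the role of `σ_i^{1/2}`, so that `(σ i) ^ (2 : ℤ)` is `σ_i`. A sign is an element
`ε : ℤˣ` (that is `1` or `-1`), and `X i ε` is the generator `X_i^ε`. -/

/-- Free generators: the elements of `R`, and the `2n` letters `X_i^ε`. -/
abbrev Gen (R : Type u) (n : ℕ) : Type u := R ⊕ (Fin n × ℤˣ)

/-- The letter of `r : R` in the free ring. -/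
def letR (n : ℕ) (r : R) : FreeAlgebra ℤ (Gen R n) := FreeAlgebra.ι ℤ (Sum.inl r)

/-- The letter `X_i^ε` in the free ring. -/
def letX (R : Type u) {n : ℕ} (i : Fin n) (ε : ℤˣ) : FreeAlgebra ℤ (Gen R n) :=
  FreeAlgebra.ι ℤ (Sum.inr (i, ε))

/-- The defining relations of the twisted generalized Weyl construction. The first three say that
the elements of `R` are multiplied and added as in `R`. -/
inductive Rel (σ : Fin n → RingAut R) (t : Fin n → R) :
    FreeAlgebra ℤ (Gen R n) → FreeAlgebra ℤ (Gen R n) → Prop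
  | one : Rel σ t (letR n 1) 1
  | add (r s : R) : Rel σ t (letR n (r + s)) (letR n r + letR n s)
  | mul (r s : R) : Rel σ t (letR n (r * s)) (letR n r * letR n s)
  | twist (i : Fin n) (ε : ℤˣ) (r : R) :
      Rel σ t (letX R i ε * letR n r) (letR n (((σ i) ^ (2 * (ε : ℤ))) r) * letX R i ε)
  | same (i : Fin n) (ε : ℤˣ) :
      Rel σ t (letX R i ε * letX R i (-ε)) (letR n (((σ i) ^ (ε : ℤ)) (t i)))
  | comm (i j : Fin n) (ε : ℤˣ) (h : i ≠ j) :
      Rel σ t (letX R i ε * letX R j (-ε)) (letX R j (-ε) * letX R i ε)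

/-- The twisted generalized Weyl construction. -/
def TGWC (σ : Fin n → RingAut R) (t : Fin n → R) : Type u := RingQuot (Rel σ t)

instance (σ : Fin n → RingAut R) (t : Fin n → R) : Ring (TGWC σ t) :=
  inferInstanceAs (Ring (RingQuot (Rel σ t)))

namespace TGWC

variable (σ : Fin n → RingAut R) (t : Fin n → R)

/-- The projection from the free ring. -/
def mk : FreeAlgebra ℤ (Gen R n) →+* TGWC σ t := RingQuot.mkRingHom (Rel σ t)

/-- The canonical ring homomorphism from `R`. -/
def ofR : R →+* TGWC σ t where
  toFun r := mk σ t (letR n r)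
  map_one' := by rw [← map_one (mk σ t)]; exact RingQuot.mkRingHom_rel .one
  map_mul' r s := by rw [← map_mul]; exact RingQuot.mkRingHom_rel (.mul r s)
  map_zero' := by
    have h : mk σ t (letR n (0 + 0)) = mk σ t (letR n 0) + mk σ t (letR n 0) := by
      rw [← map_add]; exact RingQuot.mkRingHom_rel (.add 0 0)
    simpa using h
  map_add' r s := by rw [← map_add]; exact RingQuot.mkRingHom_rel (.add r s)

/-- The universal property: a ring homomorphism from the free ring that respects the defining
relations descends. -/
def lift {T : Type u} [Ring T] (f : FreeAlgebra ℤ (Gen R n) →+* T)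
    (h : ∀ ⦃x y⦄, Rel σ t x y → f x = f y) : TGWC σ t →+* T := RingQuot.lift ⟨f, h⟩

theorem lift_mk {T : Type u} [Ring T] (f : FreeAlgebra ℤ (Gen R n) →+* T)
    (h : ∀ ⦃x y⦄, Rel σ t x y → f x = f y) (x) : lift σ t f h (mk σ t x) = f x :=
  RingQuot.lift_mkRingHom_apply f h x

/-- The generator `X_i^ε`. -/
def X (i : Fin n) (ε : ℤˣ) : TGWC σ t := mk σ t (letX R i ε)

theorem X_mul_ofR (i : Fin n) (ε : ℤˣ) (r : R) :
    X σ t i ε * ofR σ t r = ofR σ t (((σ i) ^ (2 * (ε : ℤ))) r) * X σ t i ε := by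
  change mk σ t _ * mk σ t _ = mk σ t _ * mk σ t _
  rw [← map_mul, ← map_mul]
  exact RingQuot.mkRingHom_rel (.twist i ε r)

theorem X_mul_X_neg (i : Fin n) (ε : ℤˣ) :
    X σ t i ε * X σ t i (-ε) = ofR σ t (((σ i) ^ (ε : ℤ)) (t i)) := by
  change mk σ t _ * mk σ t _ = mk σ t _
  rw [← map_mul]
  exact RingQuot.mkRingHom_rel (.same i ε)

theorem X_mul_X_of_ne (i j : Fin n) (ε : ℤˣ) (h : i ≠ j) :
    X σ t i ε * X σ t j (-ε) = X σ t j (-ε) * X σ t i ε := by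
  change mk σ t _ * mk σ t _ = mk σ t _ * mk σ t _
  rw [← map_mul, ← map_mul]
  exact RingQuot.mkRingHom_rel (.comm i j ε h)

variable {σ t} in
theorem induction {P : TGWC σ t → Prop} (hR : ∀ r, P (ofR σ t r)) (hX : ∀ i ε, P (X σ t i ε))
    (hadd : ∀ a b, P a → P b → P (a + b)) (hmul : ∀ a b, P a → P b → P (a * b)) (a) : P a := by
  obtain ⟨a, rfl⟩ := RingQuot.mkRingHom_surjective (Rel σ t) a
  change P (mk σ t a)
  induction a using FreeAlgebra.induction with
  | grade0 z =>
    have : mk σ t (algebraMap ℤ _ z) = ofR σ t z := by simp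
    rw [this]; exact hR _
  | grade1 x =>
    rcases x with r | ⟨i, ε⟩
    · exact hR r
    · exact hX i ε
  | mul a b ha hb => rw [map_mul]; exact hmul _ _ ha hb
  | add a b ha hb => rw [map_add]; exact hadd _ _ ha hb

end TGWC

end Algebra

variable {R : Type u} [CommRing R] [IsDomain R] {n : ℕ}

/-- The two-sided ideal of `R`-torsion elements `{a | ∃ r ≠ 0, r a = 0}`. -/
def torsionIdeal (σ : Fin n → RingAut R) (t : Fin n → R) : TwoSidedIdeal (TGWC σ t) :=
  .mk' {a | ∃ r : R, r ≠ 0 ∧ TGWC.ofR σ t r * a = 0}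
    ⟨1, one_ne_zero, by simp⟩
    (by
      rintro x y ⟨r, hr, hx⟩ ⟨s, hs, hy⟩
      refine ⟨r * s, mul_ne_zero hr hs, ?_⟩
      rw [mul_add, map_mul, mul_assoc _ _ y, hy, ← map_mul, mul_comm r s, map_mul, mul_assoc, hx]
      simp)
    (by rintro x ⟨r, hr, hx⟩; exact ⟨r, hr, by rw [mul_neg, hx, neg_zero]⟩)
    (by
      intro b
      induction b using TGWC.induction with
      | hR s =>
        rintro y ⟨r, hr, hy⟩
        exact ⟨r, hr, by rw [← mul_assoc, ← map_mul, mul_comm r s, map_mul, mul_assoc, hy,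
          mul_zero]⟩
      | hX i ε =>
        rintro y ⟨r, hr, hy⟩
        refine ⟨((σ i) ^ (2 * (ε : ℤ))) r, by simpa using hr, ?_⟩
        rw [← mul_assoc, ← TGWC.X_mul_ofR, mul_assoc, hy, mul_zero]
      | hadd a b ha hb =>
        intro y hy
        obtain ⟨r, hr, h1⟩ := ha hy
        obtain ⟨s, hs, h2⟩ := hb hy
        refine ⟨r * s, mul_ne_zero hr hs, ?_⟩
        rw [add_mul, mul_add, map_mul, mul_assoc _ _ (b * y), h2, ← map_mul, mul_comm r s, map_mul,
          mul_assoc, h1]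
        simp
      | hmul a b ha hb =>
        intro y hy
        have := ha (hb hy)
        rwa [mul_assoc])
    (by rintro x y ⟨r, hr, hx⟩; exact ⟨r, hr, by rw [← mul_assoc, hx, zero_mul]⟩)

theorem mem_torsionIdeal {σ : Fin n → RingAut R} {t : Fin n → R} {a : TGWC σ t} :
    a ∈ torsionIdeal σ t ↔ ∃ r : R, r ≠ 0 ∧ TGWC.ofR σ t r * a = 0 := by
  rw [torsionIdeal, TwoSidedIdeal.mem_mk']; rfl

/-- The twisted generalized Weyl algebra `A(t)`: the quotient of the twisted generalized Weyl
construction by its ideal of `R`-torsion elements. -/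
def TGWA (σ : Fin n → RingAut R) (t : Fin n → R) : Type u := (torsionIdeal σ t).ringCon.Quotient

instance (σ : Fin n → RingAut R) (t : Fin n → R) : Ring (TGWA σ t) :=
  inferInstanceAs (Ring (torsionIdeal σ t).ringCon.Quotient)

namespace TGWA

variable (σ : Fin n → RingAut R) (t : Fin n → R)

/-- The projection from the twisted generalized Weyl construction. -/
def proj : TGWC σ t →+* TGWA σ t := (torsionIdeal σ t).ringCon.mk'

theorem proj_surjective : Function.Surjective (proj σ t) := RingCon.mk'_surjective _

/-- The canonical map from `R`. -/
def ofR : R →+* TGWA σ t := (proj σ t).comp (TGWC.ofR σ t)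

/-- The generator `X_i^ε` of `A(t)`. -/
def X (i : Fin n) (ε : ℤˣ) : TGWA σ t := proj σ t (TGWC.X σ t i ε)

theorem proj_eq_zero {a : TGWC σ t} : proj σ t a = 0 ↔ a ∈ torsionIdeal σ t := by
  rw [← map_zero (proj σ t), TwoSidedIdeal.mem_iff]
  exact RingCon.eq _

theorem X_mul_ofR (i : Fin n) (ε : ℤˣ) (r : R) :
    X σ t i ε * ofR σ t r = ofR σ t (((σ i) ^ (2 * (ε : ℤ))) r) * X σ t i ε := by
  simp only [X, ofR, RingHom.comp_apply, ← map_mul, TGWC.X_mul_ofR]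

theorem X_mul_X_neg (i : Fin n) (ε : ℤˣ) :
    X σ t i ε * X σ t i (-ε) = ofR σ t (((σ i) ^ (ε : ℤ)) (t i)) := by
  simp only [X, ofR, RingHom.comp_apply, ← map_mul, TGWC.X_mul_X_neg]

theorem X_mul_X_of_ne (i j : Fin n) (ε : ℤˣ) (h : i ≠ j) :
    X σ t i ε * X σ t j (-ε) = X σ t j (-ε) * X σ t i ε := by
  simp only [X, ← map_mul, TGWC.X_mul_X_of_ne σ t i j ε h]

end TGWA

/-- `A(t)` is consistent if the canonical map `R → A(t)` is injective. -/
def IsConsistent (σ : Fin n → RingAut R) (t : Fin n → R) : Prop :=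
  Function.Injective (TGWA.ofR σ t)

/-- The set `Ω` of all `t ∈ (R ∖ {0})^n` with `A(t)` consistent. -/
def Omega (σ : Fin n → RingAut R) : Set (Fin n → R) :=
  {t | (∀ i, t i ≠ 0) ∧ IsConsistent σ t}

/-! ### Orbits in the maximal spectrum -/

/-- `σ_1^{g_1} ⋯ σ_n^{g_n}` (the `σ i` are the half-powers, hence the factor `2`). -/
def sigmaPow (σ : Fin n → RingAut R) (g : Fin n → ℤ) : RingAut R :=
  (List.ofFn fun i => (σ i) ^ (2 * g i)).prod

/-- The ideal `σ^g(m)`. -/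
def shift (σ : Fin n → RingAut R) (g : Fin n → ℤ) (m : MaximalSpectrum R) : Ideal R :=
  m.asIdeal.map (sigmaPow σ g : R ≃+* R)

/-- `O` is an orbit of `ℤ^n` on the maximal spectrum of `R`. -/
def IsOrbit (σ : Fin n → RingAut R) (O : Set (MaximalSpectrum R)) : Prop :=
  ∃ m₀ : MaximalSpectrum R, O = {m | ∃ g : Fin n → ℤ, m.asIdeal = shift σ g m₀}

/-- `O` is a torsion-free orbit: an orbit on which `ℤ^n` acts with trivial stabilizers. -/
def IsTorsionFreeOrbit (σ : Fin n → RingAut R) (O : Set (MaximalSpectrum R)) : Prop :=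
  IsOrbit σ O ∧ ∀ m ∈ O, ∀ g : Fin n → ℤ, shift σ g m = m.asIdeal → g = 0

/-- The submonoid of all `t ∈ R^n` such that no `σ_i^{1/2}(t_i)` lies in a maximal ideal of `O`. -/
def awayFrom (σ : Fin n → RingAut R) (O : Set (MaximalSpectrum R)) : Submonoid (Fin n → R) where
  carrier := {t | ∀ i, ∀ m ∈ O, σ i (t i) ∉ m.asIdeal}
  one_mem' := fun i m _ h => m.isMaximal.ne_top <| (Ideal.eq_top_iff_one _).2 <| by simpa using h
  mul_mem' := by
    intro s t hs ht i m hm h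
    rw [Pi.mul_apply, map_mul] at h
    exact (m.isMaximal.isPrime.mem_or_mem h).elim (hs i m hm) (ht i m hm)

/-- The submonoid `Γ^×` of `Γ`; for `Γ ⊆ Ω` this is `Γ ∩ Ω_O^×`, where `Ω_O^×` is the set of
`t ∈ Ω` such that no `σ_i^{1/2}(t_i)` lies in a maximal ideal of `O`. -/
def unitPart (σ : Fin n → RingAut R) (O : Set (MaximalSpectrum R)) (Γ : Submonoid (Fin n → R)) :
    Submonoid (Fin n → R) := Γ ⊓ awayFrom σ O

/-! ### Weight modules -/

/-- The weight space `M_m = {v | m v = 0}`. -/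
def weightSpace (M : Type u) [AddCommGroup M] [Module R M] (m : MaximalSpectrum R) :
    Submodule R M := Submodule.torsionBySet R M (m.asIdeal : Set R)

/-- The `R`-module structure of an `A(t)`-module is the one induced by `R → A(t)`. -/
class IsInduced (σ : Fin n → RingAut R) (t : Fin n → R) (M : Type u) [AddCommGroup M] [Module R M]
    [Module (TGWA σ t) M] : Prop where
  ofR_smul : ∀ (r : R) (v : M), TGWA.ofR σ t r • v = r • v

open Classical in
/-- The objects of `A(t)-wmod_O`: modules over `A(t)` that are the direct sum of their weight
spaces, with support in `O` and all weight spaces finite dimensional. The `R`-module structure is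
the one induced from the `A(t)`-module structure (so it is no additional data); `M_m` is finitely
generated over `R` if and only if it is finite dimensional over `R/m`. -/
structure WMod (σ : Fin n → RingAut R) (O : Set (MaximalSpectrum R)) (t : Fin n → R) :
    Type (u + 1) where
  carrier : Type u
  [addCommGroup : AddCommGroup carrier]
  [moduleR : Module R carrier]
  [moduleA : Module (TGWA σ t) carrier]
  [induced : IsInduced σ t carrier]
  isInternal : DirectSum.IsInternal fun m : MaximalSpectrum R => weightSpace carrier m
  finite : ∀ m : MaximalSpectrum R, Module.Finite R (weightSpace carrier m)
  support : ∀ m : MaximalSpectrum R, weightSpace carrier m ≠ ⊥ → m ∈ O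

attribute [instance] WMod.addCommGroup WMod.moduleR WMod.moduleA WMod.induced

instance (σ : Fin n → RingAut R) (O : Set (MaximalSpectrum R)) (t : Fin n → R) :
    CoeSort (WMod σ O t) (Type u) := ⟨WMod.carrier⟩

/-! ### The tensor product over `R` -/

section Diagonal

variable {σ : Fin n → RingAut R} {t t' : Fin n → R}
variable (M N : Type u) [AddCommGroup M] [Module R M] [Module (TGWA σ t) M] [IsInduced σ t M]
  [AddCommGroup N] [Module R N] [Module (TGWA σ t') N] [IsInduced σ t' N]

theorem X_smul_smul (i : Fin n) (ε : ℤˣ) (r : R) (v : M) :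
    TGWA.X σ t i ε • r • v = ((σ i) ^ (2 * (ε : ℤ))) r • TGWA.X σ t i ε • v := by
  rw [← IsInduced.ofR_smul (σ := σ) (t := t), ← mul_smul, TGWA.X_mul_ofR, mul_smul,
    IsInduced.ofR_smul]

/-- The operator `X_i^ε ⊗ X_i^ε` on `M ⊗_R N`. -/
def diagX (σ : Fin n → RingAut R) (t t' : Fin n → R) (M N : Type u)
    [AddCommGroup M] [Module R M] [Module (TGWA σ t) M] [IsInduced σ t M]
    [AddCommGroup N] [Module R N] [Module (TGWA σ t') N] [IsInduced σ t' N]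
    (i : Fin n) (ε : ℤˣ) : AddMonoid.End (M ⊗[R] N) :=
  TensorProduct.liftAddHom
    { toFun := fun v => ((TensorProduct.mk R M N (TGWA.X σ t i ε • v)).toAddMonoidHom).comp
        (DistribSMul.toAddMonoidHom N (TGWA.X σ t' i ε))
      map_zero' := by ext; simp
      map_add' := by intro v w; ext; simp }
    (by
      intro r v w
      simp only [AddMonoidHom.coe_mk, ZeroHom.coe_mk, AddMonoidHom.comp_apply,
        LinearMap.toAddMonoidHom_coe, TensorProduct.mk_apply, DistribSMul.toAddMonoidHom_apply]
      rw [X_smul_smul, X_smul_smul, TensorProduct.smul_tmul])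

@[simp] theorem diagX_tmul (i : Fin n) (ε : ℤˣ) (v : M) (w : N) :
    diagX σ t t' M N i ε (v ⊗ₜ w) = (TGWA.X σ t i ε • v) ⊗ₜ (TGWA.X σ t' i ε • w) := rfl

theorem end_ext {f g : M ⊗[R] N →+ M ⊗[R] N} (h : ∀ v w, f (v ⊗ₜ w) = g (v ⊗ₜ w)) : f = g := by
  apply AddMonoidHom.ext
  intro x
  induction x with
  | zero => rw [map_zero, map_zero]
  | tmul v w => exact h v w
  | add x y hx hy => rw [map_add, map_add, hx, hy]

/-- The diagonal action on `M ⊗_R N` of the twisted generalized Weyl construction with parameter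
`t t'`: an element `r : R` acts by `r (v ⊗ w) = (r v) ⊗ w = v ⊗ (r w)`, and `X_i^ε` acts by
`X_i^ε (v ⊗ w) = (X_i^ε v) ⊗ (X_i^ε w)`. -/
def diagAction (σ : Fin n → RingAut R) (t t' : Fin n → R) (M N : Type u)
    [AddCommGroup M] [Module R M] [Module (TGWA σ t) M] [IsInduced σ t M]
    [AddCommGroup N] [Module R N] [Module (TGWA σ t') N] [IsInduced σ t' N] :
    TGWC σ (t * t') →+* AddMonoid.End (M ⊗[R] N) :=
  TGWC.lift σ (t * t') (FreeAlgebra.lift ℤ (Sum.elim (fun r => Module.toAddMonoidEnd R (M ⊗[R] N) r)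
      fun p => diagX σ t t' M N p.1 p.2)).toRingHom <| by
    intro x y h
    induction h with
    | one => simp [letR]
    | add r s => simp [letR]
    | mul r s => simp [letR]
    | twist i ε r =>
      simp only [letX, letR, AlgHom.toRingHom_eq_coe, map_mul, RingHom.coe_coe,
        FreeAlgebra.lift_ι_apply, Sum.elim_inl, Sum.elim_inr]
      refine end_ext M N fun v w => ?_
      change diagX σ t t' M N i ε (r • (v ⊗ₜ w)) =
        (((σ i) ^ (2 * (ε : ℤ))) r) • diagX σ t t' M N i ε (v ⊗ₜ w)
      rw [TensorProduct.smul_tmul', diagX_tmul, diagX_tmul, X_smul_smul, TensorProduct.smul_tmul']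
    | same i ε =>
      simp only [letX, letR, AlgHom.toRingHom_eq_coe, map_mul, RingHom.coe_coe,
        FreeAlgebra.lift_ι_apply, Sum.elim_inl, Sum.elim_inr, Pi.mul_apply]
      refine end_ext M N fun v w => ?_
      change diagX σ t t' M N i ε (diagX σ t t' M N i (-ε) (v ⊗ₜ w)) =
        (((σ i) ^ (ε : ℤ)) (t i)) • (((σ i) ^ (ε : ℤ)) (t' i)) • (v ⊗ₜ[R] w)
      rw [diagX_tmul, diagX_tmul, ← mul_smul, ← mul_smul, TGWA.X_mul_X_neg, TGWA.X_mul_X_neg,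
        IsInduced.ofR_smul, IsInduced.ofR_smul, TensorProduct.smul_tmul_smul, ← mul_smul]
    | comm i j ε h =>
      simp only [letX, AlgHom.toRingHom_eq_coe, map_mul, RingHom.coe_coe,
        FreeAlgebra.lift_ι_apply, Sum.elim_inr]
      refine end_ext M N fun v w => ?_
      change diagX σ t t' M N i ε (diagX σ t t' M N j (-ε) (v ⊗ₜ w)) =
        diagX σ t t' M N j (-ε) (diagX σ t t' M N i ε (v ⊗ₜ w))
      simp only [diagX_tmul, ← mul_smul, TGWA.X_mul_X_of_ne _ _ i j ε h]

theorem diagAction_ofR (r : R) (x : M ⊗[R] N) :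
    diagAction σ t t' M N (TGWC.ofR σ (t * t') r) x = r • x := by
  change (diagAction σ t t' M N (TGWC.mk _ _ (letR n r)) : M ⊗[R] N → M ⊗[R] N) x = _
  rw [diagAction, TGWC.lift_mk]
  simp only [letR, AlgHom.toRingHom_eq_coe, RingHom.coe_coe, FreeAlgebra.lift_ι_apply,
    Sum.elim_inl]
  rfl

theorem diagAction_X (i : Fin n) (ε : ℤˣ) (v : M) (w : N) :
    diagAction σ t t' M N (TGWC.X σ (t * t') i ε) (v ⊗ₜ w) =
      (TGWA.X σ t i ε • v) ⊗ₜ (TGWA.X σ t' i ε • w) := by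
  change (diagAction σ t t' M N (TGWC.mk _ _ (letX R i ε)) : M ⊗[R] N → M ⊗[R] N) _ = _
  rw [diagAction, TGWC.lift_mk]
  simp only [letX, AlgHom.toRingHom_eq_coe, RingHom.coe_coe, FreeAlgebra.lift_ι_apply,
    Sum.elim_inr]
  rfl

end Diagonal

section Weight

variable {M N : Type u} [AddCommGroup M] [Module R M] [AddCommGroup N] [Module R N]

theorem mem_weightSpace {m : MaximalSpectrum R} {v : M} :
    v ∈ weightSpace M m ↔ ∀ r ∈ m.asIdeal, r • v = 0 := by
  simp [weightSpace, Submodule.mem_torsionBySet_iff]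

theorem sup_eq_top {m m' : MaximalSpectrum R} (h : m ≠ m') : m.asIdeal ⊔ m'.asIdeal = ⊤ :=
  Ideal.IsMaximal.coprime_of_ne m.isMaximal m'.isMaximal fun e => h (MaximalSpectrum.ext e)

theorem iSupIndep_weightSpace : iSupIndep fun m : MaximalSpectrum R => weightSpace M m := by
  rw [iSupIndep_iff_supIndep]
  intro S
  exact Submodule.supIndep_torsionBySet_ideal fun i _ j _ h => sup_eq_top h

theorem tmul_eq_zero {m m' : MaximalSpectrum R} (h : m ≠ m') {v : M} {w : N}
    (hv : v ∈ weightSpace M m) (hw : w ∈ weightSpace N m') : v ⊗ₜ[R] w = 0 := by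
  obtain ⟨a, ha, b, hb, hab⟩ := Submodule.mem_sup.1
    ((Ideal.eq_top_iff_one _).1 (sup_eq_top h))
  have h1 : (a + b) • (v ⊗ₜ[R] w) = 0 := by
    rw [add_smul, TensorProduct.smul_tmul', ← TensorProduct.tmul_smul, mem_weightSpace.1 hv a ha,
      mem_weightSpace.1 hw b hb, TensorProduct.zero_tmul, TensorProduct.tmul_zero, add_zero]
  rwa [hab, one_smul] at h1

/-- The image of `M_m ⊗ N_m` in `M ⊗_R N`. -/
def weightTensor (M N : Type u) [AddCommGroup M] [Module R M] [AddCommGroup N] [Module R N]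
    (m : MaximalSpectrum R) : Submodule R (M ⊗[R] N) :=
  LinearMap.range (TensorProduct.map (weightSpace M m).subtype (weightSpace N m).subtype)

theorem tmul_mem_weightTensor {m : MaximalSpectrum R} {v : M} {w : N}
    (hv : v ∈ weightSpace M m) (hw : w ∈ weightSpace N m) : v ⊗ₜ[R] w ∈ weightTensor M N m :=
  ⟨(⟨v, hv⟩ : weightSpace M m) ⊗ₜ (⟨w, hw⟩ : weightSpace N m), by simp⟩

theorem weightTensor_le (m : MaximalSpectrum R) :
    weightTensor M N m ≤ weightSpace (M ⊗[R] N) m := by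
  rintro _ ⟨x, rfl⟩
  induction x with
  | zero => simp
  | tmul v w =>
    rw [TensorProduct.map_tmul, mem_weightSpace]
    intro r hr
    rw [TensorProduct.smul_tmul']
    simp [mem_weightSpace.1 v.2 r hr]
  | add x y hx hy => rw [map_add]; exact add_mem hx hy

theorem iSup_weightTensor (hM : ⨆ m : MaximalSpectrum R, weightSpace M m = ⊤)
    (hN : ⨆ m : MaximalSpectrum R, weightSpace N m = ⊤) : ⨆ m, weightTensor (R := R) M N m = ⊤ := by
  rw [eq_top_iff]
  rintro x -
  induction x with
  | zero => exact zero_mem _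
  | add x y hx hy => exact add_mem hx hy
  | tmul v w =>
    have hv : v ∈ ⨆ m : MaximalSpectrum R, weightSpace M m := hM ▸ Submodule.mem_top
    have hw : w ∈ ⨆ m : MaximalSpectrum R, weightSpace N m := hN ▸ Submodule.mem_top
    induction hv using Submodule.iSup_induction' with
    | zero => rw [TensorProduct.zero_tmul]; exact zero_mem _
    | add x y _ _ hx hy => rw [TensorProduct.add_tmul]; exact add_mem hx hy
    | mem m v hv =>
      induction hw using Submodule.iSup_induction' with
      | zero => rw [TensorProduct.tmul_zero]; exact zero_mem _
      | add x y _ _ hx hy => rw [TensorProduct.tmul_add]; exact add_mem hx hy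
      | mem m' w hw =>
        by_cases h : m = m'
        · subst h
          exact Submodule.mem_iSup_of_mem m (tmul_mem_weightTensor hv hw)
        · rw [tmul_eq_zero h hv hw]; exact zero_mem _

theorem weightTensor_eq (hM : ⨆ m : MaximalSpectrum R, weightSpace M m = ⊤)
    (hN : ⨆ m : MaximalSpectrum R, weightSpace N m = ⊤) (m : MaximalSpectrum R) :
    weightTensor M N m = weightSpace (M ⊗[R] N) m := by
  refine le_antisymm (weightTensor_le m) fun x hx => ?_
  have hx' : x ∈ weightTensor M N m ⊔ ⨆ (j) (_ : j ≠ m), weightTensor M N j := by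
    have : weightTensor M N m ⊔ ⨆ (j) (_ : j ≠ m), weightTensor M N j = ⊤ := by
      rw [← iSup_weightTensor hM hN]
      refine le_antisymm (sup_le (le_iSup _ m) (iSup₂_le fun j _ => le_iSup _ j)) ?_
      refine iSup_le fun j => ?_
      by_cases h : j = m
      · subst h; exact le_sup_left
      · exact le_sup_of_le_right (le_iSup₂_of_le j h le_rfl)
    rw [this]; exact Submodule.mem_top
  obtain ⟨y, hy, z, hz, rfl⟩ := Submodule.mem_sup.1 hx'
  have hzW : z ∈ weightSpace (M ⊗[R] N) m := by
    have := sub_mem hx (weightTensor_le m hy)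
    rwa [add_sub_cancel_left] at this
  have hz' : z ∈ ⨆ (j) (_ : j ≠ m), weightSpace (M ⊗[R] N) j :=
    (iSup₂_mono fun j _ => weightTensor_le j) hz
  have h0 : z = 0 :=
    (Submodule.disjoint_def.1 (iSupIndep_weightSpace (M := M ⊗[R] N) (R := R) m)) z hzW hz'
  rw [h0, add_zero]; exact hy

theorem isSemisimpleModule_of_weight (hM : ⨆ m : MaximalSpectrum R, weightSpace M m = ⊤) :
    IsSemisimpleModule R M := by
  refine isSemisimpleModule_of_isSemisimpleModule_submodule' (fun m => ?_) hM
  have ht : Module.IsTorsionBySet R (weightSpace M m) (m.asIdeal : Set R) :=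
    Submodule.torsionBySet_isTorsionBySet _
  have := m.isMaximal
  let : Field (R ⧸ m.asIdeal) := Ideal.Quotient.field _
  let := ht.module
  exact ht.isSemisimpleModule_iff.1 inferInstance

end Weight

theorem WMod.iSup_weightSpace {σ : Fin n → RingAut R} {O : Set (MaximalSpectrum R)}
    {t : Fin n → R} (M : WMod σ O t) : ⨆ m : MaximalSpectrum R, weightSpace M m = ⊤ :=
  by classical exact M.isInternal.submodule_iSup_eq_top


section Tensor

variable {σ : Fin n → RingAut R} {O : Set (MaximalSpectrum R)} {t t' : Fin n → R}

/-- `M ⊗_R N` is an `A(t t')`-module: the diagonal action of the twisted generalized Weyl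
construction on `M ⊗_R N` factors through its quotient `A(t t')`. -/
def DiagDescends (σ : Fin n → RingAut R) (t t' : Fin n → R) (M N : Type u)
    [AddCommGroup M] [Module R M] [Module (TGWA σ t) M] [IsInduced σ t M]
    [AddCommGroup N] [Module R N] [Module (TGWA σ t') N] [IsInduced σ t' N] : Prop :=
  ∀ a ∈ torsionIdeal σ (t * t'), diagAction σ t t' M N a = 0

/-- Tensor products over `R` of weight modules with support in `O` and parameters in `Γ` are
modules over the algebra of the product parameter. -/
def TensorDefined (σ : Fin n → RingAut R) (O : Set (MaximalSpectrum R))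
    (Γ : Submonoid (Fin n → R)) : Prop :=
  ∀ t ∈ Γ, ∀ t' ∈ Γ, ∀ (M : WMod σ O t) (N : WMod σ O t'), DiagDescends σ t t' M N

theorem TensorDefined.mono {Γ Γ' : Submonoid (Fin n → R)} (h : TensorDefined σ O Γ)
    (hle : Γ' ≤ Γ) : TensorDefined σ O Γ' :=
  fun t ht t' ht' M N => h t (hle ht) t' (hle ht') M N

/-- The action of `A(t t')` on `M ⊗_R N`. -/
def tensorAction (M N : Type u)
    [AddCommGroup M] [Module R M] [Module (TGWA σ t) M] [IsInduced σ t M]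
    [AddCommGroup N] [Module R N] [Module (TGWA σ t') N] [IsInduced σ t' N]
    (h : DiagDescends σ t t' M N) : TGWA σ (t * t') →+* AddMonoid.End (M ⊗[R] N) :=
  RingCon.lift (torsionIdeal σ (t * t')).ringCon (diagAction σ t t' M N) <| by
    intro x y hxy
    have := h _ ((TwoSidedIdeal.rel_iff _ x y).1 hxy)
    rw [map_sub, sub_eq_zero] at this
    exact this

theorem tensorAction_proj (M N : Type u)
    [AddCommGroup M] [Module R M] [Module (TGWA σ t) M] [IsInduced σ t M]
    [AddCommGroup N] [Module R N] [Module (TGWA σ t') N] [IsInduced σ t' N]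
    (h : DiagDescends σ t t' M N) (a : TGWC σ (t * t')) :
    tensorAction M N h (TGWA.proj σ (t * t') a) = diagAction σ t t' M N a := rfl

/-- The tensor product `M ⊗_R N` as an object of `A(t t')-wmod_O`. -/
def WMod.tensor (M : WMod σ O t) (N : WMod σ O t') (h : DiagDescends σ t t' M N) :
    WMod σ O (t * t') :=
  letI : Module (TGWA σ (t * t')) (M ⊗[R] N) := Module.compHom _ (tensorAction M N h)
  { carrier := M ⊗[R] N
    induced := ⟨fun r x => diagAction_ofR _ _ r x⟩
    isInternal := by
      classical
      rw [DirectSum.isInternal_submodule_iff_iSupIndep_and_iSup_eq_top]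
      refine ⟨iSupIndep_weightSpace, ?_⟩
      simp_rw [← weightTensor_eq M.iSup_weightSpace N.iSup_weightSpace]
      exact iSup_weightTensor M.iSup_weightSpace N.iSup_weightSpace
    finite := fun m => by
      rw [← weightTensor_eq M.iSup_weightSpace N.iSup_weightSpace]
      have := M.finite m
      have := N.finite m
      exact Module.Finite.range _
    support := fun m hm => by
      refine M.support m fun h0 => hm ?_
      rw [← weightTensor_eq M.iSup_weightSpace N.iSup_weightSpace, weightTensor,
        LinearMap.range_eq_bot]
      ext v w
      have : (v : M) = 0 := (Submodule.eq_bot_iff _).1 h0 _ v.2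
      simp [this] }

/-- Linear maps over `A(t)` are linear over `R`. -/
def toRLinear {M N : Type u} [AddCommGroup M] [Module R M] [Module (TGWA σ t) M] [IsInduced σ t M]
    [AddCommGroup N] [Module R N] [Module (TGWA σ t) N] [IsInduced σ t N]
    (f : M →ₗ[TGWA σ t] N) : M →ₗ[R] N where
  toFun := f
  map_add' := f.map_add
  map_smul' r v := by
    rw [← IsInduced.ofR_smul (σ := σ) (t := t), map_smul, IsInduced.ofR_smul, RingHom.id_apply]

@[simp] theorem toRLinear_apply {M N : Type u} [AddCommGroup M] [Module R M] [Module (TGWA σ t) M]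
    [IsInduced σ t M] [AddCommGroup N] [Module R N] [Module (TGWA σ t) N] [IsInduced σ t N]
    (f : M →ₗ[TGWA σ t] N) (v : M) : toRLinear f v = f v := rfl

theorem map_diagAction {M N : Type u} [AddCommGroup M] [Module R M] [Module (TGWA σ t) M]
    [IsInduced σ t M] [AddCommGroup N] [Module R N] [Module (TGWA σ t) N] [IsInduced σ t N]
    {M' N' : Type u} [AddCommGroup M'] [Module R M'] [Module (TGWA σ t') M']
    [IsInduced σ t' M'] [AddCommGroup N'] [Module R N'] [Module (TGWA σ t') N'] [IsInduced σ t' N']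
    (f : M →ₗ[TGWA σ t] N) (g : M' →ₗ[TGWA σ t'] N') (a : TGWC σ (t * t')) (x : M ⊗[R] M') :
    TensorProduct.map (toRLinear f) (toRLinear g) (diagAction σ t t' M M' a x) =
      diagAction σ t t' N N' a (TensorProduct.map (toRLinear f) (toRLinear g) x) := by
  induction a using TGWC.induction generalizing x with
  | hR r => rw [diagAction_ofR, diagAction_ofR, map_smul]
  | hX i ε =>
    induction x with
    | zero => simp only [map_zero]
    | add x y hx hy => simp only [map_add, hx, hy]
    | tmul v w => simp only [diagAction_X, TensorProduct.map_tmul, toRLinear_apply, map_smul]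
  | hadd a b ha hb =>
    rw [(diagAction σ t t' M M').map_add, (diagAction σ t t' N N').map_add]
    change _ = diagAction σ t t' N N' a _ + diagAction σ t t' N N' b _
    rw [← ha, ← hb]
    exact map_add (TensorProduct.map (toRLinear f) (toRLinear g)) _ _
  | hmul a b ha hb =>
    rw [map_mul, map_mul]
    change _ = diagAction σ t t' N N' a (diagAction σ t t' N N' b _)
    rw [← hb, ← ha]; rfl

/-- The tensor product of two module homomorphisms. -/
def WMod.tensorMap {M N : WMod σ O t} {M' N' : WMod σ O t'} (h : DiagDescends σ t t' M M')
    (h' : DiagDescends σ t t' N N') (f : M →ₗ[TGWA σ t] N) (g : M' →ₗ[TGWA σ t'] N') :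
    M.tensor M' h →ₗ[TGWA σ (t * t')] N.tensor N' h' where
  toFun := TensorProduct.map (toRLinear f) (toRLinear g)
  map_add' := map_add (TensorProduct.map (toRLinear f) (toRLinear g))
  map_smul' a x := by
    obtain ⟨a, rfl⟩ := TGWA.proj_surjective σ (t * t') a
    exact map_diagAction f g a x

/-! The condition `TensorDefined` is automatic if all torsion-free `R`-modules are flat. -/

section Flat

/-- The `R`-module structure of `A(t)` by multiplication from the left. -/
local instance instModuleTGWA (σ : Fin n → RingAut R) (t : Fin n → R) : Module R (TGWA σ t) :=
  Module.compHom _ (TGWA.ofR σ t)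

local instance instIsInducedTGWA (σ : Fin n → RingAut R) (t : Fin n → R) :
    IsInduced σ t (TGWA σ t) := ⟨fun _ _ => rfl⟩

theorem TGWA.eq_zero_of_smul {r : R} (hr : r ≠ 0) (x : TGWA σ t) (hx : r • x = 0) : x = 0 := by
  obtain ⟨a, rfl⟩ := TGWA.proj_surjective σ t x
  have h1 : TGWA.proj σ t (TGWC.ofR σ t r * a) = 0 := by rw [map_mul]; exact hx
  obtain ⟨s, hs, h⟩ := mem_torsionIdeal.1 ((TGWA.proj_eq_zero σ t).1 h1)
  refine (TGWA.proj_eq_zero σ t).2 (mem_torsionIdeal.2 ⟨s * r, mul_ne_zero hs hr, ?_⟩)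
  rw [map_mul, mul_assoc, h]

theorem TGWA.torsion_eq_bot (σ : Fin n → RingAut R) (t : Fin n → R) :
    Submodule.torsion R (TGWA σ t) = ⊥ := by
  rw [eq_bot_iff]
  rintro x ⟨r, hr⟩
  exact TGWA.eq_zero_of_smul (nonZeroDivisors.ne_zero r.2) x hr

theorem diagDescends_of_flat [Module.Flat R (TGWA σ t)] (M N : Type u)
    [AddCommGroup M] [Module R M] [Module (TGWA σ t) M] [IsInduced σ t M]
    [AddCommGroup N] [Module R N] [Module (TGWA σ t') N] [IsInduced σ t' N] :
    DiagDescends σ t t' M N := by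
  intro a ha
  obtain ⟨r, hr, hra⟩ := mem_torsionIdeal.1 ha
  have h0 : diagAction σ t t' (TGWA σ t) (TGWA σ t') a (1 ⊗ₜ 1) = 0 := by
    have hinj : Function.Injective (LinearMap.lTensor (TGWA σ t)
        (LinearMap.lsmul R (TGWA σ t') r)) := by
      refine Module.Flat.lTensor_preserves_injective_linearMap _ ?_
      rw [← LinearMap.ker_eq_bot, LinearMap.ker_eq_bot']
      exact fun x hx => TGWA.eq_zero_of_smul hr x hx
    have hsm : ∀ x, LinearMap.lTensor (TGWA σ t) (LinearMap.lsmul R (TGWA σ t') r) x = r • x := by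
      intro x
      induction x with
      | zero => simp only [map_zero, smul_zero]
      | add x y hx hy => rw [map_add, hx, hy, smul_add]
      | tmul v w => rw [LinearMap.lTensor_tmul, LinearMap.lsmul_apply, TensorProduct.tmul_smul]
    apply hinj
    rw [hsm, map_zero, ← diagAction_ofR (σ := σ) (t := t) (t' := t')]
    have h := congrArg (diagAction σ t t' (TGWA σ t) (TGWA σ t')) hra
    rw [map_mul, map_zero] at h
    exact DFunLike.congr_fun h (1 ⊗ₜ 1)
  refine end_ext M N fun v w => ?_
  have h := map_diagAction (LinearMap.toSpanSingleton (TGWA σ t) M v)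
    (LinearMap.toSpanSingleton (TGWA σ t') N w) a (1 ⊗ₜ 1)
  rw [h0, map_zero, TensorProduct.map_tmul, toRLinear_apply, toRLinear_apply,
    LinearMap.toSpanSingleton_apply, LinearMap.toSpanSingleton_apply, one_smul, one_smul] at h
  exact h.symm

set_option linter.overlappingInstances false in
theorem tensorDefined_of_isDedekindDomain [IsDedekindDomain R] (Γ : Submonoid (Fin n → R)) :
    TensorDefined σ O Γ := fun t _ _ _ M N =>
  have : Module.Flat R (TGWA σ t) :=
    IsDedekindDomain.flat_iff_torsion_eq_bot.2 (TGWA.torsion_eq_bot σ t)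
  diagDescends_of_flat M N

theorem tensorDefined_of_isBezout [IsBezout R] (Γ : Submonoid (Fin n → R)) :
    TensorDefined σ O Γ := fun t _ _ _ M N =>
  have : Module.Flat R (TGWA σ t) :=
    Module.Flat.flat_iff_torsion_eq_bot_of_isBezout.2 (TGWA.torsion_eq_bot σ t)
  diagDescends_of_flat M N

end Flat

end Tensor

/-! ### Grothendieck groups -/

/-- The two kinds of Grothendieck group: the ordinary one and the split one. -/
inductive Kind
  | exact
  | split

section K0

variable {σ : Fin n → RingAut R} {O : Set (MaximalSpectrum R)} {t t' : Fin n → R}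

/-- The short exact sequence `0 → M → N → P → 0`. -/
def IsSES (M N P : WMod σ O t) : Prop :=
  ∃ (f : M →ₗ[TGWA σ t] N) (g : N →ₗ[TGWA σ t] P),
    Function.Injective f ∧ Function.Exact f g ∧ Function.Surjective g

/-- The relation imposing `[N] = [M] + [P]`: there is a short exact sequence `0 → M → N → P → 0`
for the ordinary Grothendieck group, `N ≃ M ⊕ P` for the split one. -/
def IsExtension (k : Kind) (M N P : WMod σ O t) : Prop :=
  match k with
  | .exact => IsSES M N P
  | .split => Nonempty (N ≃ₗ[TGWA σ t] M × P)

/-- The relations of the Grothendieck group. -/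
def K0Rel (k : Kind) (σ : Fin n → RingAut R) (O : Set (MaximalSpectrum R)) (t : Fin n → R) :
    Set (FreeAbelianGroup (WMod σ O t)) :=
  {x | ∃ M N P : WMod σ O t, IsExtension k M N P ∧
    x = FreeAbelianGroup.of N - FreeAbelianGroup.of M - FreeAbelianGroup.of P}

/-- The Grothendieck group (for `k = .exact`) and the split Grothendieck group (for `k = .split`)
of `A(t)-wmod_O`. -/
def K0 (k : Kind) (σ : Fin n → RingAut R) (O : Set (MaximalSpectrum R)) (t : Fin n → R) :
    Type (u + 1) := FreeAbelianGroup (WMod σ O t) ⧸ AddSubgroup.closure (K0Rel k σ O t)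

instance (k : Kind) : AddCommGroup (K0 k σ O t) :=
  inferInstanceAs (AddCommGroup (FreeAbelianGroup (WMod σ O t) ⧸ AddSubgroup.closure _))

/-- The class `[M]`. -/
def K0.of (k : Kind) (M : WMod σ O t) : K0 k σ O t :=
  QuotientAddGroup.mk (FreeAbelianGroup.of M)

theorem K0.of_eq (k : Kind) {M N P : WMod σ O t} (h : IsExtension k M N P) :
    K0.of k N = K0.of k M + K0.of k P := by
  have h1 : (QuotientAddGroup.mk (FreeAbelianGroup.of N - FreeAbelianGroup.of M -
      FreeAbelianGroup.of P) : K0 k σ O t) = 0 :=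
    (QuotientAddGroup.eq_zero_iff _).2 (AddSubgroup.subset_closure ⟨M, N, P, h, rfl⟩)
  have h2 : K0.of k N - K0.of k M - K0.of k P = 0 := h1
  rw [sub_sub, sub_eq_zero] at h2
  exact h2

/-- The universal property of the Grothendieck group. -/
def K0.lift (k : Kind) {G : Type (u + 1)} [AddCommGroup G] (f : WMod σ O t → G)
    (hf : ∀ M N P, IsExtension k M N P → f N = f M + f P) : K0 k σ O t →+ G :=
  QuotientAddGroup.lift _ (FreeAbelianGroup.lift f) <| by
    rw [AddSubgroup.closure_le]
    rintro _ ⟨M, N, P, h, rfl⟩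
    simp [hf M N P h]

@[simp] theorem K0.lift_of (k : Kind) {G : Type (u + 1)} [AddCommGroup G] (f : WMod σ O t → G)
    (hf : ∀ M N P, IsExtension k M N P → f N = f M + f P) (M : WMod σ O t) :
    K0.lift k f hf (K0.of k M) = f M := by
  change QuotientAddGroup.lift _ _ _ (QuotientAddGroup.mk _) = _
  simp

theorem K0.hom_ext (k : Kind) {G : Type (u + 1)} [AddCommGroup G] {f g : K0 k σ O t →+ G}
    (h : ∀ M, f (K0.of k M) = g (K0.of k M)) : f = g := by
  refine QuotientAddGroup.addMonoidHom_ext _ ?_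
  ext M
  exact h M

theorem exists_leftInverse (M N : WMod σ O t) (f : M →ₗ[TGWA σ t] N)
    (hf : Function.Injective f) : ∃ p : N →ₗ[R] M, p ∘ₗ toRLinear f = LinearMap.id :=
  have := isSemisimpleModule_of_weight N.iSup_weightSpace
  IsSemisimpleModule.extension_property (toRLinear f) hf LinearMap.id

theorem isExtension_tensor_right (k : Kind) {M N P : WMod σ O t} (Q : WMod σ O t')
    (hM : DiagDescends σ t t' M Q) (hN : DiagDescends σ t t' N Q) (hP : DiagDescends σ t t' P Q)
    (h : IsExtension k M N P) :
    IsExtension k (M.tensor Q hM) (N.tensor Q hN) (P.tensor Q hP) := by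
  cases k with
  | exact =>
    obtain ⟨f, g, hf, hfg, hg⟩ := h
    refine ⟨WMod.tensorMap hM hN f .id, WMod.tensorMap hN hP g .id, ?_, ?_, ?_⟩
    · obtain ⟨p, hp⟩ := exists_leftInverse M N f hf
      refine Function.LeftInverse.injective (g := LinearMap.rTensor Q p) fun x => ?_
      change LinearMap.rTensor Q p (LinearMap.rTensor Q (toRLinear f) x) = x
      rw [← LinearMap.comp_apply, ← LinearMap.rTensor_comp, hp, LinearMap.rTensor_id,
        LinearMap.id_apply]
    · exact rTensor_exact Q (f := toRLinear f) (g := toRLinear g) hfg hg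
    · exact LinearMap.rTensor_surjective Q (g := toRLinear g) hg
  | split =>
    obtain ⟨e⟩ := h
    refine ⟨LinearEquiv.ofBijective ((WMod.tensorMap hN hM (.fst _ _ _ ∘ₗ e.toLinearMap) .id).prod
      (WMod.tensorMap hN hP (.snd _ _ _ ∘ₗ e.toLinearMap) .id)) ?_⟩
    let eR : N ≃ₗ[R] M × P := LinearEquiv.ofBijective
      ((toRLinear (.fst _ _ _ ∘ₗ e.toLinearMap)).prod (toRLinear (.snd _ _ _ ∘ₗ e.toLinearMap)))
      e.bijective
    have := ((LinearEquiv.rTensor Q eR).trans (TensorProduct.prodLeft R R M P Q)).bijective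
    have key : ∀ x : N ⊗[R] Q, ((TensorProduct.map (toRLinear (.fst (TGWA σ t) M P ∘ₗ e.toLinearMap))
        (toRLinear (.id (R := TGWA σ t') (M := Q))) x, TensorProduct.map (toRLinear (.snd (TGWA σ t) M P ∘ₗ e.toLinearMap))
        (toRLinear (.id (R := TGWA σ t') (M := Q))) x) : _ × _) =
        ((LinearEquiv.rTensor Q eR).trans (TensorProduct.prodLeft R R M P Q)) x := by
      intro x
      induction x with
      | zero => simp only [map_zero]; rfl
      | add x y hx hy =>
        refine Eq.trans ?_ (map_add ((LinearEquiv.rTensor Q eR).trans (TensorProduct.prodLeft R R M P Q)) x y).symm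
        rw [← hx, ← hy]
        simp only [map_add]
        rfl
      | tmul v w => rfl
    rw [← funext key] at this
    exact this

theorem isExtension_tensor_left (k : Kind) {M N P : WMod σ O t} (Q : WMod σ O t')
    (hM : DiagDescends σ t' t Q M) (hN : DiagDescends σ t' t Q N) (hP : DiagDescends σ t' t Q P)
    (h : IsExtension k M N P) :
    IsExtension k (Q.tensor M hM) (Q.tensor N hN) (Q.tensor P hP) := by
  cases k with
  | exact =>
    obtain ⟨f, g, hf, hfg, hg⟩ := h
    refine ⟨WMod.tensorMap hM hN .id f, WMod.tensorMap hN hP .id g, ?_, ?_, ?_⟩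
    · obtain ⟨p, hp⟩ := exists_leftInverse M N f hf
      refine Function.LeftInverse.injective (g := LinearMap.lTensor Q p) fun x => ?_
      change LinearMap.lTensor Q p (LinearMap.lTensor Q (toRLinear f) x) = x
      rw [← LinearMap.comp_apply, ← LinearMap.lTensor_comp, hp, LinearMap.lTensor_id,
        LinearMap.id_apply]
    · exact lTensor_exact Q (f := toRLinear f) (g := toRLinear g) hfg hg
    · exact LinearMap.lTensor_surjective Q (g := toRLinear g) hg
  | split =>
    obtain ⟨e⟩ := h
    refine ⟨LinearEquiv.ofBijective ((WMod.tensorMap hN hM .id (.fst _ _ _ ∘ₗ e.toLinearMap)).prod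
      (WMod.tensorMap hN hP .id (.snd _ _ _ ∘ₗ e.toLinearMap))) ?_⟩
    let eR : N ≃ₗ[R] M × P := LinearEquiv.ofBijective
      ((toRLinear (.fst _ _ _ ∘ₗ e.toLinearMap)).prod (toRLinear (.snd _ _ _ ∘ₗ e.toLinearMap)))
      e.bijective
    have := ((LinearEquiv.lTensor Q eR).trans (TensorProduct.prodRight R R Q M P)).bijective
    have key : ∀ x : Q ⊗[R] N, ((TensorProduct.map (toRLinear (.id (R := TGWA σ t') (M := Q)))
        (toRLinear (.fst (TGWA σ t) M P ∘ₗ e.toLinearMap)) x, TensorProduct.map (toRLinear (.id (R := TGWA σ t') (M := Q)))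
        (toRLinear (.snd (TGWA σ t) M P ∘ₗ e.toLinearMap)) x) : _ × _) =
        ((LinearEquiv.lTensor Q eR).trans (TensorProduct.prodRight R R Q M P)) x := by
      intro x
      induction x with
      | zero => simp only [map_zero]; rfl
      | add x y hx hy =>
        refine Eq.trans ?_ (map_add ((LinearEquiv.lTensor Q eR).trans (TensorProduct.prodRight R R Q M P)) x y).symm
        rw [← hx, ← hy]
        simp only [map_add]
        rfl
      | tmul v w => rfl
    rw [← funext key] at this
    exact this

/-- The biadditive map `([M], [N]) ↦ [M ⊗_R N]`. -/
def K0.mul (k : Kind) (h : ∀ (M : WMod σ O t) (N : WMod σ O t'), DiagDescends σ t t' M N) :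
    K0 k σ O t →+ K0 k σ O t' →+ K0 k σ O (t * t') :=
  K0.lift k (fun M => K0.lift k (fun N => K0.of k (M.tensor N (h M N)))
      fun _ _ _ e => K0.of_eq k (isExtension_tensor_left k M _ _ _ e))
    fun M N P e => K0.hom_ext k fun Q => by
      simpa using K0.of_eq k (isExtension_tensor_right k Q (h M Q) (h N Q) (h P Q) e)

@[simp] theorem K0.mul_of (k : Kind)
    (h : ∀ (M : WMod σ O t) (N : WMod σ O t'), DiagDescends σ t t' M N) (M : WMod σ O t)
    (N : WMod σ O t') : K0.mul k h (K0.of k M) (K0.of k N) = K0.of k (M.tensor N (h M N)) := by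
  simp [K0.mul]

end K0


/-! ### The Grothendieck algebras

They are presented as `ℂ`-modules with a bilinear multiplication; an isomorphism of `ℂ`-algebras is
a multiplicative `ℂ`-linear bijection. -/

section GrothendieckAlgebra

variable (k : Kind) (σ : Fin n → RingAut R) (O : Set (MaximalSpectrum R))

/-- The graded `ℂ`-algebra `⨁_{t ∈ Γ} ℂ ⊗ K_0(A(t)-wmod_O)`, which is `𝒜(Γ, O)` for `k = .exact`
and `𝒜^split(Γ, O)` for `k = .split`. The last argument is only used for the multiplication. -/
def GrAlg (Γ : Submonoid (Fin n → R)) (_hΓ : TensorDefined σ O Γ) : Type (u + 1) :=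
  ⨁ t : Γ, ℂ ⊗[ℤ] K0 k σ O (t : Fin n → R)

namespace GrAlg

variable {Γ : Submonoid (Fin n → R)} (hΓ : TensorDefined σ O Γ)

instance : AddCommGroup (GrAlg k σ O Γ hΓ) :=
  inferInstanceAs (AddCommGroup (⨁ t : Γ, ℂ ⊗[ℤ] K0 k σ O (t : Fin n → R)))

instance : Module ℂ (GrAlg k σ O Γ hΓ) :=
  inferInstanceAs (Module ℂ (⨁ t : Γ, ℂ ⊗[ℤ] K0 k σ O (t : Fin n → R)))

open Classical in
/-- The inclusion of the component of degree `t`. -/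
def incl (t : Γ) : ℂ ⊗[ℤ] K0 k σ O (t : Fin n → R) →ₗ[ℂ] GrAlg k σ O Γ hΓ :=
  DirectSum.lof ℂ Γ (fun t : Γ => ℂ ⊗[ℤ] K0 k σ O (t : Fin n → R)) t

/-- The component of degree `t`. -/
def grade (t : Γ) : Submodule ℂ (GrAlg k σ O Γ hΓ) := LinearMap.range (incl k σ O hΓ t)

/-- The class `[M]` in degree `t`. -/
def cls (t : Γ) (M : WMod σ O (t : Fin n → R)) : GrAlg k σ O Γ hΓ :=
  incl k σ O hΓ t (1 ⊗ₜ K0.of k M)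

/-- The product of the components of degrees `s` and `t`:
`(z ⊗ [M]) (w ⊗ [N]) = z w ⊗ [M ⊗_R N]`. -/
def compMul (s t : Γ) : ℂ ⊗[ℤ] K0 k σ O (s : Fin n → R) →ₗ[ℂ] ℂ ⊗[ℤ] K0 k σ O (t : Fin n → R) →ₗ[ℂ]
    ℂ ⊗[ℤ] K0 k σ O ((s * t : Γ) : Fin n → R) :=
  LinearMap.liftBaseChange ℂ <| (LinearMap.baseChangeHom ℤ ℂ _ _).comp <| AddMonoidHom.toIntLinearMap
    { toFun := fun x => (K0.mul k (hΓ s s.2 t t.2) x).toIntLinearMap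
      map_zero' := by ext; simp
      map_add' := by intro x y; ext; simp }

theorem compMul_tmul (s t : Γ) (z w : ℂ) (x : K0 k σ O (s : Fin n → R))
    (y : K0 k σ O (t : Fin n → R)) :
    compMul k σ O hΓ s t (z ⊗ₜ x) (w ⊗ₜ y) = (z * w) ⊗ₜ K0.mul k (hΓ s s.2 t t.2) x y := by
  change z • (w ⊗ₜ[ℤ] K0.mul k (hΓ s s.2 t t.2) x y) = _
  rw [TensorProduct.smul_tmul', smul_eq_mul]

open Classical in
/-- The multiplication by elements of degree `s` from the left. -/
def mulHomLeft (s : Γ) :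
    ℂ ⊗[ℤ] K0 k σ O (s : Fin n → R) →ₗ[ℂ] GrAlg k σ O Γ hΓ →ₗ[ℂ] GrAlg k σ O Γ hΓ :=
  LinearMap.flip <| DirectSum.toModule ℂ Γ _ fun t =>
    LinearMap.flip <| (compMul k σ O hΓ s t).compr₂ (incl k σ O hΓ (s * t))

open Classical in
/-- The multiplication as a bilinear map. -/
def mulHom : GrAlg k σ O Γ hΓ →ₗ[ℂ] GrAlg k σ O Γ hΓ →ₗ[ℂ] GrAlg k σ O Γ hΓ :=
  DirectSum.toModule ℂ Γ _ fun s => mulHomLeft k σ O hΓ s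

instance : NonUnitalNonAssocRing (GrAlg k σ O Γ hΓ) where
  mul x y := mulHom k σ O hΓ x y
  left_distrib x y z := map_add (mulHom k σ O hΓ x) y z
  right_distrib x y z := by
    change mulHom k σ O hΓ (x + y) z = mulHom k σ O hΓ x z + mulHom k σ O hΓ y z
    rw [map_add, LinearMap.add_apply]
  zero_mul x := by
    change mulHom k σ O hΓ 0 x = 0
    rw [map_zero, LinearMap.zero_apply]
  mul_zero x := map_zero (mulHom k σ O hΓ x)

theorem mul_def (x y : GrAlg k σ O Γ hΓ) : x * y = mulHom k σ O hΓ x y := rfl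

open Classical in
theorem incl_mul_incl (s t : Γ) (x : ℂ ⊗[ℤ] K0 k σ O (s : Fin n → R))
    (y : ℂ ⊗[ℤ] K0 k σ O (t : Fin n → R)) :
    incl k σ O hΓ s x * incl k σ O hΓ t y = incl k σ O hΓ (s * t) (compMul k σ O hΓ s t x y) := by
  have h1 := DirectSum.toModule_lof (M := fun t : Γ => ℂ ⊗[ℤ] K0 k σ O (t : Fin n → R)) ℂ
    (φ := fun s => mulHomLeft k σ O hΓ s) s x
  have h2 := DirectSum.toModule_lof (M := fun t : Γ => ℂ ⊗[ℤ] K0 k σ O (t : Fin n → R)) ℂ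
    (φ := fun t => LinearMap.flip ((compMul k σ O hΓ s t).compr₂ (incl k σ O hΓ (s * t)))) t y
  refine (LinearMap.congr_fun h1 (incl k σ O hΓ t y)).trans ?_
  exact LinearMap.congr_fun h2 x

theorem cls_mul_cls (s t : Γ) (M : WMod σ O (s : Fin n → R)) (N : WMod σ O (t : Fin n → R)) :
    cls k σ O hΓ s M * cls k σ O hΓ t N =
      cls k σ O hΓ (s * t) (M.tensor N (hΓ s s.2 t t.2 M N)) := by
  rw [cls, cls, incl_mul_incl, compMul_tmul, K0.mul_of, one_mul]
  rfl

instance : IsScalarTower ℂ (GrAlg k σ O Γ hΓ) (GrAlg k σ O Γ hΓ) where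
  smul_assoc z x y := by
    rw [smul_eq_mul, smul_eq_mul, mul_def, mul_def, map_smul, LinearMap.smul_apply]

instance : SMulCommClass ℂ (GrAlg k σ O Γ hΓ) (GrAlg k σ O Γ hΓ) where
  smul_comm z x y := by
    rw [smul_eq_mul, smul_eq_mul, mul_def, mul_def, map_smul]

end GrAlg

/-! ### The quotient by the invertible part -/

section Quot

variable {Γ : Submonoid (Fin n → R)} (hΓ : TensorDefined σ O Γ)

/-- The congruence on `Γ` defining the quotient monoid `Γ / Γ^×`: the elements `s` and `t` are
identified if `u s = v t` for some `u, v ∈ Γ^×`. -/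
def unitCon (Γ : Submonoid (Fin n → R)) : Con Γ where
  r s t := ∃ u ∈ unitPart σ O Γ, ∃ v ∈ unitPart σ O Γ, u * (s : Fin n → R) = v * (t : Fin n → R)
  iseqv :=
    { refl := fun s => ⟨1, one_mem _, 1, one_mem _, rfl⟩
      symm := fun ⟨u, hu, v, hv, h⟩ => ⟨v, hv, u, hu, h.symm⟩
      trans := by
        rintro x y z ⟨u, hu, v, hv, h⟩ ⟨u', hu', v', hv', h'⟩
        refine ⟨u' * u, mul_mem hu' hu, v * v', mul_mem hv hv', ?_⟩
        rw [mul_assoc, h, mul_assoc, ← h', mul_left_comm] }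
  mul' := by
    rintro w x y z ⟨u, hu, v, hv, h⟩ ⟨u', hu', v', hv', h'⟩
    refine ⟨u * u', mul_mem hu hu', v * v', mul_mem hv hv', ?_⟩
    rw [Submonoid.coe_mul, Submonoid.coe_mul, mul_mul_mul_comm, h, h', mul_mul_mul_comm]

/-- The generators `[M] - [M ⊗_R S]`, where `M` is any weight module and `S` is a simple object of
`A(u)-wmod_O` with `u ∈ Γ^×`. -/
def unitRel : Set (GrAlg k σ O Γ hΓ) :=
  {x | ∃ (t u : Γ) (_ : (u : Fin n → R) ∈ unitPart σ O Γ) (M : WMod σ O (t : Fin n → R))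
    (S : WMod σ O (u : Fin n → R)), IsSimpleModule (TGWA σ (u : Fin n → R)) S ∧
    x = GrAlg.cls k σ O hΓ t M -
      GrAlg.cls k σ O hΓ (t * u) (M.tensor S (hΓ t t.2 u u.2 M S))}

/-- The ideal generated by `unitRel`. -/
def unitIdeal : Submodule ℂ (GrAlg k σ O Γ hΓ) :=
  sInf {I | unitRel k σ O hΓ ⊆ I ∧ ∀ a, ∀ x ∈ I, a * x ∈ I ∧ x * a ∈ I}

theorem mul_mem_unitIdeal (a : GrAlg k σ O Γ hΓ) {x} (hx : x ∈ unitIdeal k σ O hΓ) :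
    a * x ∈ unitIdeal k σ O hΓ := by
  rw [unitIdeal, Submodule.mem_sInf] at hx ⊢
  exact fun I hI => (hI.2 a x (hx I hI)).1

theorem mem_unitIdeal_mul (a : GrAlg k σ O Γ hΓ) {x} (hx : x ∈ unitIdeal k σ O hΓ) :
    x * a ∈ unitIdeal k σ O hΓ := by
  rw [unitIdeal, Submodule.mem_sInf] at hx ⊢
  exact fun I hI => (hI.2 a x (hx I hI)).2

/-- The algebra `𝒜(Γ/Γ^×, O)` (or its split version): the quotient of `GrAlg` by `unitIdeal`. -/
def QuotAlg : Type (u + 1) := GrAlg k σ O Γ hΓ ⧸ unitIdeal k σ O hΓ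

namespace QuotAlg

instance : AddCommGroup (QuotAlg k σ O hΓ) :=
  inferInstanceAs (AddCommGroup (GrAlg k σ O Γ hΓ ⧸ unitIdeal k σ O hΓ))

instance : Module ℂ (QuotAlg k σ O hΓ) :=
  inferInstanceAs (Module ℂ (GrAlg k σ O Γ hΓ ⧸ unitIdeal k σ O hΓ))

/-- The quotient map. -/
def mk : GrAlg k σ O Γ hΓ →ₗ[ℂ] QuotAlg k σ O hΓ := (unitIdeal k σ O hΓ).mkQ

/-- The multiplication as a bilinear map. -/
def mulHom : QuotAlg k σ O hΓ →ₗ[ℂ] QuotAlg k σ O hΓ →ₗ[ℂ] QuotAlg k σ O hΓ :=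
  (unitIdeal k σ O hΓ).liftQ
    (LinearMap.flip <| (unitIdeal k σ O hΓ).liftQ
      (LinearMap.flip <| (GrAlg.mulHom k σ O hΓ).compr₂ (mk k σ O hΓ)) <| by
        intro x hx
        rw [LinearMap.mem_ker]
        ext a
        exact (Submodule.Quotient.mk_eq_zero _).2 (mul_mem_unitIdeal k σ O hΓ a hx)) <| by
    intro x hx
    rw [LinearMap.mem_ker]
    ext a
    obtain ⟨a, rfl⟩ := Submodule.mkQ_surjective _ a
    exact (Submodule.Quotient.mk_eq_zero _).2 (mem_unitIdeal_mul k σ O hΓ a hx)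

instance : NonUnitalNonAssocRing (QuotAlg k σ O hΓ) where
  mul x y := mulHom k σ O hΓ x y
  left_distrib x y z := map_add (mulHom k σ O hΓ x) y z
  right_distrib x y z := by
    change mulHom k σ O hΓ (x + y) z = mulHom k σ O hΓ x z + mulHom k σ O hΓ y z
    rw [map_add, LinearMap.add_apply]
  zero_mul x := by
    change mulHom k σ O hΓ 0 x = 0
    rw [map_zero, LinearMap.zero_apply]
  mul_zero x := map_zero (mulHom k σ O hΓ x)

theorem mk_mul (x y : GrAlg k σ O Γ hΓ) :
    mk k σ O hΓ (x * y) = mk k σ O hΓ x * mk k σ O hΓ y := rfl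

/-- The component of degree `γ ∈ Γ/Γ^×`: the image of the sum of the components of all degrees
`t ∈ Γ` in the class `γ`. -/
def grade (γ : (unitCon σ O Γ).Quotient) : Submodule ℂ (QuotAlg k σ O hΓ) :=
  ⨆ (t : Γ) (_ : (t : (unitCon σ O Γ).Quotient) = γ), (GrAlg.grade k σ O hΓ t).map (mk k σ O hΓ)

end QuotAlg

end Quot

/-! ### The tensor product with a monoid algebra -/

section TensorAlg

variable (Γ : Submonoid (Fin n → R)) {Γ' : Submonoid (Fin n → R)} (hΓ' : TensorDefined σ O Γ')

/-- The algebra `ℂ[Γ^×] ⊗ 𝒜(Γ', O)` (or its split version). -/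
abbrev TensorAlg : Type (u + 1) := MonoidAlgebra ℂ (unitPart σ O Γ) ⊗[ℂ] GrAlg k σ O Γ' hΓ'

/-- The component of degree `t` of `ℂ[Γ^×] ⊗ 𝒜(Γ', O)`: the span of all `u ⊗ x` where `x` is
homogeneous of degree `t'` and `u t' = t`. -/
def TensorAlg.grade (t : Fin n → R) : Submodule ℂ (TensorAlg k σ O Γ hΓ') :=
  Submodule.span ℂ {y | ∃ (u : unitPart σ O Γ) (t' : Γ') (x : GrAlg k σ O Γ' hΓ'),
    (u : Fin n → R) * t' = t ∧ x ∈ GrAlg.grade k σ O hΓ' t' ∧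
      y = MonoidAlgebra.single u (1 : ℂ) ⊗ₜ[ℂ] x}

end TensorAlg

end GrothendieckAlgebra

end TGWATower

end

open TGWATower

open scoped TensorProduct DirectSum

noncomputable section

namespace TGWATower

universe u

set_option linter.unusedSectionVars false

/-! ### Weight decompositions, and operators that act by a scalar on each weight space. -/

section WeightSpaces

variable {R : Type u} [CommRing R] [IsDomain R]
variable {N P : Type u} [AddCommGroup N] [Module R N] [AddCommGroup P] [Module R P]

/-! Each `u` in `Γ^×` contributes exactly one simple module `S_u`, and tensoring with it can be
undone. Everything follows from this.

If no `σ_i^{1/2}(u_i)` lies in an ideal of `O`, a word in the `X_i^±` followed by its reverse acts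
on each weight space as a nonzero scalar. Words are therefore injective on weight spaces, and two
words of equal degree are proportional there (`exists_ofR_mul_word`). Since stabilizers are trivial,
a module generated by a weight vector has a line as weight space at each point of `O`. The
degree-zero part of a consistent `A(u)` is `R`. Hence `A(u) m₀` is a proper left ideal, which gives
existence of a simple module (`exists_simple`). The annihilator of a nonzero vector of weight `m₀`
depends only on `m₀` (`smul_eq_zero_iff_degZero`), which gives uniqueness. Comparing generators also
yields `S_u ⊗ S_v ≅ S_{uv}`.

Choose a basis vector `s m` in each weight line of `S_u`. Then `v ↦ s m ⊗ v` identifies a weight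
module `N` with `S_u ⊗ N` over `R`, and the actions of `X_i^±` differ only by structure constants of
`S_u` that are invertible on each weight space. Dividing by these constants turns a module over
`A(ut')` into one for the parameter `t'`, and this is inverse to `S_u ⊗ -` (`tensor_untwist`,
`untwist_tensor`).

The delicate point is that the divided action must kill the torsion ideal for `t'`. The parameter
`u` need not be invertible in `R`, so there is no inverse parameter to tensor with. Instead,
`exists_twist` lifts a homogeneous `a` for `t'` to some `b` for `ut'` that acts on `N_m` like an
invertible multiple of `a`, and on `A(u) ⊗ A(t')` like a multiple of (word) `⊗ a`. If `a` is
torsion, `b` acts there by zero. By consistency of `A(u)` and `A(t')` it is then torsion itself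
(`mem_torsionIdeal_of_diagAction_eq_zero`), so it acts by zero on `N`.

Both functors preserve short exact sequences and direct sums, so degree `ut'` of the Grothendieck
algebra is a copy of degree `t'`. Commutativity and associativity of `⊗`, with `S_u ⊗ S_v ≅ S_{uv}`,
make `[S_u ⊗ M] ↔ u ⊗ [M]` multiplicative. Forgetting `u` gives a surjection onto the algebra of
`Γ'`, whose kernel is the ideal defining the quotient (`unitIdeal_eq_ker`). -/

open Classical in
theorem isInternal_weightSpace (hN : ⨆ m : MaximalSpectrum R, weightSpace N m = ⊤) :
    DirectSum.IsInternal fun m : MaximalSpectrum R => weightSpace N m := by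
  rw [DirectSum.isInternal_submodule_iff_iSupIndep_and_iSup_eq_top]
  exact ⟨iSupIndep_weightSpace, hN⟩

/-- The decomposition of a weight module. -/
def weightEquiv (hN : ⨆ m : MaximalSpectrum R, weightSpace N m = ⊤) :
    (⨁ m : MaximalSpectrum R, weightSpace N m) ≃ₗ[R] N :=
  letI := Classical.decEq (MaximalSpectrum R)
  LinearEquiv.ofBijective (DirectSum.coeLinearMap fun m => weightSpace N m)
    (by exact isInternal_weightSpace hN)

open Classical in
theorem weightEquiv_symm (hN : ⨆ m : MaximalSpectrum R, weightSpace N m = ⊤)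
    {m : MaximalSpectrum R} {v : N} (hv : v ∈ weightSpace N m) :
    (weightEquiv hN).symm v = DirectSum.lof R _ (fun m => weightSpace N m) m ⟨v, hv⟩ := by
  rw [LinearEquiv.symm_apply_eq]
  exact (DirectSum.coeLinearMap_lof (fun m => weightSpace N m) m ⟨v, hv⟩).symm

open Classical in
/-- The linear map on a weight module that is given on each weight space. -/
def weightLift (hN : ⨆ m : MaximalSpectrum R, weightSpace N m = ⊤)
    (f : ∀ m : MaximalSpectrum R, weightSpace N m →ₗ[R] P) : N →ₗ[R] P :=
  (DirectSum.toModule R _ P f) ∘ₗ (weightEquiv hN).symm.toLinearMap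

theorem weightLift_apply (hN : ⨆ m : MaximalSpectrum R, weightSpace N m = ⊤)
    (f : ∀ m : MaximalSpectrum R, weightSpace N m →ₗ[R] P) {m : MaximalSpectrum R} {v : N}
    (hv : v ∈ weightSpace N m) : weightLift hN f v = f m ⟨v, hv⟩ := by
  rw [weightLift, LinearMap.comp_apply, LinearEquiv.coe_coe, weightEquiv_symm hN hv,
    DirectSum.toModule_lof]

theorem weight_induction (hN : ⨆ m : MaximalSpectrum R, weightSpace N m = ⊤) {Q : N → Prop}
    (h0 : Q 0) (hadd : ∀ v w, Q v → Q w → Q (v + w))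
    (hw : ∀ (m : MaximalSpectrum R), ∀ v ∈ weightSpace N m, Q v) (v : N) : Q v := by
  have hv : v ∈ ⨆ m : MaximalSpectrum R, weightSpace N m := hN ▸ Submodule.mem_top
  induction hv using Submodule.iSup_induction' with
  | zero => exact h0
  | add x y _ _ hx hy => exact hadd x y hx hy
  | mem m v hv => exact hw m v hv

/-- The operator on a weight module that acts as multiplication by `p m` on the weight space of
`m`. -/
def act (hN : ⨆ m : MaximalSpectrum R, weightSpace N m = ⊤) (p : MaximalSpectrum R → R) :
    N →ₗ[R] N := weightLift hN fun m => p m • (weightSpace N m).subtype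

theorem act_apply (hN : ⨆ m : MaximalSpectrum R, weightSpace N m = ⊤) (p : MaximalSpectrum R → R)
    {m : MaximalSpectrum R} {v : N} (hv : v ∈ weightSpace N m) : act hN p v = p m • v :=
  weightLift_apply hN _ hv

theorem smul_eq_smul_of_sub_mem {m : MaximalSpectrum R} {v : N} (hv : v ∈ weightSpace N m)
    {r s : R} (h : r - s ∈ m.asIdeal) : r • v = s • v := by
  rw [← sub_eq_zero, ← sub_smul]
  exact mem_weightSpace.1 hv _ h

/-- A weight space is a vector space over the field `R/m`, and `r` has an inverse there. -/
theorem smul_ne_zero_of_notMem {m : MaximalSpectrum R} {v : N} (hv : v ∈ weightSpace N m)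
    (h0 : v ≠ 0) {r : R} (h : r ∉ m.asIdeal) : r • v ≠ 0 := by
  obtain ⟨s, i, hi, hs⟩ := m.isMaximal.exists_inv h
  intro hr
  apply h0
  have h1 : (s * r + i) • v = 0 := by
    rw [add_smul, mul_smul, hr, smul_zero, mem_weightSpace.1 hv i hi, add_zero]
  rwa [hs, one_smul] at h1

theorem smul_eq_zero_iff_mem {m : MaximalSpectrum R} {v : N} (hv : v ∈ weightSpace N m)
    (h0 : v ≠ 0) {r : R} : r • v = 0 ↔ r ∈ m.asIdeal :=
  ⟨fun h => by_contra fun hr => smul_ne_zero_of_notMem hv h0 hr h, mem_weightSpace.1 hv r⟩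

theorem sub_mem_of_smul_eq {m : MaximalSpectrum R} {v : N} (hv : v ∈ weightSpace N m)
    (h0 : v ≠ 0) {r s : R} (h : r • v = s • v) : r - s ∈ m.asIdeal :=
  (smul_eq_zero_iff_mem hv h0).1 (by rw [sub_smul, h, sub_self])

theorem exists_smul_inverse {m : MaximalSpectrum R} {r : R} (h : r ∉ m.asIdeal) :
    ∃ s : R, ∀ {N : Type u} [AddCommGroup N] [Module R N], ∀ v ∈ weightSpace N m, s • r • v = v := by
  obtain ⟨s, i, hi, hs⟩ := m.isMaximal.exists_inv h
  refine ⟨s, fun v hv => ?_⟩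
  have h1 : (s * r + i) • v = s • r • v := by
    rw [add_smul, mul_smul, mem_weightSpace.1 hv i hi, add_zero]
  rw [← h1, hs, one_smul]

/-- Weight spaces of distinct maximal ideals are independent, so subspaces of them that together
span `N` must fill each one. -/
theorem weightSpace_eq_of_iSup_eq_top (W : MaximalSpectrum R → Submodule R N)
    (hW : ∀ m, W m ≤ weightSpace N m) (h : ⨆ m, W m = ⊤) (m : MaximalSpectrum R) :
    weightSpace N m = W m := by
  refine le_antisymm (fun x hx => ?_) (hW m)
  have hx' : x ∈ W m ⊔ ⨆ (j) (_ : j ≠ m), W j := by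
    have : W m ⊔ ⨆ (j) (_ : j ≠ m), W j = ⊤ := by
      rw [← h]
      refine le_antisymm (sup_le (le_iSup _ m) (iSup₂_le fun j _ => le_iSup _ j)) ?_
      refine iSup_le fun j => ?_
      by_cases h : j = m
      · subst h; exact le_sup_left
      · exact le_sup_of_le_right (le_iSup₂_of_le j h le_rfl)
    rw [this]; exact Submodule.mem_top
  obtain ⟨y, hy, z, hz, rfl⟩ := Submodule.mem_sup.1 hx'
  have hzW : z ∈ weightSpace N m := by
    have := sub_mem hx (hW m hy)
    rwa [add_sub_cancel_left] at this
  have hz' : z ∈ ⨆ (j) (_ : j ≠ m), weightSpace N j := (iSup₂_mono fun j _ => hW j) hz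
  have h0 : z = 0 :=
    (Submodule.disjoint_def.1 (iSupIndep_weightSpace (M := N) (R := R) m)) z hzW hz'
  rw [h0, add_zero]; exact hy

open Classical in
/-- The projection of a weight module to the weight space of `m`. -/
def wproj (hN : ⨆ m : MaximalSpectrum R, weightSpace N m = ⊤) (m : MaximalSpectrum R) :
    N →ₗ[R] N := act hN (Pi.single m 1)

theorem wproj_apply (hN : ⨆ m : MaximalSpectrum R, weightSpace N m = ⊤) {m : MaximalSpectrum R}
    {v : N} (hv : v ∈ weightSpace N m) : wproj hN m v = v := by
  classical
  rw [wproj, act_apply hN _ hv, Pi.single_eq_same, one_smul]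

theorem wproj_apply_of_ne (hN : ⨆ m : MaximalSpectrum R, weightSpace N m = ⊤)
    {m m' : MaximalSpectrum R} (h : m' ≠ m) {v : N} (hv : v ∈ weightSpace N m') :
    wproj hN m v = 0 := by
  classical
  rw [wproj, act_apply hN _ hv, Pi.single_eq_of_ne h, zero_smul]

theorem wproj_mem (hN : ⨆ m : MaximalSpectrum R, weightSpace N m = ⊤) (m : MaximalSpectrum R)
    (v : N) : wproj hN m v ∈ weightSpace N m := by
  induction v using weight_induction hN with
  | h0 => rw [map_zero]; exact zero_mem _
  | hadd v w hv hw => rw [map_add]; exact add_mem hv hw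
  | hw m' v hv =>
    by_cases h : m' = m
    · subst h; rwa [wproj_apply hN hv]
    · rw [wproj_apply_of_ne hN h hv]; exact zero_mem _

/-- The maps `wproj` compute the coordinates of the direct sum decomposition, and these determine
the vector. -/
theorem exists_wproj_ne_zero (hN : ⨆ m : MaximalSpectrum R, weightSpace N m = ⊤) {v : N}
    (hv : v ≠ 0) : ∃ m, wproj hN m v ≠ 0 := by
  classical
  by_contra! h
  apply hv
  have key : ∀ (m : MaximalSpectrum R) (w : N), (((weightEquiv hN).symm w m : weightSpace N m) : N) =
      wproj hN m w := by
    intro m w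
    induction w using weight_induction hN with
    | h0 => simp
    | hadd v w hv hw => rw [map_add, map_add, ← hv, ← hw]; rfl
    | hw m' v hv =>
      rw [weightEquiv_symm hN hv, DirectSum.lof_eq_of]
      by_cases h : m' = m
      · subst h; rw [wproj_apply hN hv, DirectSum.of_eq_same]
      · rw [wproj_apply_of_ne hN h hv, DirectSum.of_eq_of_ne _ _ _ (Ne.symm h)]; rfl
  have h0 : (weightEquiv hN).symm v = 0 := by
    refine DFinsupp.ext fun m => Subtype.ext ?_
    rw [key, h]; rfl
  exact (LinearEquiv.map_eq_zero_iff _).1 h0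

end WeightSpaces

/-! ### The action of `ℤ^n` on the maximal spectrum. -/

section Translation

variable {R : Type u} [CommRing R]

/-- The action of the automorphisms of `R` on its maximal spectrum. -/
def translate (φ : RingAut R) (m : MaximalSpectrum R) : MaximalSpectrum R :=
  have := m.isMaximal
  ⟨m.asIdeal.comap (φ⁻¹ : R ≃+* R), Ideal.comap_isMaximal_of_equiv _⟩

theorem mem_translate {φ : RingAut R} {m : MaximalSpectrum R} {r : R} :
    r ∈ (translate φ m).asIdeal ↔ φ⁻¹ r ∈ m.asIdeal := Iff.rfl

theorem inv_apply_self (φ : RingAut R) (r : R) : φ⁻¹ (φ r) = r := φ.symm_apply_apply r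

theorem apply_inv_self (φ : RingAut R) (r : R) : φ (φ⁻¹ r) = r := φ.apply_symm_apply r

theorem translate_one (m : MaximalSpectrum R) : translate 1 m = m :=
  MaximalSpectrum.ext (Ideal.ext fun r => by rw [mem_translate]; simp)

theorem translate_mul (φ ψ : RingAut R) (m : MaximalSpectrum R) :
    translate (φ * ψ) m = translate φ (translate ψ m) :=
  MaximalSpectrum.ext (Ideal.ext fun r => by
    rw [mem_translate, mem_translate, mem_translate, mul_inv_rev, RingAut.mul_apply])

variable [IsDomain R] {n : ℕ} {σ : Fin n → RingAut R}

theorem shift_eq (g : Fin n → ℤ) (m : MaximalSpectrum R) :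
    shift σ g m = (translate (sigmaPow σ g) m).asIdeal := by
  ext r
  rw [shift, mem_translate]
  exact Ideal.mem_map_of_equiv (sigmaPow σ g : R ≃+* R) r |>.trans
    ⟨by rintro ⟨x, hx, rfl⟩; rwa [inv_apply_self],
      fun h => ⟨_, h, apply_inv_self _ _⟩⟩

theorem sigmaPow_add (hσ : ∀ i j, Commute (σ i) (σ j)) (g h : Fin n → ℤ) :
    sigmaPow σ (g + h) = sigmaPow σ g * sigmaPow σ h := by
  rw [sigmaPow, sigmaPow, sigmaPow, List.ofFn_eq_map, List.ofFn_eq_map, List.ofFn_eq_map]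
  -- The identity holds for products over any list of indices, which is the form that induction
  -- needs.
  generalize List.finRange n = l
  induction l with
  | nil => simp
  | cons i l ih =>
    rw [List.map_cons, List.prod_cons, List.map_cons, List.prod_cons, List.map_cons, List.prod_cons,
      ih, Pi.add_apply, mul_add, zpow_add]
    have : Commute ((σ i) ^ (2 * h i)) (l.map fun i => σ i ^ (2 * g i)).prod := by
      refine Commute.list_prod_right _ _ fun x hx => ?_
      obtain ⟨j, -, rfl⟩ := List.mem_map.1 hx
      exact ((hσ i j).zpow_left _).zpow_right _
    rw [mul_assoc, ← mul_assoc (_ ^ (2 * h i)), this.eq, mul_assoc, mul_assoc]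

theorem sigmaPow_single (i : Fin n) (k : ℤ) : sigmaPow σ (Pi.single i k) = σ i ^ (2 * k) := by
  rw [sigmaPow, List.ofFn_eq_map, List.prod_map_eq_pow_single i]
  · rw [List.count_eq_one_of_mem (List.nodup_finRange n) (List.mem_finRange i), pow_one,
      Pi.single_eq_same]
  · intro j hj _
    rw [Pi.single_eq_of_ne hj, mul_zero, zpow_zero]

theorem sigmaPow_zero : sigmaPow σ 0 = 1 := by
  simp [sigmaPow]

theorem sigmaPow_neg (hσ : ∀ i j, Commute (σ i) (σ j)) (g : Fin n → ℤ) :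
    sigmaPow σ (-g) = (sigmaPow σ g)⁻¹ := by
  rw [eq_inv_iff_mul_eq_one, ← sigmaPow_add hσ, neg_add_cancel, sigmaPow_zero]

theorem translate_add (hσ : ∀ i j, Commute (σ i) (σ j)) (g h : Fin n → ℤ) (m : MaximalSpectrum R) :
    translate (sigmaPow σ (g + h)) m = translate (sigmaPow σ g) (translate (sigmaPow σ h) m) := by
  rw [sigmaPow_add hσ, translate_mul]

theorem translate_zero (m : MaximalSpectrum R) : translate (sigmaPow σ 0) m = m := by
  rw [sigmaPow_zero, translate_one]

variable {O : Set (MaximalSpectrum R)}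

theorem IsOrbit.nonempty (hO : IsOrbit σ O) : O.Nonempty := by
  obtain ⟨m, rfl⟩ := hO
  exact ⟨m, 0, by rw [shift_eq, translate_zero]⟩

theorem IsOrbit.translate_mem (hσ : ∀ i j, Commute (σ i) (σ j)) (hO : IsOrbit σ O)
    {m : MaximalSpectrum R} (hm : m ∈ O) (g : Fin n → ℤ) : translate (sigmaPow σ g) m ∈ O := by
  obtain ⟨m₀, rfl⟩ := hO
  obtain ⟨h, hm⟩ := hm
  refine ⟨g + h, ?_⟩
  rw [shift_eq, translate_add hσ]
  rw [shift_eq] at hm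
  rw [MaximalSpectrum.ext hm]

theorem IsOrbit.exists_translate (hσ : ∀ i j, Commute (σ i) (σ j)) (hO : IsOrbit σ O)
    {m m' : MaximalSpectrum R} (hm : m ∈ O) (hm' : m' ∈ O) :
    ∃ g, m' = translate (sigmaPow σ g) m := by
  obtain ⟨m₀, rfl⟩ := hO
  obtain ⟨g, hm⟩ := hm
  obtain ⟨h, hm'⟩ := hm'
  rw [shift_eq] at hm hm'
  refine ⟨h - g, ?_⟩
  rw [MaximalSpectrum.ext hm, MaximalSpectrum.ext hm', ← translate_add hσ, sub_add_cancel]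

/-- Trivial stabilizers let the degree of an operator be read off from the weight it reaches. -/
theorem IsTorsionFreeOrbit.translate_injective (hσ : ∀ i j, Commute (σ i) (σ j))
    (hO : IsTorsionFreeOrbit σ O) {m : MaximalSpectrum R} (hm : m ∈ O) {g h : Fin n → ℤ}
    (e : translate (sigmaPow σ g) m = translate (sigmaPow σ h) m) : g = h := by
  have h1 : translate (sigmaPow σ (-h + g)) m = m := by
    rw [translate_add hσ, e, ← translate_add hσ, neg_add_cancel, translate_zero]
  have h2 := hO.2 m hm (-h + g) (by rw [shift_eq, h1])
  exact (neg_add_eq_zero.1 h2).symm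

end Translation

/-! ### Words in the letters `X_i^±` and their normal form. -/

section Words

variable {R : Type u} [CommRing R] {n : ℕ}

/-- The degree of the letter `X_i^ε`. -/
def letterDeg (p : Fin n × ℤˣ) : Fin n → ℤ := Pi.single p.1 (p.2 : ℤ)

/-- The degree of a word in the letters `X_i^ε`. -/
def wordDeg (w : List (Fin n × ℤˣ)) : Fin n → ℤ := (w.map letterDeg).sum

@[simp] theorem wordDeg_nil : wordDeg ([] : List (Fin n × ℤˣ)) = 0 := rfl

@[simp] theorem wordDeg_cons (p : Fin n × ℤˣ) (w : List (Fin n × ℤˣ)) :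
    wordDeg (p :: w) = letterDeg p + wordDeg w := by simp [wordDeg]

@[simp] theorem wordDeg_append (w w' : List (Fin n × ℤˣ)) :
    wordDeg (w ++ w') = wordDeg w + wordDeg w' := by simp [wordDeg]

/-- The word that is read backwards and with opposite signs. -/
def wordStar (w : List (Fin n × ℤˣ)) : List (Fin n × ℤˣ) :=
  (w.map fun p => (p.1, -p.2)).reverse

theorem wordStar_cons (p : Fin n × ℤˣ) (w : List (Fin n × ℤˣ)) :
    wordStar (p :: w) = wordStar w ++ [(p.1, -p.2)] := by simp [wordStar]

theorem letterDeg_neg (i : Fin n) (ε : ℤˣ) : letterDeg (i, -ε) = -letterDeg (i, ε) := by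
  simp [letterDeg, Pi.single_neg]

theorem wordDeg_wordStar (w : List (Fin n × ℤˣ)) : wordDeg (wordStar w) = -wordDeg w := by
  induction w with
  | nil => simp [wordStar]
  | cons p w ih => rw [wordStar_cons, wordDeg_append, ih, wordDeg_cons, wordDeg_cons, letterDeg_neg,
      wordDeg_nil, add_zero, neg_add_rev]

/-- Degrees of words form a subgroup, by concatenation and `wordStar`, and it contains the unit
vectors. -/
theorem exists_wordDeg_eq (g : Fin n → ℤ) : ∃ w : List (Fin n × ℤˣ), wordDeg w = g := by
  let H : AddSubgroup (Fin n → ℤ) :=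
    { carrier := {g | ∃ w : List (Fin n × ℤˣ), wordDeg w = g}
      zero_mem' := ⟨[], rfl⟩
      add_mem' := by
        rintro _ _ ⟨w, rfl⟩ ⟨w', rfl⟩
        exact ⟨w ++ w', wordDeg_append w w'⟩
      neg_mem' := by
        rintro _ ⟨w, rfl⟩
        exact ⟨wordStar w, wordDeg_wordStar w⟩ }
  change g ∈ H
  rw [← Finset.univ_sum_single g]
  refine sum_mem fun i _ => ?_
  have h1 : Pi.single i (1 : ℤ) ∈ H := ⟨[(i, 1)], by simp [letterDeg]⟩
  have h2 := H.zsmul_mem h1 (g i)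
  rwa [← Pi.single_smul, smul_eq_mul, mul_one] at h2

variable (σ : Fin n → RingAut R) (t : Fin n → R)

/-- The element of the twisted generalized Weyl construction that is given by a word. -/
def word (w : List (Fin n × ℤˣ)) : TGWC σ t := (w.map fun p => TGWC.X σ t p.1 p.2).prod

@[simp] theorem word_nil : word σ t [] = 1 := rfl

@[simp] theorem word_cons (p : Fin n × ℤˣ) (w : List (Fin n × ℤˣ)) :
    word σ t (p :: w) = TGWC.X σ t p.1 p.2 * word σ t w := by simp [word]

@[simp] theorem word_append (w w' : List (Fin n × ℤˣ)) :
    word σ t (w ++ w') = word σ t w * word σ t w' := by simp [word]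

variable {σ} {t}

theorem sigmaPow_letterDeg [IsDomain R] (i : Fin n) (ε : ℤˣ) :
    sigmaPow σ (letterDeg (i, ε)) = σ i ^ (2 * (ε : ℤ)) := sigmaPow_single i _

theorem X_mul_ofR [IsDomain R] (i : Fin n) (ε : ℤˣ) (r : R) : TGWC.X σ t i ε * TGWC.ofR σ t r =
    TGWC.ofR σ t (sigmaPow σ (letterDeg (i, ε)) r) * TGWC.X σ t i ε := by
  rw [sigmaPow_letterDeg, TGWC.X_mul_ofR]

variable [IsDomain R]

theorem word_mul_ofR (hσ : ∀ i j, Commute (σ i) (σ j)) (w : List (Fin n × ℤˣ)) (r : R) :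
    word σ t w * TGWC.ofR σ t r = TGWC.ofR σ t (sigmaPow σ (wordDeg w) r) * word σ t w := by
  induction w with
  | nil => simp [sigmaPow_zero]
  | cons p w ih => rw [word_cons, mul_assoc, ih, ← mul_assoc, X_mul_ofR, wordDeg_cons,
      sigmaPow_add hσ, RingAut.mul_apply, mul_assoc]

/-- The twist relation moves coefficients to the left of letters, so the sums of terms `r w` are
stable under left multiplication. They contain `1`. -/
theorem word_induction {P : TGWC σ t → Prop} (h0 : P 0) (hadd : ∀ a b, P a → P b → P (a + b))
    (hw : ∀ r w, P (TGWC.ofR σ t r * word σ t w)) (a) : P a := by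
  let S : Set (TGWC σ t) := {a | ∃ r w, a = TGWC.ofR σ t r * word σ t w}
  have key : ∀ a : TGWC σ t, ∀ b ∈ AddSubmonoid.closure S, a * b ∈ AddSubmonoid.closure S := by
    intro a
    induction a using TGWC.induction with
    | hR s =>
      intro b hb
      induction hb using AddSubmonoid.closure_induction with
      | mem b hb =>
        obtain ⟨r, w, rfl⟩ := hb
        rw [← mul_assoc, ← map_mul]
        exact AddSubmonoid.subset_closure ⟨_, _, rfl⟩
      | zero => rw [mul_zero]; exact zero_mem _
      | add b c _ _ hb hc => rw [mul_add]; exact add_mem hb hc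
    | hX i ε =>
      intro b hb
      induction hb using AddSubmonoid.closure_induction with
      | mem b hb =>
        obtain ⟨r, w, rfl⟩ := hb
        rw [← mul_assoc, TGWC.X_mul_ofR, mul_assoc]
        exact AddSubmonoid.subset_closure ⟨_, (i, ε) :: w, by rw [word_cons]⟩
      | zero => rw [mul_zero]; exact zero_mem _
      | add b c _ _ hb hc => rw [mul_add]; exact add_mem hb hc
    | hadd a b ha hb => intro c hc; rw [add_mul]; exact add_mem (ha c hc) (hb c hc)
    | hmul a b ha hb => intro c hc; rw [mul_assoc]; exact ha _ (hb c hc)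
  have h1 := key a 1 (AddSubmonoid.subset_closure ⟨1, [], by simp⟩)
  rw [mul_one] at h1
  induction h1 using AddSubmonoid.closure_induction with
  | mem b hb => obtain ⟨r, w, rfl⟩ := hb; exact hw r w
  | zero => exact h0
  | add b c _ _ hb hc => exact hadd b c hb hc

/-- The word `X_{i_1}^ε ⋯ X_{i_k}^ε`. -/
def pureWord (ε : ℤˣ) (l : List (Fin n)) : List (Fin n × ℤˣ) := l.map fun i => (i, ε)

theorem pureWord_cons (ε : ℤˣ) (i : Fin n) (l : List (Fin n)) :
    pureWord ε (i :: l) = (i, ε) :: pureWord ε l := rfl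

theorem pureWord_concat (ε : ℤˣ) (i : Fin n) (l : List (Fin n)) :
    pureWord ε (l ++ [i]) = pureWord ε l ++ [(i, ε)] := by simp [pureWord]

theorem wordDeg_pureWord (ε : ℤˣ) (l : List (Fin n)) (j : Fin n) :
    wordDeg (pureWord ε l) j = ε * l.count j := by
  induction l with
  | nil => simp [pureWord]
  | cons i l ih =>
    rw [pureWord_cons, wordDeg_cons, Pi.add_apply, ih, List.count_cons, letterDeg]
    by_cases h : i = j
    · subst h; simp; ring
    · simp [h]

theorem pureWord_mul_X_of_notMem (ε : ℤˣ) (i : Fin n) (l : List (Fin n)) (h : i ∉ l) :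
    word σ t (pureWord ε l) * TGWC.X σ t i (-ε) = TGWC.X σ t i (-ε) * word σ t (pureWord ε l) := by
  induction l with
  | nil => simp [pureWord]
  | cons k l ih =>
    rw [List.mem_cons, not_or] at h
    rw [pureWord_cons, word_cons, mul_assoc, ih h.2, ← mul_assoc,
      TGWC.X_mul_X_of_ne σ t k i ε (Ne.symm h.1), mul_assoc]

/-- The letter `X_i^{-ε}` moves left past letters of other indices until it meets the last `X_i^ε`.
The pair collapses to a scalar, which the twist relation carries to the front. -/
theorem pureWord_mul_X_of_mem (ε : ℤˣ) (i : Fin n) (l : List (Fin n)) (h : i ∈ l) :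
    ∃ r l', l.Perm (i :: l') ∧ word σ t (pureWord ε l) * TGWC.X σ t i (-ε) =
      TGWC.ofR σ t r * word σ t (pureWord ε l') := by
  induction l with
  | nil => simp at h
  | cons k l ih =>
    by_cases hl : i ∈ l
    · obtain ⟨r, l', h1, h2⟩ := ih hl
      refine ⟨sigmaPow σ (letterDeg (k, ε)) r, k :: l', (h1.cons k).trans (List.Perm.swap i k l'), ?_⟩
      rw [pureWord_cons, word_cons, mul_assoc, h2, ← mul_assoc, X_mul_ofR, mul_assoc,
        pureWord_cons, word_cons]
    · obtain rfl : i = k := (List.mem_cons.1 h).resolve_right hl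
      refine ⟨(σ i ^ (ε : ℤ)) (t i), l, List.Perm.refl _, ?_⟩
      rw [pureWord_cons, word_cons, mul_assoc, pureWord_mul_X_of_notMem ε i l hl, ← mul_assoc,
        TGWC.X_mul_X_neg]

/-- Negative letters are collected on the left, positive ones on the right. A new negative letter at
the right end either cancels against a positive letter of the same index or commutes past all of
them. Letters of equal sign are never interchanged, since no relation allows it. -/
theorem exists_normalForm (hσ : ∀ i j, Commute (σ i) (σ j)) (w : List (Fin n × ℤˣ)) :
    ∃ r q p, word σ t w = TGWC.ofR σ t r * (word σ t (pureWord (-1) q) * word σ t (pureWord 1 p)) ∧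
      wordDeg w = wordDeg (pureWord (-1) q) + wordDeg (pureWord 1 p) := by
  induction w using List.reverseRecOn with
  | nil => exact ⟨1, [], [], by simp [pureWord], by simp [pureWord]⟩
  | append_singleton w x ih =>
    obtain ⟨r, q, p, h1, h2⟩ := ih
    obtain ⟨i, ε⟩ := x
    rcases Int.units_eq_one_or ε with rfl | rfl
    · refine ⟨r, q, p ++ [i], ?_, ?_⟩
      · rw [pureWord_concat, word_append, word_append, h1, mul_assoc, mul_assoc]
      · rw [pureWord_concat, wordDeg_append, wordDeg_append, h2, add_assoc]
    · by_cases hi : i ∈ p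
      · obtain ⟨s, p', h3, h4⟩ := pureWord_mul_X_of_mem (σ := σ) (t := t) 1 i p hi
        refine ⟨r * sigmaPow σ (wordDeg (pureWord (-1) q)) s, q, p', ?_, ?_⟩
        · rw [word_append, h1, word_cons, word_nil, mul_one, mul_assoc, mul_assoc, h4, map_mul,
            mul_assoc, ← mul_assoc _ (TGWC.ofR σ t s), word_mul_ofR hσ, mul_assoc]
        · rw [wordDeg_append, h2, add_assoc]
          congr 1
          ext j
          rw [Pi.add_apply, wordDeg_pureWord, wordDeg_pureWord, h3.count_eq, List.count_cons,
            wordDeg_cons, letterDeg]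
          by_cases h : i = j
          · subst h; simp
          · simp [h]
      · refine ⟨r, q ++ [i], p, ?_, ?_⟩
        · rw [pureWord_concat, word_append, word_append, h1, word_cons, word_nil, mul_one, mul_assoc,
            mul_assoc, pureWord_mul_X_of_notMem 1 i p hi, mul_assoc]
        · rw [pureWord_concat, wordDeg_append, wordDeg_append, h2]
          abel

theorem exists_pureWord_mul_pureWord (q p : List (Fin n))
    (h : q.Perm p) :
    ∃ r, word σ t (pureWord (-1) q) * word σ t (pureWord 1 p) = TGWC.ofR σ t r := by
  induction p generalizing q with
  | nil => exact ⟨1, by simp [List.perm_nil.1 h, pureWord]⟩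
  | cons i p ih =>
    obtain ⟨r, q', h1, h2⟩ := pureWord_mul_X_of_mem (σ := σ) (t := t) (-1) i q
      (h.mem_iff.2 List.mem_cons_self)
    obtain ⟨s, hs⟩ := ih q' ((List.perm_cons i).1 (h1.symm.trans h))
    refine ⟨r * s, ?_⟩
    rw [neg_neg] at h2
    rw [pureWord_cons, word_cons, ← mul_assoc, h2, mul_assoc, hs, map_mul]

/-- In degree zero the normal form contains each `X_i^-` as often as `X_i^+`, and they all cancel.
Hence the degree-zero part of the construction is the image of `R`. -/
theorem exists_word_eq_ofR (hσ : ∀ i j, Commute (σ i) (σ j)) (w : List (Fin n × ℤˣ))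
    (hw : wordDeg w = 0) : ∃ r, word σ t w = TGWC.ofR σ t r := by
  obtain ⟨r, q, p, h1, h2⟩ := exists_normalForm (t := t) hσ w
  have hqp : q.Perm p := by
    rw [List.perm_iff_count]
    intro j
    have h3 := congrFun h2 j
    rw [hw, Pi.add_apply, wordDeg_pureWord, wordDeg_pureWord, Pi.zero_apply] at h3
    simp at h3
    omega
  obtain ⟨s, hs⟩ := exists_pureWord_mul_pureWord (σ := σ) (t := t) q p hqp
  exact ⟨r * s, by rw [h1, hs, map_mul]⟩

/-- The innermost pair `X_i^{-ε} X_i^ε` collapses first, and so on outwards; the scalar is a product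
of translates of the `σ_i^{±1/2}(t_i)`. The submonoid `G` records what survives: not lying in ideals
of `O` in one application, being nonzero in the other. -/
theorem exists_wordStar_mul_word (hσ : ∀ i j, Commute (σ i) (σ j)) (G : Submonoid R)
    (hG : ∀ i (ε : ℤˣ), (σ i ^ (ε : ℤ)) (t i) ∈ G) (hG' : ∀ g, ∀ r ∈ G, sigmaPow σ g r ∈ G)
    (w : List (Fin n × ℤˣ)) :
    ∃ r ∈ G, word σ t (wordStar w) * word σ t w = TGWC.ofR σ t r := by
  induction w with
  | nil => exact ⟨1, one_mem _, by simp [wordStar]⟩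
  | cons p w ih =>
    obtain ⟨i, ε⟩ := p
    obtain ⟨r, hr, h⟩ := ih
    refine ⟨sigmaPow σ (wordDeg (wordStar w)) ((σ i ^ ((-ε : ℤˣ) : ℤ)) (t i)) * r,
      mul_mem (hG' _ _ (hG i (-ε))) hr, ?_⟩
    have h1 := TGWC.X_mul_X_neg σ t i (-ε)
    rw [neg_neg] at h1
    rw [wordStar_cons, word_append, word_cons, word_cons, word_nil, mul_one, mul_assoc,
      ← mul_assoc (TGWC.X σ t i (-ε)), h1, ← mul_assoc, word_mul_ofR hσ, mul_assoc, h, map_mul]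

end Words

/-! ### The `ℤ^n`-grading of the twisted generalized Weyl construction. -/

section Grading

variable {R : Type u} [CommRing R] {n : ℕ} (σ : Fin n → RingAut R) (t : Fin n → R)

open AddMonoidAlgebra in
/-- The coaction that defines the grading by `ℤ^n` of the twisted generalized Weyl construction. -/
def coaction : TGWC σ t →+* AddMonoidAlgebra (TGWC σ t) (Fin n → ℤ) :=
  TGWC.lift σ t (FreeAlgebra.lift ℤ (Sum.elim (fun r => single 0 (TGWC.ofR σ t r))
      fun p => single (letterDeg p) (TGWC.X σ t p.1 p.2))).toRingHom <| by
    intro x y h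
    induction h with
    | one => simp [letR, AddMonoidAlgebra.one_def]
    | add r s => simp [letR, single_add]
    | mul r s => simp [letR, single_mul_single]
    | twist i ε r =>
      simp only [letX, letR, AlgHom.toRingHom_eq_coe, map_mul, RingHom.coe_coe,
        FreeAlgebra.lift_ι_apply, Sum.elim_inl, Sum.elim_inr, single_mul_single]
      rw [add_zero, zero_add, TGWC.X_mul_ofR]
    | same i ε =>
      simp only [letX, letR, AlgHom.toRingHom_eq_coe, map_mul, RingHom.coe_coe,
        FreeAlgebra.lift_ι_apply, Sum.elim_inl, Sum.elim_inr, single_mul_single]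
      rw [letterDeg_neg, add_neg_cancel, TGWC.X_mul_X_neg]
    | comm i j ε h =>
      simp only [letX, AlgHom.toRingHom_eq_coe, map_mul, RingHom.coe_coe,
        FreeAlgebra.lift_ι_apply, Sum.elim_inr, single_mul_single]
      rw [TGWC.X_mul_X_of_ne σ t i j ε h, add_comm]

theorem coaction_ofR (r : R) :
    coaction σ t (TGWC.ofR σ t r) = AddMonoidAlgebra.single 0 (TGWC.ofR σ t r) := by
  change coaction σ t (TGWC.mk _ _ (letR n r)) = _
  rw [coaction, TGWC.lift_mk]
  simp only [letR, AlgHom.toRingHom_eq_coe, RingHom.coe_coe, FreeAlgebra.lift_ι_apply,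
    Sum.elim_inl]

theorem coaction_X (i : Fin n) (ε : ℤˣ) : coaction σ t (TGWC.X σ t i ε) =
    AddMonoidAlgebra.single (letterDeg (i, ε)) (TGWC.X σ t i ε) := by
  change coaction σ t (TGWC.mk _ _ (letX R i ε)) = _
  rw [coaction, TGWC.lift_mk]
  simp only [letX, AlgHom.toRingHom_eq_coe, RingHom.coe_coe, FreeAlgebra.lift_ι_apply,
    Sum.elim_inr]

theorem coaction_word (w : List (Fin n × ℤˣ)) :
    coaction σ t (word σ t w) = AddMonoidAlgebra.single (wordDeg w) (word σ t w) := by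
  induction w with
  | nil => rw [word_nil, map_one, AddMonoidAlgebra.one_def, wordDeg_nil]
  | cons p w ih => rw [word_cons, map_mul, ih, coaction_X, AddMonoidAlgebra.single_mul_single,
      wordDeg_cons]

/-- The component of degree `g`. -/
def comp (g : Fin n → ℤ) : TGWC σ t →+ TGWC σ t where
  toFun a := (coaction σ t a).coeff g
  map_zero' := by rw [map_zero]; rfl
  map_add' a b := by rw [map_add]; rfl

theorem comp_ofR_mul (g : Fin n → ℤ) (r : R) (a : TGWC σ t) :
    comp σ t g (TGWC.ofR σ t r * a) = TGWC.ofR σ t r * comp σ t g a := by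
  change (coaction σ t _).coeff g = _ * (coaction σ t _).coeff g
  rw [map_mul, coaction_ofR, AddMonoidAlgebra.coeff_single_zero_mul]

theorem comp_mul_ofR (g : Fin n → ℤ) (r : R) (a : TGWC σ t) :
    comp σ t g (a * TGWC.ofR σ t r) = comp σ t g a * TGWC.ofR σ t r := by
  change (coaction σ t _).coeff g = (coaction σ t _).coeff g * _
  rw [map_mul, coaction_ofR, AddMonoidAlgebra.coeff_mul_single_zero]

theorem comp_mul_word (g : Fin n → ℤ) (w : List (Fin n × ℤˣ)) (a : TGWC σ t) :
    comp σ t (g + wordDeg w) (a * word σ t w) = comp σ t g a * word σ t w := by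
  change (coaction σ t _).coeff _ = (coaction σ t _).coeff g * _
  rw [map_mul, coaction_word, AddMonoidAlgebra.coeff_mul_single_add]

theorem comp_word (w : List (Fin n × ℤˣ)) :
    comp σ t (wordDeg w) (word σ t w) = word σ t w := by
  change (coaction σ t _).coeff _ = _
  rw [coaction_word, AddMonoidAlgebra.coeff_single, Finsupp.single_eq_same]

theorem comp_word_of_ne {g : Fin n → ℤ} (w : List (Fin n × ℤˣ)) (h : wordDeg w ≠ g) :
    comp σ t g (word σ t w) = 0 := by
  change (coaction σ t _).coeff _ = _
  rw [coaction_word, AddMonoidAlgebra.coeff_single, Finsupp.single_eq_of_ne (Ne.symm h)]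

theorem comp_ofR (r : R) : comp σ t 0 (TGWC.ofR σ t r) = TGWC.ofR σ t r := by
  have h := comp_ofR_mul σ t 0 r (word σ t [])
  have h1 := comp_word σ t []
  rw [wordDeg_nil] at h1
  rwa [h1, word_nil, mul_one] at h

variable [IsDomain R]

variable {σ t} in
theorem comp_induction {P : TGWC σ t → Prop} (g : Fin n → ℤ) (h0 : P 0)
    (hadd : ∀ a b, P a → P b → P (a + b))
    (hw : ∀ r w, wordDeg w = g → P (TGWC.ofR σ t r * word σ t w)) (a) : P (comp σ t g a) := by
  induction a using word_induction with
  | h0 => rw [map_zero]; exact h0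
  | hadd a b ha hb => rw [map_add]; exact hadd _ _ ha hb
  | hw r w =>
    rw [comp_ofR_mul]
    by_cases h : wordDeg w = g
    · subst h; rw [comp_word]; exact hw r w rfl
    · rw [comp_word_of_ne σ t w h, mul_zero]; exact h0

/-- An element is the finite sum of its components. -/
theorem mem_of_comp_mem (S : AddSubmonoid (TGWC σ t)) (a : TGWC σ t)
    (h : ∀ g, comp σ t g a ∈ S) : a ∈ S := by
  have key : (coaction σ t a).coeff.sum (fun _ b => b) = a := by
    clear h
    induction a using word_induction with
    | h0 => rw [map_zero]; rfl
    | hadd a b ha hb =>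
      rw [map_add, AddMonoidAlgebra.coeff_add, Finsupp.sum_add_index' (fun _ => rfl)
        fun _ _ _ => rfl, ha, hb]
    | hw r w =>
      rw [map_mul, coaction_ofR, coaction_word, AddMonoidAlgebra.single_mul_single, zero_add,
        AddMonoidAlgebra.coeff_single, Finsupp.sum_single_index rfl]
  rw [← key]
  exact sum_mem fun g _ => h g

theorem exists_comp_zero_eq (hσ : ∀ i j, Commute (σ i) (σ j)) (a : TGWC σ t) :
    ∃ r, comp σ t 0 a = TGWC.ofR σ t r := by
  refine comp_induction (P := fun x => ∃ r, x = TGWC.ofR σ t r) 0 ⟨0, (map_zero _).symm⟩ ?_ ?_ a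
  · rintro _ _ ⟨r, rfl⟩ ⟨s, rfl⟩
    exact ⟨r + s, by rw [map_add]⟩
  · intro r w h
    obtain ⟨s, hs⟩ := exists_word_eq_ofR (t := t) hσ w h
    exact ⟨r * s, by rw [hs, map_mul]⟩

/-- Scalars have degree zero, so one `r` kills every component of an element that it kills: the
torsion ideal is homogeneous. -/
theorem comp_mem_torsionIdeal (g : Fin n → ℤ) {a : TGWC σ t} (ha : a ∈ torsionIdeal σ t) :
    comp σ t g a ∈ torsionIdeal σ t := by
  obtain ⟨r, hr, h⟩ := mem_torsionIdeal.1 ha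
  exact mem_torsionIdeal.2 ⟨r, hr, by rw [← comp_ofR_mul, h, map_zero]⟩

end Grading

variable {R : Type u} [CommRing R] [IsDomain R] {n : ℕ} {σ : Fin n → RingAut R} {t : Fin n → R}
  {O : Set (MaximalSpectrum R)}

/-! ### Words acting on weight modules, and parameters that are invertible on the orbit. -/

section WordAction

/-- The element of `A(t)` that is given by a word. -/
def aword (σ : Fin n → RingAut R) (t : Fin n → R) (w : List (Fin n × ℤˣ)) : TGWA σ t :=
  TGWA.proj σ t (word σ t w)

theorem aword_nil : aword σ t [] = 1 := map_one _

theorem aword_cons (p : Fin n × ℤˣ) (w : List (Fin n × ℤˣ)) :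
    aword σ t (p :: w) = TGWA.X σ t p.1 p.2 * aword σ t w := by
  rw [aword, word_cons, map_mul]; rfl

theorem aword_mul_ofR (hσ : ∀ i j, Commute (σ i) (σ j)) (w : List (Fin n × ℤˣ)) (r : R) :
    aword σ t w * TGWA.ofR σ t r = TGWA.ofR σ t (sigmaPow σ (wordDeg w) r) * aword σ t w := by
  simp only [aword, TGWA.ofR, RingHom.comp_apply, ← map_mul, word_mul_ofR hσ]

variable {M : Type u} [AddCommGroup M] [Module R M] [Module (TGWA σ t) M] [IsInduced σ t M]

theorem aword_smul_smul (hσ : ∀ i j, Commute (σ i) (σ j)) (w : List (Fin n × ℤˣ)) (r : R) (v : M) :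
    aword σ t w • r • v = sigmaPow σ (wordDeg w) r • aword σ t w • v := by
  rw [← IsInduced.ofR_smul (σ := σ) (t := t), ← mul_smul, aword_mul_ofR hσ, mul_smul,
    IsInduced.ofR_smul]

theorem aword_smul_mem (hσ : ∀ i j, Commute (σ i) (σ j)) (w : List (Fin n × ℤˣ))
    {m : MaximalSpectrum R} {v : M} (hv : v ∈ weightSpace M m) :
    aword σ t w • v ∈ weightSpace M (translate (sigmaPow σ (wordDeg w)) m) := by
  rw [mem_weightSpace]
  intro r hr
  rw [mem_translate] at hr
  rw [← apply_inv_self (sigmaPow σ (wordDeg w)) r, ← aword_smul_smul hσ,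
    mem_weightSpace.1 hv _ hr, smul_zero]

theorem X_smul_smul' (i : Fin n) (ε : ℤˣ) (r : R) (v : M) : TGWA.X σ t i ε • r • v =
    sigmaPow σ (letterDeg (i, ε)) r • TGWA.X σ t i ε • v := by
  rw [sigmaPow_letterDeg, X_smul_smul]

theorem X_smul_mem (i : Fin n) (ε : ℤˣ) {m : MaximalSpectrum R} {v : M}
    (hv : v ∈ weightSpace M m) :
    TGWA.X σ t i ε • v ∈ weightSpace M (translate (sigmaPow σ (letterDeg (i, ε))) m) := by
  rw [mem_weightSpace]
  intro r hr
  rw [mem_translate] at hr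
  rw [← apply_inv_self (sigmaPow σ (letterDeg (i, ε))) r, ← X_smul_smul',
    mem_weightSpace.1 hv _ hr, smul_zero]

/-- The submonoid of all elements of `R` that lie in no maximal ideal in `O`. -/
def away (O : Set (MaximalSpectrum R)) : Submonoid R where
  carrier := {r | ∀ m ∈ O, r ∉ m.asIdeal}
  one_mem' := fun m _ h => m.isMaximal.ne_top <| (Ideal.eq_top_iff_one _).2 h
  mul_mem' := fun hr hs m hm h =>
    (m.isMaximal.isPrime.mem_or_mem h).elim (hr m hm) (hs m hm)

theorem sigmaPow_mem_away (hσ : ∀ i j, Commute (σ i) (σ j)) (hO : IsOrbit σ O) (g : Fin n → ℤ)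
    (r : R) (hr : r ∈ away O) : sigmaPow σ g r ∈ away O := by
  intro m hm h
  refine hr _ (hO.translate_mem hσ hm (-g)) ?_
  rw [mem_translate, sigmaPow_neg hσ, inv_inv]
  exact h

/-- The definition of `awayFrom` only speaks of `σ_i^{1/2}(t_i)`. The value `σ_i^{-1/2}(t_i)` is its
image under `σ_i^{-1}`, and `O` is stable under the action. -/
theorem zpow_mem_away (hσ : ∀ i j, Commute (σ i) (σ j)) (hO : IsOrbit σ O)
    (ht : t ∈ awayFrom σ O) (i : Fin n) (ε : ℤˣ) : (σ i ^ (ε : ℤ)) (t i) ∈ away O := by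
  have h1 : σ i (t i) ∈ away O := ht i
  rcases Int.units_eq_one_or ε with rfl | rfl
  · simpa using h1
  · have h2 := sigmaPow_mem_away hσ hO (Pi.single i (-1)) _ h1
    rw [sigmaPow_single, ← RingAut.mul_apply, ← zpow_add_one] at h2
    simpa using h2

theorem exists_wordStar_mul_word_away (hσ : ∀ i j, Commute (σ i) (σ j)) (hO : IsOrbit σ O)
    (ht : t ∈ awayFrom σ O) (w : List (Fin n × ℤˣ)) :
    ∃ r ∈ away O, word σ t (wordStar w) * word σ t w = TGWC.ofR σ t r :=
  exists_wordStar_mul_word hσ _ (zpow_mem_away hσ hO ht) (sigmaPow_mem_away hσ hO) w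

theorem exists_wordStar_mul_word_ne_zero (hσ : ∀ i j, Commute (σ i) (σ j)) (ht : ∀ i, t i ≠ 0)
    (w : List (Fin n × ℤˣ)) :
    ∃ r, r ≠ 0 ∧ word σ t (wordStar w) * word σ t w = TGWC.ofR σ t r := by
  obtain ⟨r, hr, h⟩ := exists_wordStar_mul_word hσ (nonZeroDivisors R)
    (fun i ε => mem_nonZeroDivisors_of_ne_zero (by simpa using ht i))
    (fun g r hr => mem_nonZeroDivisors_of_ne_zero (by simpa using nonZeroDivisors.ne_zero hr)) w
  exact ⟨r, nonZeroDivisors.ne_zero hr, h⟩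

/-- Following the word by its `wordStar` gives a scalar outside `m`, which is injective on the
weight space. -/
theorem aword_smul_ne_zero (hσ : ∀ i j, Commute (σ i) (σ j)) (hO : IsOrbit σ O)
    (ht : t ∈ awayFrom σ O) (w : List (Fin n × ℤˣ)) {m : MaximalSpectrum R} (hm : m ∈ O) {v : M}
    (hv : v ∈ weightSpace M m) (h0 : v ≠ 0) : aword σ t w • v ≠ 0 := by
  obtain ⟨r, hr, h⟩ := exists_wordStar_mul_word_away hσ hO ht w
  intro h1
  refine smul_ne_zero_of_notMem hv h0 (hr m hm) ?_
  rw [← IsInduced.ofR_smul (σ := σ) (t := t), TGWA.ofR, RingHom.comp_apply, ← h, map_mul, mul_smul]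
  change _ • aword σ t w • v = 0
  rw [h1, smul_zero]

/-- Bracket the product of `w`, `wordStar w'` and `w'` in two ways. The last two factors give a
scalar outside all ideals of `O`; the first two have total degree zero and give `β`. -/
theorem exists_ofR_mul_word (hσ : ∀ i j, Commute (σ i) (σ j)) (hO : IsOrbit σ O)
    (ht : t ∈ awayFrom σ O) (w w' : List (Fin n × ℤˣ)) (h : wordDeg w = wordDeg w') :
    ∃ α ∈ away O, ∃ β, TGWC.ofR σ t α * word σ t w = TGWC.ofR σ t β * word σ t w' := by
  obtain ⟨r, hr, h1⟩ := exists_wordStar_mul_word_away hσ hO ht w'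
  obtain ⟨β, h2⟩ := exists_word_eq_ofR (t := t) hσ (w ++ wordStar w')
    (by rw [wordDeg_append, wordDeg_wordStar, h, add_neg_cancel])
  refine ⟨_, sigmaPow_mem_away hσ hO (wordDeg w) r hr, β, ?_⟩
  rw [← word_mul_ofR hσ, ← h1, ← h2, word_append, mul_assoc]

end WordAction

/-! ### The degree-zero component of elements of a consistent algebra. -/

section DegZero

theorem eq_zero_of_ofR_mem_torsionIdeal (hc : IsConsistent σ t) {r : R}
    (h : TGWC.ofR σ t r ∈ torsionIdeal σ t) : r = 0 := by
  apply hc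
  rw [map_zero]
  exact (TGWA.proj_eq_zero σ t).2 h

theorem ofR_injective (hc : IsConsistent σ t) : Function.Injective (TGWC.ofR σ t) := by
  have : Function.Injective (TGWA.proj σ t ∘ TGWC.ofR σ t) := hc
  exact this.of_comp

/-- The torsion ideal is homogeneous, and consistency says that its only scalar is `0`; so the
degree-zero component descends to `A(t)` with values in `R`. -/
theorem existsUnique_degZero (hσ : ∀ i j, Commute (σ i) (σ j)) (hc : IsConsistent σ t)
    (x : TGWA σ t) : ∃! r, ∀ a, TGWA.proj σ t a = x → comp σ t 0 a = TGWC.ofR σ t r := by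
  obtain ⟨a, rfl⟩ := TGWA.proj_surjective σ t x
  obtain ⟨r, hr⟩ := exists_comp_zero_eq σ t hσ a
  refine ⟨r, fun b hb => ?_, fun s hs => ?_⟩
  · obtain ⟨s, hs⟩ := exists_comp_zero_eq σ t hσ b
    have h1 : b - a ∈ torsionIdeal σ t := by
      rw [← TGWA.proj_eq_zero, map_sub, hb, sub_self]
    have h2 := comp_mem_torsionIdeal σ t 0 h1
    rw [map_sub, hr, hs, ← map_sub] at h2
    rw [hs, sub_eq_zero.1 (eq_zero_of_ofR_mem_torsionIdeal hc h2)]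
  · exact ofR_injective hc ((hs a rfl).symm.trans hr)

/-- The component of degree zero of the elements of a consistent `A(t)`. -/
def degZero (hσ : ∀ i j, Commute (σ i) (σ j)) (hc : IsConsistent σ t) (x : TGWA σ t) : R :=
  (existsUnique_degZero hσ hc x).choose

theorem comp_zero_eq (hσ : ∀ i j, Commute (σ i) (σ j)) (hc : IsConsistent σ t) (a : TGWC σ t) :
    comp σ t 0 a = TGWC.ofR σ t (degZero hσ hc (TGWA.proj σ t a)) :=
  (existsUnique_degZero hσ hc (TGWA.proj σ t a)).choose_spec.1 a rfl

theorem degZero_proj (hσ : ∀ i j, Commute (σ i) (σ j)) (hc : IsConsistent σ t) {a : TGWC σ t} {r : R}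
    (h : comp σ t 0 a = TGWC.ofR σ t r) : degZero hσ hc (TGWA.proj σ t a) = r :=
  ofR_injective hc ((comp_zero_eq hσ hc a).symm.trans h)

theorem degZero_add (hσ : ∀ i j, Commute (σ i) (σ j)) (hc : IsConsistent σ t) (x y : TGWA σ t) :
    degZero hσ hc (x + y) = degZero hσ hc x + degZero hσ hc y := by
  obtain ⟨a, rfl⟩ := TGWA.proj_surjective σ t x
  obtain ⟨b, rfl⟩ := TGWA.proj_surjective σ t y
  rw [← map_add]
  refine degZero_proj hσ hc ?_
  rw [map_add, map_add, ← comp_zero_eq hσ hc, ← comp_zero_eq hσ hc]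

theorem degZero_ofR_mul (hσ : ∀ i j, Commute (σ i) (σ j)) (hc : IsConsistent σ t) (r : R)
    (x : TGWA σ t) : degZero hσ hc (TGWA.ofR σ t r * x) = r * degZero hσ hc x := by
  obtain ⟨a, rfl⟩ := TGWA.proj_surjective σ t x
  rw [TGWA.ofR, RingHom.comp_apply, ← map_mul]
  refine degZero_proj hσ hc ?_
  rw [comp_ofR_mul, map_mul, ← comp_zero_eq hσ hc]

theorem degZero_mul_ofR (hσ : ∀ i j, Commute (σ i) (σ j)) (hc : IsConsistent σ t) (r : R)
    (x : TGWA σ t) : degZero hσ hc (x * TGWA.ofR σ t r) = degZero hσ hc x * r := by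
  obtain ⟨a, rfl⟩ := TGWA.proj_surjective σ t x
  rw [TGWA.ofR, RingHom.comp_apply, ← map_mul]
  refine degZero_proj hσ hc ?_
  rw [comp_mul_ofR, map_mul, ← comp_zero_eq hσ hc]

theorem degZero_one (hσ : ∀ i j, Commute (σ i) (σ j)) (hc : IsConsistent σ t) :
    degZero hσ hc 1 = 1 := by
  rw [← map_one (TGWA.proj σ t)]
  refine degZero_proj hσ hc ?_
  have h := comp_ofR σ t 1
  rwa [(TGWC.ofR σ t).map_one] at h ⊢

variable {M : Type u} [AddCommGroup M] [Module R M] [Module (TGWA σ t) M] [IsInduced σ t M]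

/-- A component of degree `g` moves weight `m` to `σ^g(m)`, which equals `m` only for `g = 0`
because the stabilizer is trivial. -/
theorem wproj_smul (hσ : ∀ i j, Commute (σ i) (σ j)) (hO : IsTorsionFreeOrbit σ O)
    (hc : IsConsistent σ t) (hM : ⨆ m : MaximalSpectrum R, weightSpace M m = ⊤)
    {m : MaximalSpectrum R} (hm : m ∈ O) {v : M} (hv : v ∈ weightSpace M m) (x : TGWA σ t) :
    wproj hM m (x • v) = degZero hσ hc x • v := by
  obtain ⟨a, rfl⟩ := TGWA.proj_surjective σ t x
  rw [← IsInduced.ofR_smul (σ := σ) (t := t), TGWA.ofR, RingHom.comp_apply, ← comp_zero_eq hσ hc]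
  induction a using word_induction with
  | h0 => simp only [map_zero, zero_smul]
  | hadd a b ha hb => simp only [map_add, add_smul, ha, hb]
  | hw r w =>
    rw [comp_ofR_mul, map_mul, map_mul, mul_smul, mul_smul]
    change wproj hM m (TGWA.ofR σ t r • aword σ t w • v) = TGWA.ofR σ t r • _
    rw [IsInduced.ofR_smul, IsInduced.ofR_smul, map_smul]
    have h1 := aword_smul_mem (t := t) hσ w hv
    by_cases h : wordDeg w = 0
    · have h2 := comp_word σ t w
      rw [h, translate_zero] at h1
      rw [h] at h2
      rw [wproj_apply hM h1, h2]
      rfl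
    · rw [comp_word_of_ne σ t w h, map_zero, zero_smul, wproj_apply_of_ne hM ?_ h1]
      intro h3
      exact h (hO.translate_injective hσ hm (h3.trans (translate_zero m).symm))

end DegZero

/-! ### Modules generated by a weight vector. -/

section Cyclic

/-- A word of degree `g`. -/
def stdWord (g : Fin n → ℤ) : List (Fin n × ℤˣ) := (exists_wordDeg_eq g).choose

theorem wordDeg_stdWord (g : Fin n → ℤ) : wordDeg (stdWord g) = g := (exists_wordDeg_eq g).choose_spec

variable {M : Type u} [AddCommGroup M] [Module R M] [Module (TGWA σ t) M] [IsInduced σ t M]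

/-- The span of the vectors `w v`, where `w` is the word of degree `g` for some `g` with
`σ^g(m₀) = m`. -/
def wordSpan (σ : Fin n → RingAut R) (t : Fin n → R) {M : Type u} [AddCommGroup M] [Module R M]
    [Module (TGWA σ t) M] (m₀ : MaximalSpectrum R) (v : M) (m : MaximalSpectrum R) :
    Submodule R M :=
  Submodule.span R {x | ∃ g, translate (sigmaPow σ g) m₀ = m ∧ x = aword σ t (stdWord g) • v}

theorem wordSpan_le (hσ : ∀ i j, Commute (σ i) (σ j)) {m₀ : MaximalSpectrum R} {v : M}
    (hv : v ∈ weightSpace M m₀) (m : MaximalSpectrum R) :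
    wordSpan σ t m₀ v m ≤ weightSpace M m := by
  rw [wordSpan, Submodule.span_le]
  rintro _ ⟨g, rfl, rfl⟩
  have h := aword_smul_mem (t := t) hσ (stdWord g) hv
  rwa [wordDeg_stdWord] at h

/-- By `exists_ofR_mul_word` a word agrees with the standard word of its degree up to scalars, and
the scalar `α` on its side can be inverted on the weight space. -/
theorem aword_smul_mem_wordSpan (hσ : ∀ i j, Commute (σ i) (σ j)) (hO : IsOrbit σ O)
    (ht : t ∈ awayFrom σ O) {m₀ : MaximalSpectrum R} (hm₀ : m₀ ∈ O) {v : M}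
    (hv : v ∈ weightSpace M m₀) (w : List (Fin n × ℤˣ)) :
    aword σ t w • v ∈ wordSpan σ t m₀ v (translate (sigmaPow σ (wordDeg w)) m₀) := by
  obtain ⟨α, hα, β, h⟩ := exists_ofR_mul_word hσ hO ht w (stdWord (wordDeg w))
    (wordDeg_stdWord _).symm
  obtain ⟨s, hs⟩ := exists_smul_inverse (hα _ (hO.translate_mem hσ hm₀ (wordDeg w)))
  rw [← hs _ (aword_smul_mem hσ w hv)]
  refine Submodule.smul_mem _ _ ?_
  have h1 : α • aword σ t w • v = β • aword σ t (stdWord (wordDeg w)) • v := by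
    rw [← IsInduced.ofR_smul (σ := σ) (t := t), ← IsInduced.ofR_smul (σ := σ) (t := t), ← mul_smul,
      ← mul_smul]
    simp only [aword, TGWA.ofR, RingHom.comp_apply, ← map_mul, h]
  rw [h1]
  exact Submodule.smul_mem _ _ (Submodule.subset_span ⟨_, rfl, rfl⟩)

theorem iSup_wordSpan (hσ : ∀ i j, Commute (σ i) (σ j)) (hO : IsOrbit σ O)
    (ht : t ∈ awayFrom σ O) {m₀ : MaximalSpectrum R} (hm₀ : m₀ ∈ O) {v : M}
    (hv : v ∈ weightSpace M m₀) (hspan : Submodule.span (TGWA σ t) {v} = ⊤) :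
    ⨆ m, wordSpan σ t m₀ v m = ⊤ := by
  rw [eq_top_iff]
  rintro x -
  have hx : x ∈ Submodule.span (TGWA σ t) {v} := hspan ▸ Submodule.mem_top
  obtain ⟨a, rfl⟩ := Submodule.mem_span_singleton.1 hx
  obtain ⟨a, rfl⟩ := TGWA.proj_surjective σ t a
  clear hx
  induction a using word_induction with
  | h0 => rw [map_zero, zero_smul]; exact zero_mem _
  | hadd a b ha hb => rw [map_add, add_smul]; exact add_mem ha hb
  | hw r w =>
    rw [map_mul, mul_smul]
    change TGWA.ofR σ t r • aword σ t w • v ∈ _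
    rw [IsInduced.ofR_smul]
    exact Submodule.smul_mem _ _
      (Submodule.mem_iSup_of_mem _ (aword_smul_mem_wordSpan hσ hO ht hm₀ hv w))

theorem iSup_weightSpace_of_span (hσ : ∀ i j, Commute (σ i) (σ j)) (hO : IsOrbit σ O)
    (ht : t ∈ awayFrom σ O) {m₀ : MaximalSpectrum R} (hm₀ : m₀ ∈ O) {v : M}
    (hv : v ∈ weightSpace M m₀) (hspan : Submodule.span (TGWA σ t) {v} = ⊤) :
    ⨆ m : MaximalSpectrum R, weightSpace M m = ⊤ := by
  rw [eq_top_iff, ← iSup_wordSpan hσ hO ht hm₀ hv hspan]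
  exact iSup_mono (wordSpan_le hσ hv)

theorem weightSpace_eq_wordSpan (hσ : ∀ i j, Commute (σ i) (σ j)) (hO : IsOrbit σ O)
    (ht : t ∈ awayFrom σ O) {m₀ : MaximalSpectrum R} (hm₀ : m₀ ∈ O) {v : M}
    (hv : v ∈ weightSpace M m₀) (hspan : Submodule.span (TGWA σ t) {v} = ⊤)
    (m : MaximalSpectrum R) : weightSpace M m = wordSpan σ t m₀ v m :=
  weightSpace_eq_of_iSup_eq_top _ (wordSpan_le hσ hv) (iSup_wordSpan hσ hO ht hm₀ hv hspan) m

theorem wordSpan_translate (hσ : ∀ i j, Commute (σ i) (σ j)) (hO : IsTorsionFreeOrbit σ O)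
    {m₀ : MaximalSpectrum R} (hm₀ : m₀ ∈ O) (v : M) (g : Fin n → ℤ) :
    wordSpan σ t m₀ v (translate (sigmaPow σ g) m₀) =
      Submodule.span R {aword σ t (stdWord g) • v} := by
  rw [wordSpan]
  congr 1
  ext x
  refine ⟨?_, fun h => ⟨g, rfl, h⟩⟩
  rintro ⟨h, e, rfl⟩
  rw [hO.translate_injective hσ hm₀ e]
  rfl

theorem wordSpan_eq_bot {m₀ : MaximalSpectrum R} (v : M) {m : MaximalSpectrum R}
    (h : ∀ g, translate (sigmaPow σ g) m₀ ≠ m) : wordSpan σ t m₀ v m = ⊥ := by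
  rw [wordSpan, Submodule.span_eq_bot]
  rintro _ ⟨g, e, -⟩
  exact absurd e (h g)

/-- A module that is generated by a weight vector is a weight module if `t` is invertible on the
orbit. -/
def cyclicWMod (hσ : ∀ i j, Commute (σ i) (σ j)) (hO : IsTorsionFreeOrbit σ O)
    (ht : t ∈ awayFrom σ O) {m₀ : MaximalSpectrum R} (hm₀ : m₀ ∈ O) (M : Type u) [AddCommGroup M]
    [Module R M] [Module (TGWA σ t) M] [IsInduced σ t M] (v : M)
    (hv : v ∈ weightSpace M m₀) (hspan : Submodule.span (TGWA σ t) {v} = ⊤) : WMod σ O t where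
  carrier := M
  isInternal := isInternal_weightSpace (iSup_weightSpace_of_span hσ hO.1 ht hm₀ hv hspan)
  finite := fun m => by
    rw [weightSpace_eq_wordSpan hσ hO.1 ht hm₀ hv hspan]
    by_cases h : ∃ g, translate (sigmaPow σ g) m₀ = m
    · obtain ⟨g, rfl⟩ := h
      rw [wordSpan_translate hσ hO hm₀]
      infer_instance
    · rw [wordSpan_eq_bot v fun g e => h ⟨g, e⟩]
      infer_instance
  support := fun m hm => by
    by_contra h
    apply hm
    rw [weightSpace_eq_wordSpan hσ hO.1 ht hm₀ hv hspan, wordSpan_eq_bot]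
    rintro g rfl
    exact h (hO.1.translate_mem hσ hm₀ g)

/-- Each point of the orbit is reached from `m₀` by exactly one degree, so its weight space is
spanned by one standard word applied to `v`. That vector is nonzero because words are injective. -/
theorem exists_weight_basis (hσ : ∀ i j, Commute (σ i) (σ j)) (hO : IsTorsionFreeOrbit σ O)
    (ht : t ∈ awayFrom σ O) {m₀ : MaximalSpectrum R} (hm₀ : m₀ ∈ O) (M : WMod σ O t) {v : M}
    (hv : v ∈ weightSpace M m₀) (h0 : v ≠ 0) (hspan : Submodule.span (TGWA σ t) {v} = ⊤) :
    ∃ s : MaximalSpectrum R → M, (∀ m, weightSpace M m = Submodule.span R {s m}) ∧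
      ∀ m ∈ O, s m ≠ 0 := by
  classical
  have key : ∀ m, ∃ x : M, weightSpace M m = Submodule.span R {x} ∧ (m ∈ O → x ≠ 0) := by
    intro m
    by_cases hm : m ∈ O
    · obtain ⟨g, rfl⟩ := hO.1.exists_translate hσ hm₀ hm
      refine ⟨aword σ t (stdWord g) • v, ?_, fun _ => aword_smul_ne_zero hσ hO.1 ht _ hm₀ hv h0⟩
      rw [weightSpace_eq_wordSpan hσ hO.1 ht hm₀ hv hspan, wordSpan_translate hσ hO hm₀]
    · refine ⟨0, ?_, fun h => absurd h hm⟩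
      rw [Submodule.span_zero_singleton]
      by_contra h
      exact hm (M.support m h)
  choose s hs using key
  exact ⟨s, fun m => (hs m).1, fun m => (hs m).2⟩

end Cyclic

variable {t' u : Fin n → R}

/-! ### Existence and uniqueness of the simple module of a parameter invertible on the orbit. -/

section Simple

/-- Take the quotient of `A(t)` by a maximal left ideal containing `A(t) m₀`. The left ideal `A(t)
m₀` is proper because the degree-zero components of its elements lie in `m₀`. The class of `1` has
weight `m₀` and generates, so the quotient is a weight module. -/
theorem exists_simple (hσ : ∀ i j, Commute (σ i) (σ j)) (hO : IsTorsionFreeOrbit σ O)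
    (ht : t ∈ awayFrom σ O) (hc : IsConsistent σ t) :
    ∃ S : WMod σ O t, IsSimpleModule (TGWA σ t) S := by
  obtain ⟨m₀, hm₀⟩ := hO.1.nonempty
  let J₀ : Ideal (TGWA σ t) := Ideal.span (TGWA.ofR σ t '' (m₀.asIdeal : Set R))
  -- The extra factor `b` absorbs the left multiplications met in the induction over the span.
  have hJ₀ : ∀ x ∈ J₀, ∀ b, degZero hσ hc (b * x) ∈ m₀.asIdeal := by
    intro x hx
    induction hx using Submodule.span_induction with
    | mem x hx =>
      obtain ⟨r, hr, rfl⟩ := hx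
      intro b
      rw [degZero_mul_ofR]
      exact Ideal.mul_mem_left _ _ hr
    | zero =>
      intro b
      have h := degZero_ofR_mul hσ hc 0 0
      rw [zero_mul, mul_zero] at h
      rw [mul_zero, h]
      exact zero_mem _
    | add x y _ _ hx hy =>
      intro b
      rw [mul_add, degZero_add]
      exact add_mem (hx b) (hy b)
    | smul a x _ hx =>
      intro b
      rw [smul_eq_mul, ← mul_assoc]
      exact hx _
  have hne : J₀ ≠ ⊤ := by
    intro h
    have h1 := hJ₀ 1 (h ▸ Submodule.mem_top) 1
    rw [mul_one, degZero_one] at h1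
    exact m₀.isMaximal.ne_top ((Ideal.eq_top_iff_one _).2 h1)
  obtain ⟨J, hJ, hle⟩ := Ideal.exists_le_maximal J₀ hne
  let : Module R (TGWA σ t ⧸ J) := Module.compHom _ (TGWA.ofR σ t)
  have : IsInduced σ t (TGWA σ t ⧸ J) := ⟨fun _ _ => rfl⟩
  have hv : (Submodule.Quotient.mk 1 : TGWA σ t ⧸ J) ∈ weightSpace (TGWA σ t ⧸ J) m₀ := by
    rw [mem_weightSpace]
    intro r hr
    rw [← IsInduced.ofR_smul (σ := σ) (t := t), ← Submodule.Quotient.mk_smul, smul_eq_mul, mul_one]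
    exact (Submodule.Quotient.mk_eq_zero _).2 (hle (Ideal.subset_span ⟨r, hr, rfl⟩))
  have hspan : Submodule.span (TGWA σ t) {(Submodule.Quotient.mk 1 : TGWA σ t ⧸ J)} = ⊤ := by
    rw [eq_top_iff]
    rintro x -
    obtain ⟨a, rfl⟩ := Submodule.Quotient.mk_surjective _ x
    exact Submodule.mem_span_singleton.2
      ⟨a, by rw [← Submodule.Quotient.mk_smul, smul_eq_mul, mul_one]⟩
  exact ⟨cyclicWMod hσ hO ht hm₀ _ _ hv hspan, isSimpleModule_iff_isCoatom.2 hJ.out⟩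

theorem translate_injective (φ : RingAut R) {m m' : MaximalSpectrum R}
    (h : translate φ m = translate φ m') : m = m' := by
  have h1 := congrArg (translate φ⁻¹) h
  rwa [← translate_mul, ← translate_mul, inv_mul_cancel, translate_one, translate_one] at h1

theorem aword_smul_wproj (hσ : ∀ i j, Commute (σ i) (σ j)) {M : Type u} [AddCommGroup M]
    [Module R M] [Module (TGWA σ t) M] [IsInduced σ t M]
    (hM : ⨆ m : MaximalSpectrum R, weightSpace M m = ⊤) (w : List (Fin n × ℤˣ))
    (m : MaximalSpectrum R) (x : M) :
    aword σ t w • wproj hM m x =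
      wproj hM (translate (sigmaPow σ (wordDeg w)) m) (aword σ t w • x) := by
  induction x using weight_induction hM with
  | h0 => simp only [map_zero, smul_zero]
  | hadd v w hv hw => simp only [map_add, smul_add, hv, hw]
  | hw m' v hv =>
    have h1 := aword_smul_mem (t := t) hσ w hv
    by_cases h : m' = m
    · subst h
      rw [wproj_apply hM hv, wproj_apply hM h1]
    · rw [wproj_apply_of_ne hM h hv, wproj_apply_of_ne hM (fun e => h (translate_injective _ e)) h1,
        smul_zero]

/-- If `a v ≠ 0`, some weight component of `a v` is nonzero, and a word `b` carries it back to
weight `m₀` without killing it. By `wproj_smul` the result is the degree-zero component of `b a`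
times `v`. The criterion mentions neither `M` nor `v`, so all nonzero vectors of weight `m₀` have
the same annihilator. -/
theorem smul_eq_zero_iff_degZero (hσ : ∀ i j, Commute (σ i) (σ j)) (hO : IsTorsionFreeOrbit σ O)
    (ht : t ∈ awayFrom σ O) (hc : IsConsistent σ t) {m₀ : MaximalSpectrum R} (hm₀ : m₀ ∈ O)
    (M : WMod σ O t) {v : M} (hv : v ∈ weightSpace M m₀) (h0 : v ≠ 0) (a : TGWA σ t) :
    a • v = 0 ↔ ∀ b, degZero hσ hc (b * a) ∈ m₀.asIdeal := by
  constructor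
  · intro h b
    rw [← smul_eq_zero_iff_mem hv h0, ← wproj_smul hσ hO hc M.iSup_weightSpace hm₀ hv, mul_smul, h,
      smul_zero, map_zero]
  · intro h
    by_contra hav
    obtain ⟨m, hm⟩ := exists_wproj_ne_zero M.iSup_weightSpace hav
    have hmem := wproj_mem M.iSup_weightSpace m (a • v)
    have hmO : m ∈ O := M.support m fun e => hm (by rw [e] at hmem; exact hmem)
    obtain ⟨g, hg⟩ := hO.1.exists_translate hσ hmO hm₀
    have h1 := aword_smul_ne_zero hσ hO.1 ht (stdWord g) hmO hmem hm
    rw [aword_smul_wproj hσ, wordDeg_stdWord, ← hg, ← mul_smul,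
      wproj_smul hσ hO hc M.iSup_weightSpace hm₀ hv] at h1
    exact h1 ((smul_eq_zero_iff_mem hv h0).2 (h _))

/-- `M` is generated by a nonzero vector of weight `m₀`. -/
def IsCyclicAt (M : WMod σ O t) (m₀ : MaximalSpectrum R) : Prop :=
  ∃ v : M, v ∈ weightSpace M m₀ ∧ v ≠ 0 ∧ Submodule.span (TGWA σ t) {v} = ⊤

/-- Both modules are the quotient of `A(t)` by the same annihilator. -/
theorem nonempty_linearEquiv_of_isCyclicAt (hσ : ∀ i j, Commute (σ i) (σ j))
    (hO : IsTorsionFreeOrbit σ O) (ht : t ∈ awayFrom σ O) (hc : IsConsistent σ t)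
    {m₀ : MaximalSpectrum R} (hm₀ : m₀ ∈ O) {M N : WMod σ O t} (hM : IsCyclicAt M m₀)
    (hN : IsCyclicAt N m₀) : Nonempty (M ≃ₗ[TGWA σ t] N) := by
  obtain ⟨v, hv, hv0, hvs⟩ := hM
  obtain ⟨w, hw, hw0, hws⟩ := hN
  let f := LinearMap.toSpanSingleton (TGWA σ t) M v
  let g := LinearMap.toSpanSingleton (TGWA σ t) N w
  have hf : Function.Surjective f := by
    rw [← LinearMap.range_eq_top, LinearMap.range_toSpanSingleton, hvs]
  have hg : Function.Surjective g := by
    rw [← LinearMap.range_eq_top, LinearMap.range_toSpanSingleton, hws]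
  have hker : LinearMap.ker f = LinearMap.ker g := by
    ext a
    rw [LinearMap.mem_ker, LinearMap.mem_ker, LinearMap.toSpanSingleton_apply,
      LinearMap.toSpanSingleton_apply, smul_eq_zero_iff_degZero hσ hO ht hc hm₀ M hv hv0,
      smul_eq_zero_iff_degZero hσ hO ht hc hm₀ N hw hw0]
  exact ⟨(f.quotKerEquivOfSurjective hf).symm.trans
    ((Submodule.quotEquivOfEq _ _ hker).trans (g.quotKerEquivOfSurjective hg))⟩

/-- Some weight component of a nonzero vector is nonzero, and a word carries it injectively to
weight `m₀`, where by simplicity it generates. -/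
theorem isCyclicAt_of_isSimpleModule (hσ : ∀ i j, Commute (σ i) (σ j)) (hO : IsOrbit σ O)
    (ht : t ∈ awayFrom σ O) {m₀ : MaximalSpectrum R} (hm₀ : m₀ ∈ O) (S : WMod σ O t)
    (hS : IsSimpleModule (TGWA σ t) S) : IsCyclicAt S m₀ := by
  have := hS.nontrivial
  obtain ⟨x, hx⟩ := exists_ne (0 : S)
  obtain ⟨m, hm⟩ := exists_wproj_ne_zero S.iSup_weightSpace hx
  have hmem := wproj_mem S.iSup_weightSpace m x
  have hmO : m ∈ O := S.support m fun e => hm (by rw [e] at hmem; exact hmem)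
  obtain ⟨g, rfl⟩ := hO.exists_translate hσ hmO hm₀
  have h1 := aword_smul_ne_zero hσ hO ht (stdWord g) hmO hmem hm
  have h2 := aword_smul_mem (t := t) hσ (stdWord g) hmem
  rw [wordDeg_stdWord] at h2
  exact ⟨_, h2, h1, IsSimpleModule.span_singleton_eq_top _ h1⟩

end Simple

/-! ### Weight bases of `S` and the linear equivalence of `N` with `S ⊗ N`. -/

section Basis

/-- A family of vectors that generate the weight spaces of `S` and do not vanish on the orbit. -/
structure IsWeightBasis (S : WMod σ O u) (s : MaximalSpectrum R → S) : Prop where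
  span_eq : ∀ m, weightSpace S m = Submodule.span R {s m}
  ne_zero : ∀ m ∈ O, s m ≠ 0

theorem IsCyclicAt.exists_isWeightBasis (hσ : ∀ i j, Commute (σ i) (σ j))
    (hO : IsTorsionFreeOrbit σ O) (hu : u ∈ awayFrom σ O) {m₀ : MaximalSpectrum R} (hm₀ : m₀ ∈ O)
    {S : WMod σ O u} (hS : IsCyclicAt S m₀) : ∃ s, IsWeightBasis S s := by
  obtain ⟨v, hv, h0, hspan⟩ := hS
  obtain ⟨s, h1, h2⟩ := exists_weight_basis hσ hO hu hm₀ S hv h0 hspan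
  exact ⟨s, h1, h2⟩

namespace IsWeightBasis

variable {S : WMod σ O u} {s : MaximalSpectrum R → S}

theorem mem (hs : IsWeightBasis S s) (m : MaximalSpectrum R) : s m ∈ weightSpace S m := by
  rw [hs.span_eq]; exact Submodule.mem_span_singleton_self _

theorem exists_smul_eq (hs : IsWeightBasis S s) {m : MaximalSpectrum R} {x : S}
    (hx : x ∈ weightSpace S m) : ∃ r : R, r • s m = x := by
  rw [hs.span_eq] at hx
  exact Submodule.mem_span_singleton.1 hx

/-- On the orbit `s m` is nonzero, so both scalars agree modulo `m`; off the orbit `N` has no weight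
vectors. This makes constructions on `N` independent of the lifts to `R` chosen as coordinates in
`S`. -/
theorem smul_eq_smul (hs : IsWeightBasis S s) (N : WMod σ O t) {m : MaximalSpectrum R} {r r' : R}
    (h : r • s m = r' • s m) {v : N} (hv : v ∈ weightSpace N m) : r • v = r' • v := by
  by_cases hm : m ∈ O
  · exact smul_eq_smul_of_sub_mem hv (sub_mem_of_smul_eq (hs.mem m) (hs.ne_zero m hm) h)
  · have hv0 : v = 0 := by
      by_contra h0
      exact hm (N.support m fun e => h0 (by rw [e] at hv; exact hv))
    rw [hv0, smul_zero, smul_zero]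

/-- The coordinates with respect to a weight basis. -/
def coord (hs : IsWeightBasis S s) (x : S) (m : MaximalSpectrum R) : R :=
  (hs.exists_smul_eq (wproj_mem S.iSup_weightSpace m x)).choose

theorem coord_smul (hs : IsWeightBasis S s) (x : S) (m : MaximalSpectrum R) :
    hs.coord x m • s m = wproj S.iSup_weightSpace m x :=
  (hs.exists_smul_eq (wproj_mem S.iSup_weightSpace m x)).choose_spec

/-- The linear map `S ⊗ N → N` with `s m ⊗ v ↦ v` for `v` of weight `m`. -/
def contract (hs : IsWeightBasis S s) (N : WMod σ O t) : S ⊗[R] N →ₗ[R] N :=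
  TensorProduct.lift <| LinearMap.mk₂ R (fun x v => act N.iSup_weightSpace (hs.coord x) v)
    (fun x y v => by
      induction v using weight_induction N.iSup_weightSpace with
      | h0 => simp only [map_zero, add_zero]
      | hadd v w hv hw => simp only [map_add, hv, hw]; abel
      | hw m v hv =>
        rw [act_apply _ _ hv, act_apply _ _ hv, act_apply _ _ hv, ← add_smul]
        refine hs.smul_eq_smul N ?_ hv
        rw [add_smul, coord_smul, coord_smul, coord_smul, map_add])
    (fun r x v => by
      induction v using weight_induction N.iSup_weightSpace with
      | h0 => simp only [map_zero, smul_zero]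
      | hadd v w hv hw => simp only [map_add, smul_add, hv, hw]
      | hw m v hv =>
        rw [act_apply _ _ hv, act_apply _ _ hv, ← mul_smul]
        refine hs.smul_eq_smul N ?_ hv
        rw [mul_smul, coord_smul, coord_smul, map_smul])
    (fun x v w => map_add _ v w) (fun r x v => map_smul _ r v)

theorem contract_tmul (hs : IsWeightBasis S s) (N : WMod σ O t) {m : MaximalSpectrum R} {v : N}
    (hv : v ∈ weightSpace N m) : hs.contract N (s m ⊗ₜ[R] v) = v := by
  rw [contract, TensorProduct.lift.tmul, LinearMap.mk₂_apply, act_apply _ _ hv]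
  refine (hs.smul_eq_smul N ?_ hv).trans (one_smul R v)
  rw [coord_smul, wproj_apply _ (hs.mem m), one_smul]

/-- The linear map `N → S ⊗ N` with `v ↦ s m ⊗ v` for `v` of weight `m`. -/
def expand (s : MaximalSpectrum R → S) (N : WMod σ O t) : N →ₗ[R] S ⊗[R] N :=
  weightLift N.iSup_weightSpace fun m =>
    (TensorProduct.mk R S N (s m)) ∘ₗ (weightSpace N m).subtype

theorem expand_apply (s : MaximalSpectrum R → S) (N : WMod σ O t) {m : MaximalSpectrum R} {v : N}
    (hv : v ∈ weightSpace N m) : expand s N v = s m ⊗ₜ[R] v :=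
  weightLift_apply _ _ hv

/-- The map `contract` exists to make `expand` injective. -/
theorem contract_expand (hs : IsWeightBasis S s) (N : WMod σ O t) (v : N) :
    hs.contract N (expand s N v) = v := by
  induction v using weight_induction N.iSup_weightSpace with
  | h0 => simp only [map_zero]
  | hadd v w hv hw => simp only [map_add, hv, hw]
  | hw m v hv => rw [expand_apply s N hv, hs.contract_tmul N hv]

/-- Tensors of vectors of different weights vanish, and a vector of `S` of weight `m` is a multiple
of `s m` that can be moved to the other factor. -/
theorem expand_surjective (hs : IsWeightBasis S s) (N : WMod σ O t) :
    Function.Surjective (expand s N) := by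
  rw [← LinearMap.range_eq_top, eq_top_iff]
  rintro x -
  induction x with
  | zero => exact zero_mem _
  | add x y hx hy => exact add_mem hx hy
  | tmul x v =>
    induction x using weight_induction S.iSup_weightSpace with
    | h0 => rw [TensorProduct.zero_tmul]; exact zero_mem _
    | hadd x y hx hy => rw [TensorProduct.add_tmul]; exact add_mem hx hy
    | hw m x hx =>
      induction v using weight_induction N.iSup_weightSpace with
      | h0 => rw [TensorProduct.tmul_zero]; exact zero_mem _
      | hadd v w hv hw => rw [TensorProduct.tmul_add]; exact add_mem hv hw
      | hw m' v hv =>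
        by_cases h : m = m'
        · subst h
          obtain ⟨r, rfl⟩ := hs.exists_smul_eq hx
          refine ⟨r • v, ?_⟩
          rw [map_smul, expand_apply s N hv, TensorProduct.smul_tmul']
        · rw [tmul_eq_zero h hx hv]; exact zero_mem _

/-- The linear equivalence `N ≃ S ⊗ N` with `v ↦ s m ⊗ v` for `v` of weight `m`. -/
def expandEquiv (hs : IsWeightBasis S s) (N : WMod σ O t) : N ≃ₗ[R] S ⊗[R] N :=
  LinearEquiv.ofBijective (expand s N)
    ⟨Function.LeftInverse.injective (hs.contract_expand N), hs.expand_surjective N⟩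

theorem expandEquiv_apply (hs : IsWeightBasis S s) (N : WMod σ O t) {m : MaximalSpectrum R} {v : N}
    (hv : v ∈ weightSpace N m) : hs.expandEquiv N v = s m ⊗ₜ[R] v :=
  expand_apply s N hv

end IsWeightBasis

end Basis

/-! ### Tensor products of cyclic weight modules. -/

section TensorCyclic

/-- The pure tensors of `M ⊗ N`. -/
def WMod.tmul (M : WMod σ O t) (N : WMod σ O t') (h : DiagDescends σ t t' M N) (v : M) (w : N) :
    M.tensor N h := v ⊗ₜ[R] w

theorem WMod.X_smul_tmul (M : WMod σ O t) (N : WMod σ O t') (h : DiagDescends σ t t' M N)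
    (i : Fin n) (ε : ℤˣ) (v : M) (w : N) : TGWA.X σ (t * t') i ε • M.tmul N h v w =
      M.tmul N h (TGWA.X σ t i ε • v) (TGWA.X σ t' i ε • w) := diagAction_X _ _ i ε v w

theorem WMod.smul_tmul_smul (M : WMod σ O t) (N : WMod σ O t') (h : DiagDescends σ t t' M N)
    (r r' : R) (v : M) (w : N) : M.tmul N h (r • v) (r' • w) = (r * r') • M.tmul N h v w :=
  TensorProduct.smul_tmul_smul r r' v w

theorem WMod.aword_smul_tmul (M : WMod σ O t) (N : WMod σ O t') (h : DiagDescends σ t t' M N)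
    (l : List (Fin n × ℤˣ)) (v : M) (w : N) : aword σ (t * t') l • M.tmul N h v w =
      M.tmul N h (aword σ t l • v) (aword σ t' l • w) := by
  induction l with
  | nil => rw [aword_nil, aword_nil, aword_nil, one_smul, one_smul, one_smul]
  | cons p l ih =>
    rw [aword_cons, aword_cons, aword_cons, mul_smul, mul_smul, mul_smul, ih, WMod.X_smul_tmul]

theorem WMod.tensor_induction (M : WMod σ O t) (N : WMod σ O t') (h : DiagDescends σ t t' M N)
    {Q : M.tensor N h → Prop} (h0 : Q 0) (hadd : ∀ x y, Q x → Q y → Q (x + y))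
    (htmul : ∀ m : MaximalSpectrum R, ∀ v ∈ weightSpace M m, ∀ w ∈ weightSpace N m, Q (M.tmul N h v w))
    (x : M.tensor N h) : Q x := by
  refine TensorProduct.induction_on (R := R) (M := M) (N := N) (motive := Q) x h0 ?_ hadd
  intro v w
  change Q (M.tmul N h v w)
  induction v using weight_induction M.iSup_weightSpace with
  | h0 =>
    have : M.tmul N h 0 w = 0 := TensorProduct.zero_tmul _ _
    rwa [this]
  | hadd v v' hv hv' =>
    have : M.tmul N h (v + v') w = M.tmul N h v w + M.tmul N h v' w := TensorProduct.add_tmul _ _ _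
    rw [this]
    exact hadd _ _ hv hv'
  | hw m v hv =>
    induction w using weight_induction N.iSup_weightSpace with
    | h0 =>
      have : M.tmul N h v 0 = 0 := TensorProduct.tmul_zero _ _
      rwa [this]
    | hadd w w' hw hw' =>
      have : M.tmul N h v (w + w') = M.tmul N h v w + M.tmul N h v w' := TensorProduct.tmul_add _ _ _
      rw [this]
      exact hadd _ _ hw hw'
    | hw m' w hw =>
      by_cases e : m = m'
      · subst e
        exact htmul m v hv w hw
      · have : M.tmul N h v w = 0 := tmul_eq_zero e hv hw
        rwa [this]

/-- Words act diagonally, so the standard word of degree `g` carries the tensor of the two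
generators to the tensor of the vectors spanning the weight lines at `σ^g(m₀)`. -/
theorem IsCyclicAt.tensor (hσ : ∀ i j, Commute (σ i) (σ j)) (hO : IsTorsionFreeOrbit σ O)
    (ht : t ∈ awayFrom σ O) (ht' : t' ∈ awayFrom σ O) {m₀ : MaximalSpectrum R} (hm₀ : m₀ ∈ O)
    {S : WMod σ O t} {S' : WMod σ O t'} (h : DiagDescends σ t t' S S') (hS : IsCyclicAt S m₀)
    (hS' : IsCyclicAt S' m₀) : IsCyclicAt (S.tensor S' h) m₀ := by
  obtain ⟨s, hs⟩ := hS.exists_isWeightBasis hσ hO ht hm₀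
  obtain ⟨v, hv, hv0, hvs⟩ := hS
  obtain ⟨w, hw, hw0, hws⟩ := hS'
  refine ⟨S.tmul S' h v w, weightTensor_le m₀ (tmul_mem_weightTensor hv hw), ?_, ?_⟩
  -- With `v = r • s m₀`, the tensor `v ⊗ w` is the image of `r • w ≠ 0` under the injective map
  -- `expandEquiv`.
  · obtain ⟨r, rfl⟩ := hs.exists_smul_eq hv
    have hr : r ∉ m₀.asIdeal := fun hr => hv0 (mem_weightSpace.1 (hs.mem m₀) r hr)
    intro e
    have e' : (r • s m₀) ⊗ₜ[R] w = 0 := e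
    rw [TensorProduct.smul_tmul, ← hs.expandEquiv_apply S' (Submodule.smul_mem _ r hw),
      LinearEquiv.map_eq_zero_iff] at e'
    exact smul_ne_zero_of_notMem hw hw0 hr e'
  · rw [eq_top_iff]
    rintro x -
    induction x using WMod.tensor_induction with
    | h0 => exact zero_mem _
    | hadd x y hx hy => exact add_mem hx hy
    | htmul m x hx y hy =>
      by_cases hm : m ∈ O
      · obtain ⟨g, rfl⟩ := hO.1.exists_translate hσ hm₀ hm
        rw [weightSpace_eq_wordSpan hσ hO.1 ht hm₀ hv hvs, wordSpan_translate hσ hO hm₀] at hx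
        rw [weightSpace_eq_wordSpan hσ hO.1 ht' hm₀ hw hws, wordSpan_translate hσ hO hm₀] at hy
        obtain ⟨r, rfl⟩ := Submodule.mem_span_singleton.1 hx
        obtain ⟨r', rfl⟩ := Submodule.mem_span_singleton.1 hy
        rw [WMod.smul_tmul_smul, ← WMod.aword_smul_tmul,
          ← IsInduced.ofR_smul (σ := σ) (t := t * t')]
        exact Submodule.smul_mem _ _ (Submodule.smul_mem _ _ (Submodule.mem_span_singleton_self _))
      · have hx0 : x = 0 := by
          by_contra h0
          exact hm (S.support m fun e => h0 (by rw [e] at hx; exact hx))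
        have : S.tmul S' h x y = 0 := by rw [hx0]; exact TensorProduct.zero_tmul _ _
        rw [this]
        exact zero_mem _

end TensorCyclic

/-! ### Criteria for linearity, and replacing the action on a fixed `R`-module. -/

section LinearMaps

variable {M N : Type u} [AddCommGroup M] [Module R M] [Module (TGWA σ t) M] [IsInduced σ t M]
  [AddCommGroup N] [Module R N] [Module (TGWA σ t) N] [IsInduced σ t N]

/-- An `R`-linear map that commutes with the generators `X_i^ε` is linear over `A(t)`. -/
def linearMapOfX (f : M →ₗ[R] N) (hf : ∀ i ε v, f (TGWA.X σ t i ε • v) = TGWA.X σ t i ε • f v) :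
    M →ₗ[TGWA σ t] N where
  toFun := f
  map_add' := f.map_add
  map_smul' a v := by
    obtain ⟨a, rfl⟩ := TGWA.proj_surjective σ t a
    rw [RingHom.id_apply]
    induction a using TGWC.induction generalizing v with
    | hR r =>
      change f (TGWA.ofR σ t r • v) = TGWA.ofR σ t r • f v
      rw [IsInduced.ofR_smul, IsInduced.ofR_smul, map_smul]
    | hX i ε => exact hf i ε v
    | hadd a b ha hb => rw [map_add, add_smul, add_smul, map_add, ha, hb]
    | hmul a b ha hb => rw [map_mul, mul_smul, mul_smul, ha, hb]

theorem apply_mem_weightSpace (f : M →ₗ[R] N) {m : MaximalSpectrum R} {v : M}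
    (hv : v ∈ weightSpace M m) : f v ∈ weightSpace N m := by
  rw [mem_weightSpace]
  intro r hr
  rw [← map_smul, mem_weightSpace.1 hv r hr, map_zero]

theorem apply_act (hM : ⨆ m : MaximalSpectrum R, weightSpace M m = ⊤)
    (hN : ⨆ m : MaximalSpectrum R, weightSpace N m = ⊤) (p : MaximalSpectrum R → R)
    (f : M →ₗ[R] N) (v : M) : f (act hM p v) = act hN p (f v) := by
  induction v using weight_induction hM with
  | h0 => simp only [map_zero]
  | hadd v w hv hw => simp only [map_add, hv, hw]
  | hw m v hv => rw [act_apply hM p hv, map_smul, act_apply hN p (apply_mem_weightSpace f hv)]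

end LinearMaps

section ChangeAction

/-- The `R`-module of a weight module with another action of a twisted generalized Weyl algebra. -/
def WMod.changeAction (N : WMod σ O t) (ρ : TGWC σ t' →+* AddMonoid.End N)
    (hR : ∀ r v, ρ (TGWC.ofR σ t' r) v = r • v) (hρ : ∀ a ∈ torsionIdeal σ t', ρ a = 0) :
    WMod σ O t' :=
  letI : Module (TGWA σ t') N := Module.compHom _ <|
    RingCon.lift (torsionIdeal σ t').ringCon ρ <| by
      intro x y hxy
      have := hρ _ ((TwoSidedIdeal.rel_iff _ x y).1 hxy)
      rw [map_sub, sub_eq_zero] at this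
      exact this
  { carrier := N
    induced := ⟨fun r v => hR r v⟩
    isInternal := N.isInternal
    finite := N.finite
    support := N.support }

/-- The identity map to a module with another action. -/
def WMod.changeEquiv (N : WMod σ O t) (ρ : TGWC σ t' →+* AddMonoid.End N)
    (hR : ∀ r v, ρ (TGWC.ofR σ t' r) v = r • v) (hρ : ∀ a ∈ torsionIdeal σ t', ρ a = 0) :
    N ≃ₗ[R] N.changeAction ρ hR hρ :=
  LinearEquiv.refl R N

end ChangeAction

/-! ### Operators rescaled by the structure constants of the simple module. -/

section Scaled

/-- The operator `v ↦ d X_i^ε v`, where `d` is a family of scalars depending on the weight. -/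
def scaledX (d : Fin n → ℤˣ → MaximalSpectrum R → R) (N : WMod σ O t) (i : Fin n) (ε : ℤˣ) :
    AddMonoid.End N :=
  (act N.iSup_weightSpace (d i ε)).toAddMonoidHom.comp
    (DistribSMul.toAddMonoidHom N (TGWA.X σ t i ε))

theorem scaledX_apply (d : Fin n → ℤˣ → MaximalSpectrum R → R) (N : WMod σ O t) (i : Fin n)
    (ε : ℤˣ) (v : N) : scaledX d N i ε v = act N.iSup_weightSpace (d i ε) (TGWA.X σ t i ε • v) := rfl

theorem scaledX_apply_of_mem (d : Fin n → ℤˣ → MaximalSpectrum R → R) (N : WMod σ O t) (i : Fin n)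
    (ε : ℤˣ) {m : MaximalSpectrum R} {v : N} (hv : v ∈ weightSpace N m) : scaledX d N i ε v =
      d i ε (translate (sigmaPow σ (letterDeg (i, ε))) m) • TGWA.X σ t i ε • v :=
  act_apply _ _ (X_smul_mem i ε hv)

theorem scaledX_smul (d : Fin n → ℤˣ → MaximalSpectrum R → R) (N : WMod σ O t) (i : Fin n) (ε : ℤˣ)
    (r : R) (v : N) :
    scaledX d N i ε (r • v) = sigmaPow σ (letterDeg (i, ε)) r • scaledX d N i ε v := by
  rw [scaledX_apply, X_smul_smul', map_smul, scaledX_apply]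

/-- The product of the operators `scaledX` over a word. -/
def scaledWord (d : Fin n → ℤˣ → MaximalSpectrum R → R) (N : WMod σ O t)
    (w : List (Fin n × ℤˣ)) : AddMonoid.End N := (w.map fun p => scaledX d N p.1 p.2).prod

theorem scaledWord_nil (d : Fin n → ℤˣ → MaximalSpectrum R → R) (N : WMod σ O t) (v : N) :
    scaledWord d N [] v = v := rfl

theorem scaledWord_cons (d : Fin n → ℤˣ → MaximalSpectrum R → R) (N : WMod σ O t)
    (p : Fin n × ℤˣ) (w : List (Fin n × ℤˣ)) (v : N) :
    scaledWord d N (p :: w) v = scaledX d N p.1 p.2 (scaledWord d N w v) := by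
  rw [scaledWord, List.map_cons, List.prod_cons]; rfl

/-- The scalar by which `scaledWord` and the word itself differ on the weight space of `m`. -/
def scalar (σ : Fin n → RingAut R) (d : Fin n → ℤˣ → MaximalSpectrum R → R) :
    List (Fin n × ℤˣ) → MaximalSpectrum R → R
  | [], _ => 1
  | p :: w, m => d p.1 p.2 (translate (sigmaPow σ (letterDeg p))
      (translate (sigmaPow σ (wordDeg w)) m)) * sigmaPow σ (letterDeg p) (scalar σ d w m)

/-- The factor depends on the weight but not on `N`, so it can be evaluated on the simple module
instead. -/
theorem scaledWord_apply (hσ : ∀ i j, Commute (σ i) (σ j))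
    (d : Fin n → ℤˣ → MaximalSpectrum R → R) (N : WMod σ O t) (w : List (Fin n × ℤˣ))
    {m : MaximalSpectrum R} {v : N} (hv : v ∈ weightSpace N m) :
    scaledWord d N w v = scalar σ d w m • aword σ t w • v := by
  induction w with
  | nil => rw [scaledWord_nil, scalar, aword_nil, one_smul, one_smul]
  | cons p w ih =>
    rw [scaledWord_cons, ih, scaledX_smul, scaledX_apply_of_mem d N _ _ (aword_smul_mem hσ w hv),
      aword_cons, mul_smul, scalar, mul_comm, mul_smul]

/-- `d` is inverse to the structure constants of the basis `s`. -/
def IsScaling (S : WMod σ O u) (s : MaximalSpectrum R → S)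
    (d : Fin n → ℤˣ → MaximalSpectrum R → R) : Prop :=
  ∀ i ε m, d i ε (translate (sigmaPow σ (letterDeg (i, ε))) m) • TGWA.X σ u i ε • s m =
    s (translate (sigmaPow σ (letterDeg (i, ε))) m)

/-- Rescaled letters send basis vectors to basis vectors. The scalar of a word thus inverts its
matrix coefficient on `S`, and rescaled words of equal degree agree on the basis. -/
theorem IsScaling.scalar_smul (hσ : ∀ i j, Commute (σ i) (σ j)) {S : WMod σ O u}
    {s : MaximalSpectrum R → S} {d : Fin n → ℤˣ → MaximalSpectrum R → R} (hd : IsScaling S s d)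
    (w : List (Fin n × ℤˣ)) (m : MaximalSpectrum R) :
    scalar σ d w m • aword σ u w • s m = s (translate (sigmaPow σ (wordDeg w)) m) := by
  induction w with
  | nil => rw [scalar, aword_nil, one_smul, one_smul, wordDeg_nil, translate_zero]
  | cons p w ih =>
    rw [scalar, aword_cons, mul_smul, mul_smul, ← X_smul_smul', ih, hd, wordDeg_cons,
      translate_add hσ]

theorem IsWeightBasis.eq_zero {S : WMod σ O u}
    {s : MaximalSpectrum R → S} (hs : IsWeightBasis S s) {m : MaximalSpectrum R} (hm : m ∉ O) :
    s m = 0 := by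
  by_contra h0
  have := hs.mem m
  exact hm (S.support m fun e => h0 (by rw [e] at this; exact this))

/-- On the orbit `X_i^ε s m = c • s m'` with `c ∉ m'`, because letters are injective; take for `d`
an inverse of `c` modulo `m'`. Off the orbit the basis vectors vanish. -/
theorem IsWeightBasis.exists_isScaling (hσ : ∀ i j, Commute (σ i) (σ j)) (hO : IsOrbit σ O)
    (hu : u ∈ awayFrom σ O) {S : WMod σ O u} {s : MaximalSpectrum R → S} (hs : IsWeightBasis S s) :
    ∃ d, IsScaling S s d := by
  -- The constant is indexed by the target weight `m'`, which determines the source.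
  have key : ∀ (i : Fin n) (ε : ℤˣ) (m' : MaximalSpectrum R), ∃ d : R, ∀ m,
      translate (sigmaPow σ (letterDeg (i, ε))) m = m' → d • TGWA.X σ u i ε • s m = s m' := by
    intro i ε m'
    by_cases hm' : m' ∈ O
    · set m := translate (sigmaPow σ (-letterDeg (i, ε))) m' with hm
      have hmm' : translate (sigmaPow σ (letterDeg (i, ε))) m = m' := by
        rw [hm, ← translate_add hσ, add_neg_cancel, translate_zero]
      have hmO : m ∈ O := hO.translate_mem hσ hm' _
      have h1 := X_smul_mem (σ := σ) (t := u) i ε (hs.mem m)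
      rw [hmm'] at h1
      have h2 := aword_smul_ne_zero hσ hO hu [(i, ε)] hmO (hs.mem m) (hs.ne_zero m hmO)
      rw [aword_cons, aword_nil, mul_one] at h2
      obtain ⟨c, hc⟩ := hs.exists_smul_eq h1
      have hcm : c ∉ m'.asIdeal := fun h => h2 (by
        rw [← hc]; exact mem_weightSpace.1 (hs.mem m') c h)
      obtain ⟨d, hd⟩ := exists_smul_inverse hcm
      refine ⟨d, fun m₁ h => ?_⟩
      rw [translate_injective _ (h.trans hmm'.symm), ← hc, hd _ (hs.mem m')]
    · refine ⟨0, fun m h => ?_⟩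
      rw [zero_smul, hs.eq_zero hm']
  choose d hd using key
  exact ⟨d, fun i ε m => hd i ε _ m rfl⟩

end Scaled

/-- A simple weight module for a parameter `u` that is invertible on the orbit, with a weight basis
and its structure constants. -/
structure UnitData (σ : Fin n → RingAut R) (O : Set (MaximalSpectrum R)) (u : Fin n → R) where
  commute : ∀ i j, Commute (σ i) (σ j)
  isOrbit : IsTorsionFreeOrbit σ O
  mem_omega : u ∈ Omega σ
  mem_awayFrom : u ∈ awayFrom σ O
  obj : WMod σ O u
  isSimple : IsSimpleModule (TGWA σ u) obj
  basis : MaximalSpectrum R → obj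
  isWeightBasis : IsWeightBasis obj basis
  scaling : Fin n → ℤˣ → MaximalSpectrum R → R
  isScaling : IsScaling obj basis scaling

theorem nonempty_unitData (hσ : ∀ i j, Commute (σ i) (σ j)) (hO : IsTorsionFreeOrbit σ O)
    (hΩ : u ∈ Omega σ) (hu : u ∈ awayFrom σ O) : Nonempty (UnitData σ O u) := by
  obtain ⟨S, hS⟩ := exists_simple hσ hO hu hΩ.2
  obtain ⟨m₀, hm₀⟩ := hO.1.nonempty
  obtain ⟨s, hs⟩ :=
    (isCyclicAt_of_isSimpleModule hσ hO.1 hu hm₀ S hS).exists_isWeightBasis hσ hO hu hm₀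
  obtain ⟨d, hd⟩ := hs.exists_isScaling hσ hO.1 hu
  exact ⟨⟨hσ, hO, hΩ, hu, S, hS, s, hs, d, hd⟩⟩

/-! ### Untwisting: dividing an action by that of the simple module. -/

namespace UnitData

variable (U : UnitData σ O u)

/-- The action of the twisted generalized Weyl construction with parameter `t'` on the modules over
`A(u t')` that is obtained by dividing out the action on the simple module. -/
def untwistAction (h : u * t' = t) (N : WMod σ O t) : TGWC σ t' →+* AddMonoid.End N :=
  TGWC.lift σ t' (FreeAlgebra.lift ℤ (Sum.elim (fun r => Module.toAddMonoidEnd R N r)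
      fun p => scaledX U.scaling N p.1 p.2)).toRingHom <| by
    intro x y hxy
    induction hxy with
    | one => simp [letR]
    | add r s => simp [letR]
    | mul r s => simp [letR]
    | twist i ε r =>
      simp only [letX, letR, AlgHom.toRingHom_eq_coe, map_mul, RingHom.coe_coe,
        FreeAlgebra.lift_ι_apply, Sum.elim_inl, Sum.elim_inr]
      ext v
      change scaledX U.scaling N i ε (r • v) =
        ((σ i) ^ (2 * (ε : ℤ))) r • scaledX U.scaling N i ε v
      rw [scaledX_smul, sigmaPow_letterDeg]
    | same i ε =>
      simp only [letX, letR, AlgHom.toRingHom_eq_coe, map_mul, RingHom.coe_coe,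
        FreeAlgebra.lift_ι_apply, Sum.elim_inl, Sum.elim_inr]
      ext v
      change scaledX U.scaling N i ε (scaledX U.scaling N i (-ε) v) = ((σ i) ^ (ε : ℤ)) (t' i) • v
      induction v using weight_induction N.iSup_weightSpace with
      | h0 => simp only [map_zero, smul_zero]
      | hadd v w hv hw => simp only [map_add, smul_add, hv, hw]
      | hw m v hv =>
        -- On `N_m` the two rescaled letters act by a scalar times `σ_i^{ε/2}(u_i) σ_i^{ε/2}(t'_i)`.
        -- On `S` the scalar times `σ_i^{ε/2}(u_i)` fixes `s m`, and `smul_eq_smul` transfers this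
        -- to `N`.
        have h1 := scaledWord_apply U.commute U.scaling N [(i, ε), (i, -ε)] hv
        have h2 := U.isScaling.scalar_smul U.commute [(i, ε), (i, -ε)] m
        simp only [scaledWord_cons, scaledWord_nil, aword_cons, aword_nil, mul_one, wordDeg_cons,
          wordDeg_nil, add_zero, letterDeg_neg, add_neg_cancel, translate_zero, TGWA.X_mul_X_neg,
          IsInduced.ofR_smul] at h1 h2
        have hti : t i = u i * t' i := by rw [← h, Pi.mul_apply]
        rw [h1, hti, map_mul, mul_smul, ← mul_smul]
        rw [← mul_smul] at h2
        refine (U.isWeightBasis.smul_eq_smul N (h2.trans (one_smul R _).symm)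
          (Submodule.smul_mem _ _ hv)).trans (one_smul R _)
    | comm i j ε hij =>
      simp only [letX, AlgHom.toRingHom_eq_coe, map_mul, RingHom.coe_coe,
        FreeAlgebra.lift_ι_apply, Sum.elim_inr]
      ext v
      change scaledX U.scaling N i ε (scaledX U.scaling N j (-ε) v) =
        scaledX U.scaling N j (-ε) (scaledX U.scaling N i ε v)
      induction v using weight_induction N.iSup_weightSpace with
      | h0 => simp only [map_zero]
      | hadd v w hv hw => simp only [map_add, hv, hw]
      | hw m v hv =>
        by_cases hm : m ∈ O
        -- Unscaled, the two orders agree. Rescaled, both send `s m` to the same basis vector, so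
        -- their scalars agree modulo the target ideal.
        · have h1 := scaledWord_apply U.commute U.scaling N [(i, ε), (j, -ε)] hv
          have h1' := scaledWord_apply U.commute U.scaling N [(j, -ε), (i, ε)] hv
          have h2 := U.isScaling.scalar_smul U.commute [(i, ε), (j, -ε)] m
          have h2' := U.isScaling.scalar_smul U.commute [(j, -ε), (i, ε)] m
          have hmem := aword_smul_mem (t := t) U.commute [(i, ε), (j, -ε)] hv
          have hmem' := aword_smul_mem (t := u) U.commute [(i, ε), (j, -ε)] (U.isWeightBasis.mem m)
          have hne := aword_smul_ne_zero U.commute U.isOrbit.1 U.mem_awayFrom [(i, ε), (j, -ε)] hm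
            (U.isWeightBasis.mem m) (U.isWeightBasis.ne_zero m hm)
          simp only [scaledWord_cons, scaledWord_nil, aword_cons, aword_nil, mul_one, wordDeg_cons,
            wordDeg_nil, add_zero, ← TGWA.X_mul_X_of_ne σ _ i j ε hij] at h1 h2 h1' h2' hmem hmem' hne
          rw [h1, h1']
          rw [add_comm, ← h2] at h2'
          exact smul_eq_smul_of_sub_mem hmem (sub_mem_of_smul_eq hmem' hne h2'.symm)
        · have hv0 : v = 0 := by
            by_contra h0
            exact hm (N.support m fun e => h0 (by rw [e] at hv; exact hv))
          simp only [hv0, map_zero]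

theorem untwistAction_ofR (h : u * t' = t) (N : WMod σ O t) (r : R) (v : N) :
    U.untwistAction h N (TGWC.ofR σ t' r) v = r • v := by
  change (U.untwistAction h N (TGWC.mk _ _ (letR n r)) : N → N) v = _
  rw [untwistAction, TGWC.lift_mk]
  simp only [letR, AlgHom.toRingHom_eq_coe, RingHom.coe_coe, FreeAlgebra.lift_ι_apply,
    Sum.elim_inl]
  rfl

theorem untwistAction_X (h : u * t' = t) (N : WMod σ O t) (i : Fin n) (ε : ℤˣ) :
    U.untwistAction h N (TGWC.X σ t' i ε) = scaledX U.scaling N i ε := by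
  change U.untwistAction h N (TGWC.mk _ _ (letX R i ε)) = _
  rw [untwistAction, TGWC.lift_mk]
  simp only [letX, AlgHom.toRingHom_eq_coe, RingHom.coe_coe, FreeAlgebra.lift_ι_apply,
    Sum.elim_inr]

theorem untwistAction_word (h : u * t' = t) (N : WMod σ O t) (w : List (Fin n × ℤˣ)) :
    U.untwistAction h N (word σ t' w) = scaledWord U.scaling N w := by
  induction w with
  | nil => rw [word_nil, map_one]; rfl
  | cons p w ih =>
    rw [word_cons, map_mul, ih, untwistAction_X, scaledWord, scaledWord, List.map_cons,
      List.prod_cons]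

end UnitData

/-! ### The untwisted action factors through the twisted generalized Weyl algebra. -/

section Torsion

theorem comp_mul_ofR_comm (hσ : ∀ i j, Commute (σ i) (σ j)) (g : Fin n → ℤ) (a : TGWC σ t) (r : R) :
    comp σ t g a * TGWC.ofR σ t r = TGWC.ofR σ t (sigmaPow σ g r) * comp σ t g a := by
  refine comp_induction (P := fun x => x * TGWC.ofR σ t r = TGWC.ofR σ t (sigmaPow σ g r) * x)
    g ?_ ?_ ?_ a
  · rw [zero_mul, mul_zero]
  · intro a b ha hb
    rw [add_mul, mul_add, ha, hb]
  · rintro s w rfl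
    rw [mul_assoc, word_mul_ofR hσ, ← mul_assoc, ← mul_assoc, ← map_mul, ← map_mul, mul_comm s]

attribute [local instance] instModuleTGWA instIsInducedTGWA

/-- The product of the two degree-zero components is an `R`-linear map from the tensor product to
`R` that sends `1 ⊗ 1` to `1`. -/
theorem eq_zero_of_smul_one_tmul_one (hσ : ∀ i j, Commute (σ i) (σ j)) (hu : IsConsistent σ u)
    (ht : IsConsistent σ t) {r : R} (h : r • ((1 : TGWA σ u) ⊗ₜ[R] (1 : TGWA σ t)) = 0) : r = 0 := by
  let f : TGWA σ u →ₗ[R] R :=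
    { toFun := degZero hσ hu
      map_add' := degZero_add hσ hu
      map_smul' := degZero_ofR_mul hσ hu }
  let g : TGWA σ t →ₗ[R] R :=
    { toFun := degZero hσ ht
      map_add' := degZero_add hσ ht
      map_smul' := degZero_ofR_mul hσ ht }
  have h1 := congrArg (TensorProduct.lift ((LinearMap.mul R R).compl₁₂ f g)) h
  rw [map_smul, TensorProduct.lift.tmul, map_zero] at h1
  change r • (degZero hσ hu 1 * degZero hσ ht 1) = 0 at h1
  rwa [degZero_one, degZero_one, mul_one, smul_eq_mul, mul_one] at h1

/-- Multiplying on the right by a word of degree `-g` gives a scalar. It kills `1 ⊗ 1`, so it is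
`0`. Multiplying by the reversed word as well shows that the element times a nonzero scalar is `0`;
the scalar moves to the left by the twist relation. -/
theorem mem_torsionIdeal_of_diagAction_eq_zero (hσ : ∀ i j, Commute (σ i) (σ j)) (hu : u ∈ Omega σ)
    (ht : t ∈ Omega σ) (g : Fin n → ℤ) (b : TGWC σ (u * t))
    (h : diagAction σ u t (TGWA σ u) (TGWA σ t) (comp σ _ g b) = 0) :
    comp σ _ g b ∈ torsionIdeal σ (u * t) := by
  obtain ⟨r, hr, h1⟩ := exists_wordStar_mul_word_ne_zero (t := u * t) hσ
    (fun i => mul_ne_zero (hu.1 i) (ht.1 i)) (stdWord g)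
  have hdeg : g + wordDeg (wordStar (stdWord g)) = 0 := by
    rw [wordDeg_wordStar, wordDeg_stdWord, add_neg_cancel]
  have h2 : comp σ _ g b * word σ (u * t) (wordStar (stdWord g)) = 0 := by
    obtain ⟨s, hs⟩ := exists_comp_zero_eq σ (u * t) hσ (b * word σ (u * t) (wordStar (stdWord g)))
    rw [← hdeg, comp_mul_word] at hs
    have h3 : s • ((1 : TGWA σ u) ⊗ₜ[R] (1 : TGWA σ t)) = 0 := by
      rw [← diagAction_ofR (σ := σ) (t := u) (t' := t), ← hs, map_mul, h, zero_mul]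
      rfl
    rw [hs, eq_zero_of_smul_one_tmul_one hσ hu.2 ht.2 h3, map_zero]
  refine mem_torsionIdeal.2 ⟨sigmaPow σ g r, by simpa using hr, ?_⟩
  rw [← comp_mul_ofR_comm hσ, ← h1, ← mul_assoc, h2, zero_mul]

theorem diagAction_word (w : List (Fin n × ℤˣ)) {M N : Type u} [AddCommGroup M] [Module R M]
    [Module (TGWA σ t) M] [IsInduced σ t M] [AddCommGroup N] [Module R N] [Module (TGWA σ t') N]
    [IsInduced σ t' N] (x : M) (y : N) : diagAction σ t t' M N (word σ (t * t') w) (x ⊗ₜ[R] y) =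
      (aword σ t w • x) ⊗ₜ[R] (aword σ t' w • y) := by
  induction w with
  | nil => rw [word_nil, map_one, aword_nil, aword_nil, one_smul, one_smul]; rfl
  | cons p w ih =>
    rw [word_cons, map_mul, aword_cons, aword_cons, mul_smul, mul_smul, ← diagAction_X, ← ih]
    rfl

namespace UnitData

variable (U : UnitData σ O u)

theorem untwistAction_comp_mem (h : u * t' = t) (N : WMod σ O t) (g : Fin n → ℤ) (a : TGWC σ t')
    {m : MaximalSpectrum R} {v : N} (hv : v ∈ weightSpace N m) :
    U.untwistAction h N (comp σ t' g a) v ∈ weightSpace N (translate (sigmaPow σ g) m) := by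
  refine comp_induction (P := fun x => U.untwistAction h N x v ∈
    weightSpace N (translate (sigmaPow σ g) m)) g ?_ ?_ ?_ a
  · rw [map_zero]; exact zero_mem _
  · intro a b ha hb
    rw [map_add]; exact add_mem ha hb
  · rintro r w rfl
    rw [map_mul]
    change U.untwistAction h N _ (U.untwistAction h N _ v) ∈ _
    rw [untwistAction_ofR, untwistAction_word, scaledWord_apply U.commute _ _ _ hv]
    exact Submodule.smul_mem _ _ (Submodule.smul_mem _ _ (aword_smul_mem U.commute w hv))

/-- Let `W` be the standard word of degree `g`, and `w` any word of degree `g`. In the construction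
for `u`, `α w = β W` with `α` outside all ideals of `O`. For `a = r w` take `b = κ r α w`. On `A(u)
⊗ A(t')` the factor `α w` on the left becomes `β W`, so `b` acts as `κ β (W ⊗ r w)`. On `N_m` it
acts as `β` times the untwisted `r w`, since `κ α` and `β` times the scalar of `w` agree modulo
`σ^g(m)`. So `c = β`. -/
theorem exists_twist (N : WMod σ O (u * t')) (g : Fin n → ℤ) {m : MaximalSpectrum R} (hm : m ∈ O)
    (a : TGWC σ t') : ∃ (b : TGWC σ (u * t')) (c : R),
      c ∉ (translate (sigmaPow σ g) m).asIdeal ∧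
      (∀ v ∈ weightSpace N m, TGWA.proj σ _ (comp σ _ g b) • v =
        c • U.untwistAction rfl N (comp σ t' g a) v) ∧
      ∀ (x : TGWA σ u) (y : TGWA σ t'), diagAction σ u t' (TGWA σ u) (TGWA σ t') (comp σ _ g b)
        (x ⊗ₜ[R] y) = (scalar σ U.scaling (stdWord g) m * c) •
          ((aword σ u (stdWord g) * x) ⊗ₜ[R] (TGWA.proj σ t' (comp σ t' g a) * y)) := by
  set κ := scalar σ U.scaling (stdWord g) m with hκ
  refine comp_induction (P := fun a' => ∃ (b : TGWC σ (u * t')) (c : R),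
      c ∉ (translate (sigmaPow σ g) m).asIdeal ∧
      (∀ v ∈ weightSpace N m, TGWA.proj σ _ (comp σ _ g b) • v =
        c • U.untwistAction rfl N a' v) ∧
      ∀ (x : TGWA σ u) (y : TGWA σ t'), diagAction σ u t' (TGWA σ u) (TGWA σ t') (comp σ _ g b)
        (x ⊗ₜ[R] y) = (κ * c) • ((aword σ u (stdWord g) * x) ⊗ₜ[R] (TGWA.proj σ t' a' * y)))
    g ?_ ?_ ?_ a
  · refine ⟨0, 1, (away O).one_mem _ (U.isOrbit.1.translate_mem U.commute hm g), ?_, ?_⟩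
    · intro v _
      rw [map_zero, map_zero, zero_smul, map_zero]
      exact (smul_zero _).symm
    · intro x y
      rw [map_zero, map_zero, map_zero, zero_mul, TensorProduct.tmul_zero, smul_zero]
      rfl
  · rintro a₁ a₂ ⟨b₁, c₁, hc₁, h₁, h₁'⟩ ⟨b₂, c₂, hc₂, h₂, h₂'⟩
    -- The pairs `b, c` add like fractions, with common denominator `c₁ c₂`.
    refine ⟨TGWC.ofR σ _ c₂ * b₁ + TGWC.ofR σ _ c₁ * b₂, c₁ * c₂, ?_, ?_, ?_⟩
    · intro h
      exact ((translate (sigmaPow σ g) m).isMaximal.isPrime.mem_or_mem h).elim hc₁ hc₂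
    · intro v hv
      rw [map_add, comp_ofR_mul, comp_ofR_mul, map_add, map_mul, map_mul, add_smul, mul_smul,
        mul_smul, h₁ v hv, h₂ v hv, map_add]
      change TGWA.ofR σ _ c₂ • _ + TGWA.ofR σ _ c₁ • _ =
        _ • (U.untwistAction rfl N a₁ v + U.untwistAction rfl N a₂ v)
      rw [IsInduced.ofR_smul, IsInduced.ofR_smul, smul_add, ← mul_smul, ← mul_smul, mul_comm c₂]
    · intro x y
      rw [map_add, comp_ofR_mul, comp_ofR_mul, map_add, map_mul, map_mul]
      change diagAction σ u t' _ _ (TGWC.ofR σ _ c₂) (diagAction σ u t' _ _ (comp σ _ g b₁) _) +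
        diagAction σ u t' _ _ (TGWC.ofR σ _ c₁) (diagAction σ u t' _ _ (comp σ _ g b₂) _) = _
      rw [diagAction_ofR, diagAction_ofR, h₁', h₂', map_add, add_mul, TensorProduct.tmul_add,
        smul_add, ← mul_smul, ← mul_smul]
      congr 2 <;> ring
  · intro r w hw
    obtain ⟨α, hα, β, hαβ⟩ := exists_ofR_mul_word U.commute U.isOrbit.1 U.mem_awayFrom w (stdWord g)
      (hw.trans (wordDeg_stdWord g).symm)
    have hαβ' : TGWA.ofR σ u α * aword σ u w = TGWA.ofR σ u β * aword σ u (stdWord g) := by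
      simp only [aword, TGWA.ofR, RingHom.comp_apply, ← map_mul, hαβ]
    have hbm := U.isWeightBasis.mem m
    have hb0 := U.isWeightBasis.ne_zero m hm
    have hgm := U.isOrbit.1.translate_mem U.commute hm g
    have hwm := aword_smul_mem (t := u) U.commute w hbm
    rw [hw] at hwm
    have hw0 := aword_smul_ne_zero U.commute U.isOrbit.1 U.mem_awayFrom w hm hbm hb0
    have hS : α • aword σ u w • U.basis m = β • aword σ u (stdWord g) • U.basis m := by
      rw [← IsInduced.ofR_smul (σ := σ) (t := u), ← IsInduced.ofR_smul (σ := σ) (t := u),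
        ← mul_smul, ← mul_smul, hαβ']
    have hβ : β ∉ (translate (sigmaPow σ g) m).asIdeal := by
      intro h
      have h1 := aword_smul_mem (t := u) U.commute (stdWord g) hbm
      rw [wordDeg_stdWord] at h1
      rw [mem_weightSpace.1 h1 β h] at hS
      exact smul_ne_zero_of_notMem hwm hw0 (hα _ hgm) hS
    -- Compare on the basis: rescaled, both `w` and `W` send `s m` to the basis vector at `σ^g(m)`,
    -- while `α w` and `β W` agree on it.
    have hscal : κ * α - β * scalar σ U.scaling w m ∈ (translate (sigmaPow σ g) m).asIdeal := by
      refine sub_mem_of_smul_eq hwm hw0 ?_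
      have h1 := U.isScaling.scalar_smul U.commute w m
      have h2 := U.isScaling.scalar_smul U.commute (stdWord g) m
      rw [wordDeg_stdWord] at h2
      rw [hw] at h1
      rw [mul_smul, hS, mul_smul, h1, ← h2, smul_comm]
    have hb : comp σ (u * t') g (TGWC.ofR σ _ (κ * r * α) * word σ _ w) =
        TGWC.ofR σ _ (κ * r * α) * word σ _ w := by
      rw [comp_ofR_mul, ← hw, comp_word]
    refine ⟨TGWC.ofR σ _ (κ * r * α) * word σ _ w, β, hβ, ?_, ?_⟩
    · intro v hv
      have hwv := aword_smul_mem (t := u * t') U.commute w hv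
      rw [hw] at hwv
      rw [hb, map_mul (TGWA.proj σ _), map_mul (U.untwistAction rfl N), mul_smul]
      change TGWA.ofR σ _ _ • aword σ _ w • v =
        β • U.untwistAction rfl N _ (U.untwistAction rfl N _ v)
      rw [IsInduced.ofR_smul, untwistAction_ofR, untwistAction_word,
        scaledWord_apply U.commute _ _ _ hv, ← mul_smul, ← mul_smul]
      refine smul_eq_smul_of_sub_mem hwv ?_
      have h1 : κ * r * α - β * (r * scalar σ U.scaling w m) =
        r * (κ * α - β * scalar σ U.scaling w m) := by ring
      rw [← mul_assoc] at h1
      exact h1 ▸ Ideal.mul_mem_left _ r hscal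
    · intro x y
      have h1 : α • (aword σ u w * x) = β • (aword σ u (stdWord g) * x) := by
        change TGWA.ofR σ u α * _ = TGWA.ofR σ u β * _
        rw [← mul_assoc, hαβ', mul_assoc]
      have h2 : TGWA.proj σ t' (TGWC.ofR σ t' r * word σ t' w) * y = r • (aword σ t' w * y) := by
        rw [map_mul, mul_assoc]; rfl
      rw [hb, map_mul, h2]
      change diagAction σ u t' _ _ (TGWC.ofR σ _ (κ * r * α))
        (diagAction σ u t' _ _ (word σ (u * t') w) _) = _
      rw [diagAction_ofR, diagAction_word, smul_eq_mul, smul_eq_mul, TensorProduct.tmul_smul,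
        mul_smul, TensorProduct.smul_tmul', h1, ← TensorProduct.smul_tmul', ← mul_smul, ← mul_smul]
      congr 1
      ring

/-- The scalar witnessing torsion of `a` may lie in the ideals of `O`, so it cannot be cancelled on
`N`. The lift `b` of a component of `a` avoids this: it acts by zero on `A(u) ⊗ A(t')`, hence is
torsion and zero on `N`, and `c` can be cancelled. -/
theorem untwistAction_eq_zero (ht' : t' ∈ Omega σ) (h : u * t' = t) (N : WMod σ O t)
    (a : TGWC σ t') (ha : a ∈ torsionIdeal σ t') : U.untwistAction h N a = 0 := by
  subst h
  ext v
  change U.untwistAction rfl N a v = 0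
  induction v using weight_induction N.iSup_weightSpace with
  | h0 => rw [map_zero]
  | hadd v w hv hw => rw [map_add, hv, hw, add_zero]
  | hw m v hv =>
    by_cases hm : m ∈ O
    · let S : AddSubmonoid (TGWC σ t') :=
        { carrier := {x | U.untwistAction rfl N x v = 0}
          zero_mem' := by
            change U.untwistAction rfl N 0 v = 0
            rw [map_zero]; rfl
          add_mem' := by
            intro x y hx hy
            change U.untwistAction rfl N (x + y) v = 0
            rw [map_add]
            change U.untwistAction rfl N x v + U.untwistAction rfl N y v = 0
            rw [hx, hy, add_zero] }
      refine mem_of_comp_mem σ t' S a fun g => ?_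
      obtain ⟨b, c, hc, h1, h2⟩ := U.exists_twist N g hm a
      have h3 : TGWA.proj σ t' (comp σ t' g a) = 0 :=
        (TGWA.proj_eq_zero σ t').2 (comp_mem_torsionIdeal σ t' g ha)
      have h4 : diagAction σ u t' (TGWA σ u) (TGWA σ t') (comp σ _ g b) = 0 := by
        refine end_ext _ _ fun x y => ?_
        refine (h2 x y).trans ?_
        rw [h3, zero_mul, TensorProduct.tmul_zero, smul_zero]
        rfl
      have h5 := mem_torsionIdeal_of_diagAction_eq_zero U.commute U.mem_omega ht' g b h4
      have h6 := h1 v hv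
      rw [(TGWA.proj_eq_zero σ _).2 h5, zero_smul] at h6
      by_contra h0
      exact smul_ne_zero_of_notMem (U.untwistAction_comp_mem rfl N g a hv) h0 hc h6.symm
    · have hv0 : v = 0 := by
        by_contra h0
        exact hm (N.support m fun e => h0 (by rw [e] at hv; exact hv))
      rw [hv0, map_zero]

/-- The weight module over `A(t')` that is obtained from one over `A(u t')` by dividing out the
action on the simple module. -/
def untwist (ht' : t' ∈ Omega σ) (h : u * t' = t) (N : WMod σ O t) : WMod σ O t' :=
  N.changeAction (U.untwistAction h N) (U.untwistAction_ofR h N) (U.untwistAction_eq_zero ht' h N)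

/-- The identity map from a module to its untwisted version. -/
def untwistEquiv (ht' : t' ∈ Omega σ) (h : u * t' = t) (N : WMod σ O t) :
    N ≃ₗ[R] U.untwist ht' h N :=
  N.changeEquiv (U.untwistAction h N) (U.untwistAction_ofR h N) (U.untwistAction_eq_zero ht' h N)

theorem X_smul_untwistEquiv (ht' : t' ∈ Omega σ) (h : u * t' = t) (N : WMod σ O t) (i : Fin n)
    (ε : ℤˣ) (v : N) : TGWA.X σ t' i ε • U.untwistEquiv ht' h N v =
      U.untwistEquiv ht' h N (scaledX U.scaling N i ε v) := by
  rw [← U.untwistAction_X h N]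
  rfl

end UnitData

end Torsion

/-! ### Isomorphisms of weight modules; untwisting inverts tensoring with the simple module. -/

section Iso

/-- `M` and `N` are isomorphic; the parameters, which need not be the same term, are not compared. -/
def WIso (M : WMod σ O t) (N : WMod σ O t') : Prop :=
  ∃ e : M ≃ₗ[R] N, ∀ i ε v, e (TGWA.X σ t i ε • v) = TGWA.X σ t' i ε • e v

namespace WIso

variable {t'' : Fin n → R} {M : WMod σ O t} {N : WMod σ O t'} {P : WMod σ O t''}

theorem refl (M : WMod σ O t) : WIso M M := ⟨LinearEquiv.refl R M, fun _ _ _ => rfl⟩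

theorem symm : WIso M N → WIso N M := by
  rintro ⟨e, he⟩
  refine ⟨e.symm, fun i ε v => ?_⟩
  rw [LinearEquiv.symm_apply_eq, he, LinearEquiv.apply_symm_apply]

theorem trans : WIso M N → WIso N P → WIso M P := by
  rintro ⟨e, he⟩ ⟨f, hf⟩
  exact ⟨e.trans f, fun i ε v => by
    rw [LinearEquiv.trans_apply, LinearEquiv.trans_apply, he, hf]⟩

theorem nonempty_linearEquiv {N : WMod σ O t} : WIso M N → Nonempty (M ≃ₗ[TGWA σ t] N) := by
  rintro ⟨e, he⟩
  exact ⟨LinearEquiv.ofBijective (linearMapOfX e.toLinearMap he) e.bijective⟩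

theorem of_linearEquiv {N : WMod σ O t} (e : M ≃ₗ[TGWA σ t] N) : WIso M N :=
  ⟨LinearEquiv.ofBijective (toRLinear e.toLinearMap) e.bijective,
    fun i ε v => map_smul e (TGWA.X σ t i ε) v⟩

end WIso

theorem WMod.smul_tmul (M : WMod σ O t) (N : WMod σ O t') (h : DiagDescends σ t t' M N)
    (r : R) (v : M) (w : N) : M.tmul N h (r • v) w = M.tmul N h v (r • w) :=
  TensorProduct.smul_tmul r v w

namespace UnitData

variable (U : UnitData σ O u)

/-- The linear equivalence `N ≃ S ⊗ N` with `v ↦ s m ⊗ v` for `v` of weight `m`. -/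
def expand (N : WMod σ O t) (hd : DiagDescends σ u t U.obj N) : N ≃ₗ[R] U.obj.tensor N hd :=
  U.isWeightBasis.expandEquiv N

theorem expand_apply (N : WMod σ O t) (hd : DiagDescends σ u t U.obj N) {m : MaximalSpectrum R}
    {v : N} (hv : v ∈ weightSpace N m) : U.expand N hd v = U.obj.tmul N hd (U.basis m) v :=
  U.isWeightBasis.expandEquiv_apply N hv

theorem smul_expand_X_smul (N : WMod σ O t) (hd : DiagDescends σ u t U.obj N) (i : Fin n) (ε : ℤˣ)
    {m : MaximalSpectrum R} {v : N} (hv : v ∈ weightSpace N m) :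
    U.expand N hd (TGWA.X σ t i ε • v) =
      U.scaling i ε (translate (sigmaPow σ (letterDeg (i, ε))) m) •
        TGWA.X σ (u * t) i ε • U.expand N hd v := by
  rw [U.expand_apply N hd (X_smul_mem i ε hv), ← U.isScaling, U.expand_apply N hd hv,
    WMod.X_smul_tmul]
  exact (TensorProduct.smul_tmul' (R := R) _ _ _).symm

/-- For `v` of weight `m`, `X (s m ⊗ v) = X s m ⊗ d X v = d X s m ⊗ X v`. The first factor is now
the basis vector at the new weight, so `v ↦ s m ⊗ v` intertwines the actions. -/
theorem tensor_untwist (ht' : t' ∈ Omega σ) (h : u * t' = t) (N : WMod σ O t)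
    (hd : DiagDescends σ u t' U.obj (U.untwist ht' h N)) :
    WIso (U.obj.tensor (U.untwist ht' h N) hd) N := by
  refine WIso.symm ⟨(U.untwistEquiv ht' h N).trans (U.expand (U.untwist ht' h N) hd),
    fun i ε v => ?_⟩
  rw [LinearEquiv.trans_apply, LinearEquiv.trans_apply]
  induction v using weight_induction N.iSup_weightSpace with
  | h0 => simp only [smul_zero, map_zero]
  | hadd v w hv hw => rw [smul_add, map_add, map_add, hv, hw, map_add, map_add, smul_add]
  | hw m v hv =>
    have h1 := apply_mem_weightSpace (U.untwistEquiv ht' h N).toLinearMap hv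
    have h2 := apply_mem_weightSpace (U.untwistEquiv ht' h N).toLinearMap
      (X_smul_mem (σ := σ) (t := t) i ε hv)
    rw [LinearEquiv.coe_coe] at h1 h2
    rw [U.expand_apply _ hd h1, U.expand_apply _ hd h2, WMod.X_smul_tmul, X_smul_untwistEquiv,
      scaledX_apply_of_mem _ _ _ _ hv, (U.untwistEquiv ht' h N).map_smul, ← U.isScaling,
      WMod.smul_tmul]

/-- Rescaling by `d` commutes with `R`-linear maps, and on `S ⊗ M` it undoes the structure constants
of `S`. Since `N` need only be isomorphic to `S ⊗ M`, its parameter may be a different expression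
for `u t'`. -/
theorem untwist_tensor (ht' : t' ∈ Omega σ) (M : WMod σ O t') (hd : DiagDescends σ u t' U.obj M)
    (h : u * t' = t) (N : WMod σ O t) (hN : WIso N (U.obj.tensor M hd)) :
    WIso (U.untwist ht' h N) M := by
  obtain ⟨e, he⟩ := hN
  refine WIso.symm ⟨(U.expand M hd).trans (e.symm.trans (U.untwistEquiv ht' h N)), fun i ε v => ?_⟩
  rw [LinearEquiv.trans_apply, LinearEquiv.trans_apply, LinearEquiv.trans_apply,
    LinearEquiv.trans_apply, X_smul_untwistEquiv, EmbeddingLike.apply_eq_iff_eq,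
    LinearEquiv.symm_apply_eq, scaledX_apply]
  refine Eq.trans ?_ (apply_act N.iSup_weightSpace (U.obj.tensor M hd).iSup_weightSpace
    (U.scaling i ε) e.toLinearMap _).symm
  rw [LinearEquiv.coe_coe, he, LinearEquiv.apply_symm_apply]
  induction v using weight_induction M.iSup_weightSpace with
  | h0 => simp only [smul_zero, map_zero]
  | hadd v w hv hw => rw [smul_add, map_add, hv, hw, map_add, smul_add, map_add]
  | hw m v hv =>
    have hmem := apply_mem_weightSpace (U.expand M hd).toLinearMap hv
    rw [LinearEquiv.coe_coe] at hmem
    rw [U.smul_expand_X_smul M hd i ε hv, act_apply _ _ (X_smul_mem i ε hmem)]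

/-- `untwist` on morphisms. -/
def untwistMap (ht' : t' ∈ Omega σ) (h : u * t' = t) {M N : WMod σ O t} (f : M →ₗ[TGWA σ t] N) :
    U.untwist ht' h M →ₗ[TGWA σ t'] U.untwist ht' h N :=
  linearMapOfX ((U.untwistEquiv ht' h N).toLinearMap ∘ₗ toRLinear f ∘ₗ
    (U.untwistEquiv ht' h M).symm.toLinearMap) <| by
    intro i ε v
    obtain ⟨v, rfl⟩ := (U.untwistEquiv ht' h M).surjective v
    simp only [LinearMap.comp_apply, LinearEquiv.coe_coe, X_smul_untwistEquiv,
      LinearEquiv.symm_apply_apply]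
    rw [scaledX_apply, apply_act M.iSup_weightSpace N.iSup_weightSpace, toRLinear_apply, map_smul,
      toRLinear_apply, scaledX_apply]

/-- Untwisting changes neither the underlying `R`-modules nor the maps. -/
theorem isExtension_untwist (k : Kind) (ht' : t' ∈ Omega σ) (h : u * t' = t) {M N P : WMod σ O t}
    (he : IsExtension k M N P) :
    IsExtension k (U.untwist ht' h M) (U.untwist ht' h N) (U.untwist ht' h P) := by
  cases k with
  | exact =>
    obtain ⟨f, g, hf, hfg, hg⟩ := he
    exact ⟨U.untwistMap ht' h f, U.untwistMap ht' h g, hf, hfg, hg⟩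
  | split =>
    obtain ⟨e⟩ := he
    exact ⟨LinearEquiv.ofBijective ((U.untwistMap ht' h (.fst _ _ _ ∘ₗ e.toLinearMap)).prod
      (U.untwistMap ht' h (.snd _ _ _ ∘ₗ e.toLinearMap))) e.bijective⟩

end UnitData

end Iso

/-! ### Commutativity and associativity of the tensor product. -/

section TensorIso

variable {s s' : Fin n → R}

theorem WIso.of_tmul {M : WMod σ O t} {N : WMod σ O t'} {h : DiagDescends σ t t' M N}
    {P : WMod σ O s} (e : M.tensor N h ≃ₗ[R] P)
    (he : ∀ i ε v w, e (M.tmul N h (TGWA.X σ t i ε • v) (TGWA.X σ t' i ε • w)) =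
      TGWA.X σ s i ε • e (M.tmul N h v w)) : WIso (M.tensor N h) P := by
  refine ⟨e, fun i ε x => ?_⟩
  induction x using WMod.tensor_induction with
  | h0 => simp only [smul_zero, map_zero]
  | hadd x y hx hy => rw [smul_add, map_add, hx, hy, map_add, smul_add]
  | htmul m v _ w _ => rw [WMod.X_smul_tmul, he]

theorem WIso.tensor {M : WMod σ O t} {N : WMod σ O t'} {M' : WMod σ O s} {N' : WMod σ O s'}
    (h : DiagDescends σ t t' M N) (h' : DiagDescends σ s s' M' N') :
    WIso M M' → WIso N N' → WIso (M.tensor N h) (M'.tensor N' h') := by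
  rintro ⟨e, he⟩ ⟨f, hf⟩
  refine WIso.of_tmul (TensorProduct.congr e f : M ⊗[R] N ≃ₗ[R] M' ⊗[R] N') fun i ε v w => ?_
  refine Eq.trans ?_ (WMod.X_smul_tmul M' N' h' i ε (e v) (f w)).symm
  rw [← he, ← hf]
  rfl

theorem WIso.tensor_comm (M : WMod σ O t) (N : WMod σ O t') (h : DiagDescends σ t t' M N)
    (h' : DiagDescends σ t' t N M) : WIso (M.tensor N h) (N.tensor M h') :=
  WIso.of_tmul (TensorProduct.comm R M N) fun i ε v w => (WMod.X_smul_tmul N M h' i ε w v).symm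

theorem WIso.tensor_right_comm (M : WMod σ O t) (N : WMod σ O t') (P : WMod σ O s)
    (h₁ : DiagDescends σ t t' M N) (h₂ : DiagDescends σ (t * t') s (M.tensor N h₁) P)
    (h₃ : DiagDescends σ t s M P) (h₄ : DiagDescends σ (t * s) t' (M.tensor P h₃) N) :
    WIso ((M.tensor N h₁).tensor P h₂) ((M.tensor P h₃).tensor N h₄) := by
  refine WIso.of_tmul (TensorProduct.rightComm R M N P) fun i ε x p => ?_
  induction x using WMod.tensor_induction with
  | h0 =>
    have h0 : ∀ p, (M.tensor N h₁).tmul P h₂ 0 p = 0 := fun p => TensorProduct.zero_tmul _ _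
    rw [smul_zero, h0, h0]
    exact (smul_zero _).symm
  | hadd x y hx hy =>
    have h0 : ∀ x y p, (M.tensor N h₁).tmul P h₂ (x + y) p =
      (M.tensor N h₁).tmul P h₂ x p + (M.tensor N h₁).tmul P h₂ y p :=
      fun x y p => TensorProduct.add_tmul _ _ _
    rw [smul_add, h0, h0]
    refine (map_add (TensorProduct.rightComm R M N P) _ _).trans ?_
    refine Eq.trans ?_ (congrArg _ (map_add (TensorProduct.rightComm R M N P) _ _).symm)
    exact (congrArg₂ (· + ·) hx hy).trans (smul_add (A := (M.tensor P h₃).tensor N h₄) _ _ _).symm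
  | htmul m v _ w _ =>
    rw [WMod.X_smul_tmul]
    exact ((WMod.X_smul_tmul (M.tensor P h₃) N h₄ i ε (M.tmul P h₃ v p) w).trans
      (by rw [WMod.X_smul_tmul]; rfl)).symm

theorem WIso.tensor_assoc (M : WMod σ O t) (N : WMod σ O t') (P : WMod σ O s)
    (h₁ : DiagDescends σ t t' M N) (h₂ : DiagDescends σ (t * t') s (M.tensor N h₁) P)
    (h₃ : DiagDescends σ t' s N P) (h₄ : DiagDescends σ t (t' * s) M (N.tensor P h₃)) :
    WIso ((M.tensor N h₁).tensor P h₂) (M.tensor (N.tensor P h₃) h₄) := by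
  refine WIso.of_tmul (TensorProduct.assoc R M N P) fun i ε x p => ?_
  induction x using WMod.tensor_induction with
  | h0 =>
    have h0 : ∀ p, (M.tensor N h₁).tmul P h₂ 0 p = 0 := fun p => TensorProduct.zero_tmul _ _
    rw [smul_zero, h0, h0]
    exact (smul_zero _).symm
  | hadd x y hx hy =>
    have h0 : ∀ x y p, (M.tensor N h₁).tmul P h₂ (x + y) p =
      (M.tensor N h₁).tmul P h₂ x p + (M.tensor N h₁).tmul P h₂ y p :=
      fun x y p => TensorProduct.add_tmul _ _ _
    rw [smul_add, h0, h0]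
    refine (map_add (TensorProduct.assoc R M N P) _ _).trans ?_
    refine Eq.trans ?_ (congrArg _ (map_add (TensorProduct.assoc R M N P) _ _).symm)
    exact (congrArg₂ (· + ·) hx hy).trans (smul_add (A := M.tensor (N.tensor P h₃) h₄) _ _ _).symm
  | htmul m v _ w _ =>
    rw [WMod.X_smul_tmul]
    exact ((WMod.X_smul_tmul M (N.tensor P h₃) h₄ i ε v (N.tmul P h₃ w p)).trans
      (by rw [WMod.X_smul_tmul]; rfl)).symm

end TensorIso

/-! ### Isomorphism invariance of classes in the Grothendieck groups. -/

section K0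

/-- The zero module. -/
def WMod.zero (σ : Fin n → RingAut R) (O : Set (MaximalSpectrum R)) (t : Fin n → R) :
    WMod σ O t where
  carrier := PUnit
  induced := ⟨fun _ _ => rfl⟩
  isInternal := isInternal_weightSpace (Subsingleton.elim _ _)
  finite := fun m => by
    rw [Subsingleton.elim (weightSpace PUnit.{u + 1} m) (⊥ : Submodule R PUnit.{u + 1})]
    infer_instance
  support := fun _ h => absurd (Subsingleton.elim _ _) h

instance : Subsingleton (WMod.zero σ O t) := inferInstanceAs (Subsingleton PUnit)

/-- This yields `[0] = 0` and then `[M] = [N]` for isomorphic modules, in both kinds of Grothendieck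
group. -/
theorem isExtension_zero (k : Kind) {M N : WMod σ O t} (e : M ≃ₗ[TGWA σ t] N) :
    IsExtension k M N (WMod.zero σ O t) := by
  cases k with
  | exact =>
    refine ⟨e.toLinearMap, 0, e.injective, fun x => ⟨fun _ => e.surjective x, fun _ => rfl⟩, ?_⟩
    exact fun y => ⟨0, Subsingleton.elim _ _⟩
  | split =>
    refine ⟨LinearEquiv.ofBijective (e.symm.toLinearMap.prod 0) ⟨?_, ?_⟩⟩
    · intro x y h
      exact e.symm.injective (congrArg Prod.fst h)
    · rintro ⟨x, z⟩
      exact ⟨e x, Prod.ext (e.symm_apply_apply x) (Subsingleton.elim _ _)⟩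

theorem K0.of_zero (k : Kind) : K0.of k (WMod.zero σ O t) = 0 := by
  have h := K0.of_eq k (isExtension_zero k (LinearEquiv.refl (TGWA σ t) (WMod.zero σ O t)))
  exact left_eq_add.1 h

theorem K0.of_congr (k : Kind) {M N : WMod σ O t} (e : M ≃ₗ[TGWA σ t] N) :
    K0.of k M = K0.of k N := by
  have h := K0.of_eq k (isExtension_zero k e)
  rw [K0.of_zero, add_zero] at h
  exact h.symm

theorem K0.induction (k : Kind) {Q : K0 k σ O t → Prop} (h0 : Q 0)
    (hadd : ∀ x y, Q x → Q y → Q (x + y)) (hneg : ∀ x, Q x → Q (-x)) (hof : ∀ M, Q (K0.of k M))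
    (x : K0 k σ O t) : Q x := by
  obtain ⟨x, rfl⟩ := QuotientAddGroup.mk_surjective x
  induction x using FreeAbelianGroup.induction_on with
  | zero => exact h0
  | of M => exact hof M
  | neg M h => exact hneg _ h
  | add x y hx hy => exact hadd _ _ hx hy

end K0

/-! ### The classes as generators of the Grothendieck algebra, and its universal property. -/

namespace GrAlg

variable (k : Kind) {Γ : Submonoid (Fin n → R)} (hΓ : TensorDefined σ O Γ)

theorem cls_congr {s t : Γ} (h : s = t) {M : WMod σ O (s : Fin n → R)}
    {N : WMod σ O (t : Fin n → R)} (e : WIso M N) : cls k σ O hΓ s M = cls k σ O hΓ t N := by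
  subst h
  obtain ⟨e⟩ := e.nonempty_linearEquiv
  rw [cls, cls, K0.of_congr k e]

theorem grade_eq_span (t : Γ) :
    grade k σ O hΓ t = Submodule.span ℂ (Set.range (cls k σ O hΓ t)) := by
  refine le_antisymm ?_ ?_
  · rintro _ ⟨x, rfl⟩
    induction x with
    | zero => rw [map_zero]; exact zero_mem _
    | add x y hx hy => rw [map_add]; exact add_mem hx hy
    | tmul z x =>
      have h1 : z ⊗ₜ[ℤ] x = z • ((1 : ℂ) ⊗ₜ[ℤ] x) := by
        rw [TensorProduct.smul_tmul', smul_eq_mul, mul_one]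
      rw [h1, map_smul]
      refine Submodule.smul_mem _ _ ?_
      induction x using K0.induction with
      | h0 => rw [TensorProduct.tmul_zero, map_zero]; exact zero_mem _
      | hadd x y hx hy =>
        rw [TensorProduct.tmul_add, map_add]
        refine add_mem (hx ?_) (hy ?_) <;>
          rw [TensorProduct.smul_tmul', smul_eq_mul, mul_one]
      | hneg x hx =>
        rw [TensorProduct.tmul_neg, map_neg]
        refine neg_mem (hx ?_)
        rw [TensorProduct.smul_tmul', smul_eq_mul, mul_one]
      | hof M => exact Submodule.subset_span ⟨M, rfl⟩
  · rw [Submodule.span_le]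
    rintro _ ⟨M, rfl⟩
    exact ⟨_, rfl⟩

theorem cls_mem_grade (t : Γ) (M : WMod σ O (t : Fin n → R)) :
    cls k σ O hΓ t M ∈ grade k σ O hΓ t := ⟨_, rfl⟩

theorem iSup_grade : ⨆ t, grade k σ O hΓ t = ⊤ := by
  classical
  rw [eq_top_iff]
  rintro x -
  induction x using DirectSum.induction_on with
  | zero => exact zero_mem _
  | of t x => exact Submodule.mem_iSup_of_mem t ⟨x, rfl⟩
  | add x y hx hy => exact add_mem hx hy

variable {k hΓ} in
theorem induction {Q : GrAlg k σ O Γ hΓ → Prop} (h0 : Q 0) (hadd : ∀ x y, Q x → Q y → Q (x + y))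
    (hsmul : ∀ (z : ℂ) x, Q x → Q (z • x)) (hcls : ∀ t M, Q (cls k σ O hΓ t M))
    (x : GrAlg k σ O Γ hΓ) : Q x := by
  have hx : x ∈ ⨆ t, grade k σ O hΓ t := by rw [iSup_grade]; exact Submodule.mem_top
  induction hx using Submodule.iSup_induction' with
  | zero => exact h0
  | add x y _ _ hx hy => exact hadd x y hx hy
  | mem t x hx =>
    rw [grade_eq_span] at hx
    induction hx using Submodule.span_induction with
    | mem x hx => obtain ⟨M, rfl⟩ := hx; exact hcls t M
    | zero => exact h0
    | add x y _ _ hx hy => exact hadd x y hx hy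
    | smul z x _ hx => exact hsmul z x hx

variable {V : Type (u + 1)} [AddCommGroup V] [Module ℂ V]

open Classical in
/-- The universal property of the Grothendieck algebra as a vector space. -/
def lift (f : ∀ t : Γ, WMod σ O (t : Fin n → R) → V)
    (hf : ∀ t M N P, IsExtension k M N P → f t N = f t M + f t P) : GrAlg k σ O Γ hΓ →ₗ[ℂ] V :=
  DirectSum.toModule ℂ Γ V fun t =>
    LinearMap.liftBaseChange ℂ (K0.lift k (f t) (hf t)).toIntLinearMap

theorem lift_cls (f : ∀ t : Γ, WMod σ O (t : Fin n → R) → V)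
    (hf : ∀ t M N P, IsExtension k M N P → f t N = f t M + f t P) (t : Γ)
    (M : WMod σ O (t : Fin n → R)) : lift k hΓ f hf (cls k σ O hΓ t M) = f t M := by
  classical
  have h := DirectSum.toModule_lof (M := fun t : Γ => ℂ ⊗[ℤ] K0 k σ O (t : Fin n → R)) ℂ
    (φ := fun t => LinearMap.liftBaseChange ℂ (K0.lift k (f t) (hf t)).toIntLinearMap) t
    (1 ⊗ₜ K0.of k M)
  refine h.trans ?_
  rw [LinearMap.liftBaseChange_tmul, one_smul]
  exact K0.lift_of k (f t) (hf t) M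

theorem cls_eq_add {t : Γ} {M N P : WMod σ O (t : Fin n → R)} (h : IsExtension k M N P) :
    cls k σ O hΓ t N = cls k σ O hΓ t M + cls k σ O hΓ t P := by
  rw [cls, cls, cls, K0.of_eq k h, TensorProduct.tmul_add, map_add]

end GrAlg

/-- A splitting `Γ = Γ^× Γ'` with a simple module for each element of `Γ^×`. -/
structure SplitData (σ : Fin n → RingAut R) (O : Set (MaximalSpectrum R))
    (Γ Γ' : Submonoid (Fin n → R)) where
  subset_omega : (Γ : Set (Fin n → R)) ⊆ Omega σ
  tensorDefined : TensorDefined σ O Γ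
  le : Γ' ≤ Γ
  split : ∀ t ∈ Γ, ∃! p : unitPart σ O Γ × Γ', (p.1 : Fin n → R) * (p.2 : Fin n → R) = t
  unit : ∀ u : unitPart σ O Γ, UnitData σ O (u : Fin n → R)

/-! ### Twisting and untwisting along the splitting of `Γ`. -/

namespace SplitData

variable {Γ Γ' : Submonoid (Fin n → R)} (D : SplitData σ O Γ Γ') (k : Kind)

/-- The element of `Γ` with given components in `Γ^×` and `Γ'`. -/
def prod (p : unitPart σ O Γ × Γ') : Γ := ⟨p.1 * p.2, mul_mem p.1.2.1 (D.le p.2.2)⟩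

/-- The components of an element of `Γ` in `Γ^×` and `Γ'`. -/
def factor (t : Γ) : unitPart σ O Γ × Γ' := (D.split t t.2).choose

theorem factor_spec (t : Γ) :
    ((D.factor t).1 : Fin n → R) * ((D.factor t).2 : Fin n → R) = t :=
  (D.split t t.2).choose_spec.1

theorem factor_eq {t : Γ} {p : unitPart σ O Γ × Γ'}
    (h : (p.1 : Fin n → R) * (p.2 : Fin n → R) = t) : D.factor t = p :=
  ((D.split t t.2).choose_spec.2 p h).symm

theorem mem_omega (D : SplitData σ O Γ Γ') (t' : Γ') : (t' : Fin n → R) ∈ Omega σ := D.subset_omega (D.le t'.2)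

/-- The untwisted module in degree `t'` of a module in degree `u t'`. -/
def untwist (p : unitPart σ O Γ × Γ') {t : Fin n → R}
    (h : (p.1 : Fin n → R) * (p.2 : Fin n → R) = t) (N : WMod σ O t) :
    WMod σ O (p.2 : Fin n → R) :=
  (D.unit p.1).untwist (D.mem_omega p.2) h N

/-- The tensor product of a module in degree `t'` with the simple module in degree `u`. -/
def twist (p : unitPart σ O Γ × Γ') (M : WMod σ O (p.2 : Fin n → R)) :
    WMod σ O (D.prod p : Fin n → R) :=
  (D.unit p.1).obj.tensor M (D.tensorDefined _ p.1.2.1 _ (D.le p.2.2) _ _)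

theorem untwist_wiso (p : unitPart σ O Γ × Γ') {t : Fin n → R}
    (h : (p.1 : Fin n → R) * (p.2 : Fin n → R) = t) {N : WMod σ O t}
    {M : WMod σ O (p.2 : Fin n → R)} (e : WIso N (D.twist p M)) : WIso (D.untwist p h N) M :=
  (D.unit p.1).untwist_tensor (D.mem_omega p.2) M _ h N e

theorem twist_untwist (p : unitPart σ O Γ × Γ') {t : Fin n → R}
    (h : (p.1 : Fin n → R) * (p.2 : Fin n → R) = t) (N : WMod σ O t) :
    WIso (D.twist p (D.untwist p h N)) N :=
  (D.unit p.1).tensor_untwist (D.mem_omega p.2) h N _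

theorem isExtension_untwist (p : unitPart σ O Γ × Γ') {t : Fin n → R}
    (h : (p.1 : Fin n → R) * (p.2 : Fin n → R) = t) {M N P : WMod σ O t}
    (e : IsExtension k M N P) :
    IsExtension k (D.untwist p h M) (D.untwist p h N) (D.untwist p h P) :=
  (D.unit p.1).isExtension_untwist k (D.mem_omega p.2) h e

theorem isExtension_twist (p : unitPart σ O Γ × Γ') {M N P : WMod σ O (p.2 : Fin n → R)}
    (e : IsExtension k M N P) : IsExtension k (D.twist p M) (D.twist p N) (D.twist p P) :=
  isExtension_tensor_left k _ _ _ _ e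

/-- Both sides are generated by a nonzero vector of weight `m₀`, hence isomorphic. As `S` is an
arbitrary simple module, the choices made in `D.unit` do not matter. -/
theorem tensor_wiso_unit (u v : unitPart σ O Γ) (S : WMod σ O (v : Fin n → R))
    (hS : IsSimpleModule (TGWA σ (v : Fin n → R)) S)
    (h : DiagDescends σ (u : Fin n → R) (v : Fin n → R) (D.unit u).obj S) :
    WIso ((D.unit u).obj.tensor S h) (D.unit (u * v)).obj := by
  have hσ := (D.unit u).commute
  have hO := (D.unit u).isOrbit
  obtain ⟨m₀, hm₀⟩ := hO.1.nonempty
  have h1 : IsCyclicAt ((D.unit u).obj.tensor S h) m₀ :=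
    (isCyclicAt_of_isSimpleModule hσ hO.1 u.2.2 hm₀ _ (D.unit u).isSimple).tensor hσ hO u.2.2 v.2.2
      hm₀ h (isCyclicAt_of_isSimpleModule hσ hO.1 v.2.2 hm₀ _ hS)
  have h2 : IsCyclicAt (D.unit (u * v)).obj m₀ :=
    isCyclicAt_of_isSimpleModule hσ hO.1 (u * v).2.2 hm₀ _ (D.unit (u * v)).isSimple
  obtain ⟨e⟩ := nonempty_linearEquiv_of_isCyclicAt (t := (u : Fin n → R) * (v : Fin n → R)) hσ hO (u * v).2.2
    (D.unit (u * v)).mem_omega.2 hm₀ h1 h2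
  exact WIso.of_linearEquiv e

/-- Rearrange `(S ⊗ M') ⊗ (T ⊗ N')` to `(S ⊗ T) ⊗ (M' ⊗ N')` and replace `S ⊗ T` by the simple
module of the product. Existence of the isomorphism suffices, since only classes are compared. -/
theorem wiso_twist_tensor {p q : unitPart σ O Γ × Γ'} {s t : Γ} {M : WMod σ O (s : Fin n → R)}
    {N : WMod σ O (t : Fin n → R)} {M' : WMod σ O (p.2 : Fin n → R)}
    {N' : WMod σ O (q.2 : Fin n → R)} (e : WIso M (D.twist p M')) (f : WIso N (D.twist q N')) :
    WIso (M.tensor N (D.tensorDefined _ s.2 _ t.2 M N))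
      (D.twist (p * q) (M'.tensor N' (D.tensorDefined _ (D.le p.2.2) _ (D.le q.2.2) M' N'))) := by
  have hΓ := D.tensorDefined
  set S := (D.unit p.1).obj
  set T := (D.unit q.1).obj
  have hS := p.1.2.1
  have hT := q.1.2.1
  have hM := D.le p.2.2
  have hN := D.le q.2.2
  have hSM := hΓ _ hS _ hM S M'
  have hTN := hΓ _ hT _ hN T N'
  have h1 : WIso (M.tensor N (hΓ _ s.2 _ t.2 M N))
      ((S.tensor M' hSM).tensor (T.tensor N' hTN)
        (hΓ _ (mul_mem hS hM) _ (mul_mem hT hN) _ _)) := WIso.tensor _ _ e f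
  have h2 := (WIso.tensor_assoc (S.tensor M' hSM) T N' (hΓ _ (mul_mem hS hM) _ hT _ _)
    (hΓ _ (mul_mem (mul_mem hS hM) hT) _ hN _ _) hTN (hΓ _ (mul_mem hS hM) _ (mul_mem hT hN) _ _)).symm
  have h3 := WIso.tensor_right_comm S M' T hSM (hΓ _ (mul_mem hS hM) _ hT _ _)
    (hΓ _ hS _ hT _ _) (hΓ _ (mul_mem hS hT) _ hM _ _)
  have h4 := WIso.tensor (hΓ _ (mul_mem (mul_mem hS hM) hT) _ hN _ _)
    (hΓ _ (mul_mem (mul_mem hS hT) hM) _ hN _ _) h3 (WIso.refl N')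
  have h5 := WIso.tensor_assoc (S.tensor T (hΓ _ hS _ hT _ _)) M' N' (hΓ _ (mul_mem hS hT) _ hM _ _)
    (hΓ _ (mul_mem (mul_mem hS hT) hM) _ hN _ _) (hΓ _ hM _ hN _ _)
    (hΓ _ (mul_mem hS hT) _ (mul_mem hM hN) _ _)
  have h6 := WIso.tensor (hΓ _ (mul_mem hS hT) _ (mul_mem hM hN) _ _)
    (hΓ _ (mul_mem hS hT) _ (mul_mem hM hN) _ _)
    (D.tensor_wiso_unit p.1 q.1 T (D.unit q.1).isSimple (hΓ _ hS _ hT _ _))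
    (WIso.refl (M'.tensor N' (hΓ _ hM _ hN _ _)))
  exact h1.trans (h2.trans (h4.trans (h5.trans h6)))

theorem wiso_twist_tensor_unit {p : unitPart σ O Γ × Γ'} {t : Γ} {M : WMod σ O (t : Fin n → R)}
    {M' : WMod σ O (p.2 : Fin n → R)} (e : WIso M (D.twist p M')) (v : unitPart σ O Γ)
    (S : WMod σ O (v : Fin n → R)) (hS : IsSimpleModule (TGWA σ (v : Fin n → R)) S) :
    WIso (M.tensor S (D.tensorDefined _ t.2 _ v.2.1 M S)) (D.twist (p.1 * v, p.2) M') := by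
  have hΓ := D.tensorDefined
  have hM := D.le p.2.2
  have h1 := WIso.tensor (hΓ _ t.2 _ v.2.1 M S) (hΓ _ (mul_mem p.1.2.1 hM) _ v.2.1 _ _) e
    (WIso.refl S)
  have h2 := WIso.tensor_right_comm (D.unit p.1).obj M' S (hΓ _ p.1.2.1 _ hM _ _)
    (hΓ _ (mul_mem p.1.2.1 hM) _ v.2.1 _ _) (hΓ _ p.1.2.1 _ v.2.1 _ _)
    (hΓ _ (mul_mem p.1.2.1 v.2.1) _ hM _ _)
  have h3 := WIso.tensor (hΓ _ (mul_mem p.1.2.1 v.2.1) _ hM _ _)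
    (hΓ _ (mul_mem p.1.2.1 v.2.1) _ hM _ _)
    (D.tensor_wiso_unit p.1 v S hS (hΓ _ p.1.2.1 _ v.2.1 _ _)) (WIso.refl M')
  exact h1.trans (h2.trans h3)

/-! ### The algebra isomorphisms and their gradings. -/

section Maps

/-- The linear map `[N] ↦ u ⊗ [N']`, where `N` is the twist of `N'` by `u`. -/
def toTensor : GrAlg k σ O Γ D.tensorDefined →ₗ[ℂ] TensorAlg k σ O Γ (D.tensorDefined.mono D.le) :=
  GrAlg.lift k _ (fun t N => MonoidAlgebra.single (D.factor t).1 (1 : ℂ) ⊗ₜ[ℂ]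
      GrAlg.cls k σ O (D.tensorDefined.mono D.le) (D.factor t).2 (D.untwist _ (D.factor_spec t) N)) <| by
    intro t M N P e
    rw [GrAlg.cls_eq_add k _ (D.isExtension_untwist k _ _ e), TensorProduct.tmul_add]

theorem toTensor_cls {p : unitPart σ O Γ × Γ'} {t : Γ} {N : WMod σ O (t : Fin n → R)}
    {M : WMod σ O (p.2 : Fin n → R)} (h : D.prod p = t) (e : WIso N (D.twist p M)) :
    D.toTensor k (GrAlg.cls k σ O D.tensorDefined t N) =
      MonoidAlgebra.single p.1 (1 : ℂ) ⊗ₜ[ℂ] GrAlg.cls k σ O (D.tensorDefined.mono D.le) p.2 M := by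
  obtain rfl : D.factor t = p := D.factor_eq (congrArg Subtype.val h)
  rw [toTensor, GrAlg.lift_cls, GrAlg.cls_congr k _ rfl (D.untwist_wiso _ (D.factor_spec t) e)]

/-- The linear map `[N] ↦ [N']`, where `N` is a twist of `N'`. -/
def retract : GrAlg k σ O Γ D.tensorDefined →ₗ[ℂ] GrAlg k σ O Γ' (D.tensorDefined.mono D.le) :=
  GrAlg.lift k _ (fun t N => GrAlg.cls k σ O (D.tensorDefined.mono D.le) (D.factor t).2
      (D.untwist _ (D.factor_spec t) N)) <| by
    intro t M N P e
    exact GrAlg.cls_eq_add k _ (D.isExtension_untwist k _ _ e)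

theorem retract_cls {p : unitPart σ O Γ × Γ'} {t : Γ} {N : WMod σ O (t : Fin n → R)}
    {M : WMod σ O (p.2 : Fin n → R)} (h : D.prod p = t) (e : WIso N (D.twist p M)) :
    D.retract k (GrAlg.cls k σ O D.tensorDefined t N) = GrAlg.cls k σ O (D.tensorDefined.mono D.le) p.2 M := by
  obtain rfl : D.factor t = p := D.factor_eq (congrArg Subtype.val h)
  rw [retract, GrAlg.lift_cls, GrAlg.cls_congr k _ rfl (D.untwist_wiso _ (D.factor_spec t) e)]

/-- The linear map `[M] ↦ [S ⊗ M]`, where `S` is the simple module of `u`. -/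
def twistMap (u : unitPart σ O Γ) : GrAlg k σ O Γ' (D.tensorDefined.mono D.le) →ₗ[ℂ] GrAlg k σ O Γ D.tensorDefined :=
  GrAlg.lift k _ (fun t' M => GrAlg.cls k σ O D.tensorDefined (D.prod (u, t')) (D.twist (u, t') M)) <| by
    intro t M N P e
    exact GrAlg.cls_eq_add k _ (D.isExtension_twist k (u, t) e)

theorem twistMap_cls (p : unitPart σ O Γ × Γ') (M : WMod σ O (p.2 : Fin n → R)) :
    D.twistMap k p.1 (GrAlg.cls k σ O (D.tensorDefined.mono D.le) p.2 M) = GrAlg.cls k σ O D.tensorDefined (D.prod p) (D.twist p M) :=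
  GrAlg.lift_cls k _ _ _ p.2 M

/-- The inverse of `toTensor`. -/
def ofTensor : TensorAlg k σ O Γ (D.tensorDefined.mono D.le) →ₗ[ℂ] GrAlg k σ O Γ D.tensorDefined :=
  TensorProduct.lift <|
    (Finsupp.lsum ℂ fun u => LinearMap.toSpanSingleton ℂ _ (D.twistMap k u)) ∘ₗ
      (MonoidAlgebra.coeffLinearEquiv ℂ).toLinearMap

theorem ofTensor_single_tmul (u : unitPart σ O Γ) (x : GrAlg k σ O Γ' (D.tensorDefined.mono D.le)) :
    D.ofTensor k (MonoidAlgebra.single u (1 : ℂ) ⊗ₜ[ℂ] x) = D.twistMap k u x := by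
  rw [ofTensor, TensorProduct.lift.tmul, LinearMap.comp_apply]
  have h : (MonoidAlgebra.coeffLinearEquiv ℂ).toLinearMap (MonoidAlgebra.single u (1 : ℂ)) =
    Finsupp.single u (1 : ℂ) := rfl
  rw [h, Finsupp.lsum_single, LinearMap.toSpanSingleton_apply, one_smul]

theorem ofTensor_toTensor (x : GrAlg k σ O Γ D.tensorDefined) : D.ofTensor k (D.toTensor k x) = x := by
  induction x using GrAlg.induction with
  | h0 => simp only [map_zero]
  | hadd x y hx hy => simp only [map_add, hx, hy]
  | hsmul z x hx => simp only [map_smul, hx]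
  | hcls t N =>
    have e := D.twist_untwist _ (D.factor_spec t) N
    rw [D.toTensor_cls k (Subtype.ext (D.factor_spec t)) e.symm, ofTensor_single_tmul, twistMap_cls]
    exact GrAlg.cls_congr k _ (Subtype.ext (D.factor_spec t)) e

theorem tensorAlg_induction {Q : TensorAlg k σ O Γ (D.tensorDefined.mono D.le) → Prop} (h0 : Q 0)
    (hadd : ∀ x y, Q x → Q y → Q (x + y)) (hsmul : ∀ (z : ℂ) x, Q x → Q (z • x))
    (hcls : ∀ (p : unitPart σ O Γ × Γ') M,
      Q (MonoidAlgebra.single p.1 (1 : ℂ) ⊗ₜ[ℂ] GrAlg.cls k σ O (D.tensorDefined.mono D.le) p.2 M)) (x) : Q x := by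
  refine TensorProduct.induction_on x h0 (fun a x => ?_) hadd
  · induction a using MonoidAlgebra.induction_linear with
    | zero => rw [TensorProduct.zero_tmul]; exact h0
    | add a b ha hb => rw [TensorProduct.add_tmul]; exact hadd _ _ ha hb
    | single u z =>
      have h1 : MonoidAlgebra.single u z = z • MonoidAlgebra.single u (1 : ℂ) := by simp
      rw [h1, ← TensorProduct.smul_tmul']
      refine hsmul z _ ?_
      induction x using GrAlg.induction with
      | h0 => rw [TensorProduct.tmul_zero]; exact h0
      | hadd x y hx hy => rw [TensorProduct.tmul_add]; exact hadd _ _ hx hy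
      | hsmul z x hx => rw [TensorProduct.tmul_smul]; exact hsmul z _ hx
      | hcls t M => exact hcls (u, t) M

theorem toTensor_ofTensor (x : TensorAlg k σ O Γ (D.tensorDefined.mono D.le)) : D.toTensor k (D.ofTensor k x) = x := by
  induction x using D.tensorAlg_induction with
  | h0 => simp only [map_zero]
  | hadd x y hx hy => simp only [map_add, hx, hy]
  | hsmul z x hx => simp only [map_smul, hx]
  | hcls p M =>
    rw [ofTensor_single_tmul, twistMap_cls, D.toTensor_cls k rfl (WIso.refl _)]

theorem prod_mul (p q : unitPart σ O Γ × Γ') : D.prod (p * q) = D.prod p * D.prod q :=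
  Subtype.ext (mul_mul_mul_comm _ _ _ _)

theorem map_mul_of_cls {B : Type*} [NonUnitalNonAssocRing B] [Module ℂ B] [IsScalarTower ℂ B B]
    [SMulCommClass ℂ B B] (f : GrAlg k σ O Γ D.tensorDefined →ₗ[ℂ] B)
    (hf : ∀ s t M N, f (GrAlg.cls k σ O D.tensorDefined s M * GrAlg.cls k σ O D.tensorDefined t N) =
      f (GrAlg.cls k σ O D.tensorDefined s M) * f (GrAlg.cls k σ O D.tensorDefined t N)) (x y : GrAlg k σ O Γ D.tensorDefined) :
    f (x * y) = f x * f y := by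
  induction x using GrAlg.induction with
  | h0 => simp only [zero_mul, map_zero]
  | hadd x x' hx hx' => simp only [add_mul, map_add, hx, hx']
  | hsmul z x hx => simp only [smul_mul_assoc, map_smul, hx]
  | hcls s M =>
    induction y using GrAlg.induction with
    | h0 => simp only [mul_zero, map_zero]
    | hadd y y' hy hy' => simp only [mul_add, map_add, hy, hy']
    | hsmul z y hy => simp only [mul_smul_comm, map_smul, hy]
    | hcls t N => exact hf s t M N

theorem toTensor_mul (x y : GrAlg k σ O Γ D.tensorDefined) :
    D.toTensor k (x * y) = D.toTensor k x * D.toTensor k y := by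
  refine D.map_mul_of_cls k _ (fun s t M N => ?_) x y
  have e := (D.twist_untwist _ (D.factor_spec s) M).symm
  have f := (D.twist_untwist _ (D.factor_spec t) N).symm
  have hs : D.prod (D.factor s) = s := Subtype.ext (D.factor_spec s)
  have ht : D.prod (D.factor t) = t := Subtype.ext (D.factor_spec t)
  rw [GrAlg.cls_mul_cls, D.toTensor_cls k hs e, D.toTensor_cls k ht f,
    D.toTensor_cls k ((D.prod_mul _ _).trans (by rw [hs, ht])) (D.wiso_twist_tensor e f),
    Algebra.TensorProduct.tmul_mul_tmul, GrAlg.cls_mul_cls, MonoidAlgebra.single_mul_single,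
    one_mul]
  rfl

theorem retract_mul (x y : GrAlg k σ O Γ D.tensorDefined) :
    D.retract k (x * y) = D.retract k x * D.retract k y := by
  refine D.map_mul_of_cls k _ (fun s t M N => ?_) x y
  have e := (D.twist_untwist _ (D.factor_spec s) M).symm
  have f := (D.twist_untwist _ (D.factor_spec t) N).symm
  have hs : D.prod (D.factor s) = s := Subtype.ext (D.factor_spec s)
  have ht : D.prod (D.factor t) = t := Subtype.ext (D.factor_spec t)
  rw [GrAlg.cls_mul_cls, D.retract_cls k hs e, D.retract_cls k ht f,
    D.retract_cls k ((D.prod_mul _ _).trans (by rw [hs, ht])) (D.wiso_twist_tensor e f),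
    GrAlg.cls_mul_cls]
  rfl

theorem retract_twistMap (u : unitPart σ O Γ) (x : GrAlg k σ O Γ' (D.tensorDefined.mono D.le)) :
    D.retract k (D.twistMap k u x) = x := by
  induction x using GrAlg.induction with
  | h0 => simp only [map_zero]
  | hadd x y hx hy => simp only [map_add, hx, hy]
  | hsmul z x hx => simp only [map_smul, hx]
  | hcls t M =>
    rw [D.twistMap_cls k (u, t) M, D.retract_cls k rfl (WIso.refl _)]

/-- An element of `Γ^×` as an element of `Γ`. -/
def unitIncl (u : unitPart σ O Γ) : Γ := ⟨u, u.2.1⟩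

/-- The generators of the ideal have the simple module on the right, the twist has it on the left;
commutativity of the tensor product reconciles them. -/
theorem cls_sub_twistMap_mem (p : unitPart σ O Γ × Γ') (M : WMod σ O (p.2 : Fin n → R)) :
    GrAlg.cls k σ O D.tensorDefined (Submonoid.inclusion D.le p.2) M -
      D.twistMap k p.1 (GrAlg.cls k σ O (D.tensorDefined.mono D.le) p.2 M) ∈ unitIdeal k σ O D.tensorDefined := by
  rw [unitIdeal, Submodule.mem_sInf]
  intro I hI
  have h1 : GrAlg.cls k σ O D.tensorDefined (Submonoid.inclusion D.le p.2) M -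
      GrAlg.cls k σ O D.tensorDefined (Submonoid.inclusion D.le p.2 * unitIncl p.1)
        (M.tensor (D.unit p.1).obj (D.tensorDefined _ (D.le p.2.2) _ p.1.2.1 _ _)) ∈ I :=
    hI.1 ⟨Submonoid.inclusion D.le p.2, unitIncl p.1, p.1.2, M, (D.unit p.1).obj,
      (D.unit p.1).isSimple, rfl⟩
  have h2 : GrAlg.cls k σ O D.tensorDefined (Submonoid.inclusion D.le p.2 * unitIncl p.1)
      (M.tensor (D.unit p.1).obj (D.tensorDefined _ (D.le p.2.2) _ p.1.2.1 _ _)) =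
      GrAlg.cls k σ O D.tensorDefined (D.prod p) (D.twist p M) :=
    GrAlg.cls_congr k _ (Subtype.ext (mul_comm _ _)) (WIso.tensor_comm M (D.unit p.1).obj
      (D.tensorDefined _ (D.le p.2.2) _ p.1.2.1 _ _) (D.tensorDefined _ p.1.2.1 _ (D.le p.2.2) _ _))
  rw [twistMap_cls, ← h2]
  exact h1

/-- For `N ≅ S_u ⊗ M`, both `[S_u ⊗ M]` and `[S_1 ⊗ M]` are congruent to `[M]` modulo the ideal. -/
theorem sub_twistMap_retract_mem (x : GrAlg k σ O Γ D.tensorDefined) :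
    x - D.twistMap k 1 (D.retract k x) ∈ unitIdeal k σ O D.tensorDefined := by
  induction x using GrAlg.induction with
  | h0 => simp only [map_zero, sub_zero]; exact zero_mem _
  | hadd x y hx hy =>
    rw [map_add, map_add, add_sub_add_comm]
    exact add_mem hx hy
  | hsmul z x hx =>
    rw [map_smul, map_smul, ← smul_sub]
    exact Submodule.smul_mem _ z hx
  | hcls t N =>
    have e := D.twist_untwist _ (D.factor_spec t) N
    have ht : D.prod (D.factor t) = t := Subtype.ext (D.factor_spec t)
    rw [D.retract_cls k ht e.symm, ← GrAlg.cls_congr k _ ht e, ← twistMap_cls]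
    have h1 := D.cls_sub_twistMap_mem k (D.factor t) (D.untwist _ (D.factor_spec t) N)
    have h2 := D.cls_sub_twistMap_mem k (1, (D.factor t).2) (D.untwist (D.factor t) (D.factor_spec t) N)
    have h3 := sub_mem h2 h1
    rwa [sub_sub_sub_cancel_left] at h3

/-- Tensoring with a simple module of a parameter in `Γ^×` changes only the `Γ^×`-component, so
`retract`, being multiplicative, kills the ideal. Conversely `x` is congruent to `twistMap 1
(retract x)`. -/
theorem unitIdeal_eq_ker : unitIdeal k σ O D.tensorDefined = LinearMap.ker (D.retract k) := by
  refine le_antisymm (sInf_le ⟨?_, ?_⟩) ?_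
  · rintro _ ⟨t, u, hu, M, S, hS, rfl⟩
    have e := (D.twist_untwist _ (D.factor_spec t) M).symm
    have ht : D.prod (D.factor t) = t := Subtype.ext (D.factor_spec t)
    have h1 := D.wiso_twist_tensor_unit e ⟨u, hu⟩ S hS
    have h2 : D.prod ((D.factor t).1 * ⟨u, hu⟩, (D.factor t).2) = t * u :=
      Subtype.ext ((mul_right_comm _ _ _).trans
        (congrArg (· * (u : Fin n → R)) (D.factor_spec t)))
    rw [SetLike.mem_coe, LinearMap.mem_ker, map_sub, D.retract_cls k ht e, D.retract_cls k h2 h1,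
      sub_self]
  · intro a x hx
    rw [LinearMap.mem_ker] at hx ⊢
    rw [LinearMap.mem_ker, retract_mul, retract_mul, hx, mul_zero, zero_mul]
    exact ⟨rfl, rfl⟩
  · intro x hx
    have h := D.sub_twistMap_retract_mem k x
    rwa [LinearMap.mem_ker.1 hx, map_zero, sub_zero] at h

/-- The isomorphism of the quotient algebra with the algebra of `Γ'`. -/
def quotEquiv : QuotAlg k σ O D.tensorDefined ≃ₗ[ℂ] GrAlg k σ O Γ' (D.tensorDefined.mono D.le) :=
  (Submodule.quotEquivOfEq _ _ (D.unitIdeal_eq_ker k)).trans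
    ((D.retract k).quotKerEquivOfSurjective fun x => ⟨_, D.retract_twistMap k 1 x⟩)

theorem quotEquiv_mk (x : GrAlg k σ O Γ D.tensorDefined) :
    D.quotEquiv k (QuotAlg.mk k σ O D.tensorDefined x) = D.retract k x := rfl

theorem quotEquiv_mul (x y : QuotAlg k σ O D.tensorDefined) :
    D.quotEquiv k (x * y) = D.quotEquiv k x * D.quotEquiv k y := by
  obtain ⟨x, rfl⟩ := Submodule.mkQ_surjective _ x
  obtain ⟨y, rfl⟩ := Submodule.mkQ_surjective _ y
  change D.quotEquiv k (QuotAlg.mk k σ O D.tensorDefined x * QuotAlg.mk k σ O D.tensorDefined y) =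
    D.quotEquiv k (QuotAlg.mk k σ O D.tensorDefined x) * D.quotEquiv k (QuotAlg.mk k σ O D.tensorDefined y)
  rw [← QuotAlg.mk_mul, quotEquiv_mk, quotEquiv_mk, quotEquiv_mk, retract_mul]

/-- The isomorphism of `Γ'` with the quotient monoid. -/
def quotMonoidEquiv : Γ' ≃* (unitCon σ O Γ).Quotient :=
  MulEquiv.ofBijective ((unitCon σ O Γ).mk'.comp (Submonoid.inclusion D.le)) <| by
    constructor
    · intro s t h
      obtain ⟨u, hu, v, hv, e⟩ := (Con.eq _).1 h
      -- The equation `u s = v t` gives two factorizations of one element of `Γ`.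
      have h1 : D.factor (D.prod (⟨v, hv⟩, t)) = (⟨u, hu⟩, s) := D.factor_eq e
      rw [D.factor_eq (p := (⟨v, hv⟩, t)) rfl] at h1
      exact (congrArg Prod.snd h1).symm
    · intro x
      obtain ⟨t, rfl⟩ := Con.mk'_surjective x
      refine ⟨(D.factor t).2, (Con.eq _).2 ⟨_, (D.factor t).1.2, 1, one_mem _, ?_⟩⟩
      rw [one_mul]
      exact D.factor_spec t

theorem quotMonoidEquiv_apply (t : Γ') : D.quotMonoidEquiv t =
    ((Submonoid.inclusion D.le t : Γ) : (unitCon σ O Γ).Quotient) := rfl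

theorem quotMonoidEquiv_factor (t : Γ) :
    D.quotMonoidEquiv (D.factor t).2 = ((t : Γ) : (unitCon σ O Γ).Quotient) := by
  rw [quotMonoidEquiv_apply]
  refine (Con.eq _).2 ⟨_, (D.factor t).1.2, 1, one_mem _, ?_⟩
  rw [one_mul]
  exact D.factor_spec t

theorem map_quotEquiv_grade (t' : Γ') :
    (QuotAlg.grade k σ O D.tensorDefined (D.quotMonoidEquiv t')).map (D.quotEquiv k : _ →ₗ[ℂ] _) =
      GrAlg.grade k σ O (D.tensorDefined.mono D.le) t' := by
  rw [QuotAlg.grade, Submodule.map_iSup]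
  simp_rw [Submodule.map_iSup]
  refine le_antisymm (iSup₂_le fun t ht => ?_) ?_
  -- The degrees in the class of `t'` are exactly those with `Γ'`-component `t'`.
  · rw [← D.quotMonoidEquiv_factor t] at ht
    obtain rfl := D.quotMonoidEquiv.injective ht
    rw [← Submodule.map_comp, GrAlg.grade_eq_span, Submodule.map_span_le]
    rintro _ ⟨N, rfl⟩
    have e := D.twist_untwist _ (D.factor_spec t) N
    have h1 := D.retract_cls k (Subtype.ext (D.factor_spec t)) e.symm
    refine (congrArg (· ∈ GrAlg.grade k σ O (D.tensorDefined.mono D.le) (D.factor t).2) h1).mpr ?_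
    exact GrAlg.cls_mem_grade k _ _ _
  · rw [GrAlg.grade_eq_span, Submodule.span_le]
    rintro _ ⟨M, rfl⟩
    have h1 : ((D.prod (1, t') : Γ) : (unitCon σ O Γ).Quotient) = D.quotMonoidEquiv t' := by
      rw [← D.quotMonoidEquiv_factor, D.factor_eq (p := (1, t')) rfl]
    refine Submodule.mem_iSup_of_mem (D.prod (1, t')) (Submodule.mem_iSup_of_mem h1 ?_)
    have h2 : D.retract k (GrAlg.cls k σ O D.tensorDefined (D.prod (1, t')) (D.twist (1, t') M)) =
        GrAlg.cls k σ O (D.tensorDefined.mono D.le) t' M := D.retract_cls k (p := (1, t')) rfl (WIso.refl _)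
    rw [← h2, ← quotEquiv_mk]
    exact Submodule.mem_map_of_mem (Submodule.mem_map_of_mem (GrAlg.cls_mem_grade k _ _ _))

/-- The isomorphism of the algebra of `Γ` with `ℂ[Γ^×] ⊗ 𝒜(Γ')`. -/
def tensorEquiv : GrAlg k σ O Γ D.tensorDefined ≃ₗ[ℂ] TensorAlg k σ O Γ (D.tensorDefined.mono D.le) :=
  LinearEquiv.ofLinearMap (D.toTensor k) (D.ofTensor k)
    (LinearMap.ext (D.toTensor_ofTensor k)) (LinearMap.ext (D.ofTensor_toTensor k))

theorem map_tensorEquiv_grade (t : Γ) :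
    (GrAlg.grade k σ O D.tensorDefined t).map (D.tensorEquiv k : _ →ₗ[ℂ] _) =
      TensorAlg.grade k σ O Γ (D.tensorDefined.mono D.le) t := by
  refine le_antisymm ?_ ?_
  · rw [GrAlg.grade_eq_span, Submodule.map_span_le]
    rintro _ ⟨N, rfl⟩
    have e := D.twist_untwist _ (D.factor_spec t) N
    exact Submodule.subset_span ⟨_, _, _, D.factor_spec t, GrAlg.cls_mem_grade k _ _ _,
      D.toTensor_cls k (Subtype.ext (D.factor_spec t)) e.symm⟩
  · rw [TensorAlg.grade, Submodule.span_le]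
    rintro _ ⟨u, t', x, h, hx, rfl⟩
    obtain rfl : D.prod (u, t') = t := Subtype.ext h
    refine ⟨D.twistMap k u x, ?_, ?_⟩
    · rw [GrAlg.grade_eq_span] at hx
      induction hx using Submodule.span_induction with
      | mem x hx =>
        obtain ⟨M, rfl⟩ := hx
        rw [D.twistMap_cls k (u, t') M]
        exact GrAlg.cls_mem_grade k _ _ _
      | zero => rw [map_zero]; exact zero_mem _
      | add x y _ _ hx hy => rw [map_add]; exact add_mem hx hy
      | smul z x _ hx => rw [map_smul]; exact Submodule.smul_mem _ z hx
    · rw [← ofTensor_single_tmul]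
      exact D.toTensor_ofTensor k _

end Maps

end SplitData

end TGWATower

end

theorem mainTheorem10 {R : Type*} [CommRing R] [IsDomain R] {n : ℕ}
    (σ : Fin n → RingAut R) (hσ : ∀ i j, Commute (σ i) (σ j))
    (O : Set (MaximalSpectrum R)) (hO : IsTorsionFreeOrbit σ O)
    (Γ Γ' : Submonoid (Fin n → R)) (hΩ : (Γ : Set (Fin n → R)) ⊆ Omega σ)
    (hΓ : TensorDefined σ O Γ) (hle : Γ' ≤ Γ)
    (hsplit : ∀ t ∈ Γ, ∃! p : unitPart σ O Γ × Γ', (p.1 : Fin n → R) * (p.2 : Fin n → R) = t)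
    (k : Kind) :
    (∃ (ι : Γ' ≃* (unitCon σ O Γ).Quotient)
        (e : QuotAlg k σ O hΓ ≃ₗ[ℂ] GrAlg k σ O Γ' (hΓ.mono hle)),
      (∀ t : Γ', ι t = ((Submonoid.inclusion hle t : Γ) : (unitCon σ O Γ).Quotient)) ∧
      (∀ x y, e (x * y) = e x * e y) ∧
      ∀ t : Γ', (QuotAlg.grade k σ O hΓ (ι t)).map (e : _ →ₗ[ℂ] _) =
        GrAlg.grade k σ O (hΓ.mono hle) t) ∧
    (∃ e : GrAlg k σ O Γ hΓ ≃ₗ[ℂ] TensorAlg k σ O Γ (hΓ.mono hle),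
      (∀ x y, e (x * y) = e x * e y) ∧
      ∀ t : Γ, (GrAlg.grade k σ O hΓ t).map (e : _ →ₗ[ℂ] _) =
        TensorAlg.grade k σ O Γ (hΓ.mono hle) t) := by
  let D : SplitData σ O Γ Γ' := ⟨hΩ, hΓ, hle, hsplit,
    fun u => (nonempty_unitData hσ hO (hΩ u.2.1) u.2.2).some⟩
  exact ⟨⟨D.quotMonoidEquiv, D.quotEquiv k, fun _ => rfl, D.quotEquiv_mul k,
    D.map_quotEquiv_grade k⟩, ⟨D.tensorEquiv k, D.toTensor_mul k, D.map_tensorEquiv_grade k⟩⟩
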